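/- **Conventions.** For a Noetherian local ring $A$ of dimension $d>0$ with maximal ideal $\mathfrak m$ and an $\mathfrak m$-primary ideal $J$, the Hilbert coefficients $e_J^0(A),\dots,e_J^d(A)$ are the integers with $$\ell_A(A/J^{m+1})=\sum_{i=0}^{d}(-1)^i e_J^i(A)\binom{m+d-i}{d-i}\qquad (m\gg 0),$$ where $\ell_A$ is length, and $e_J^0(A)$ is the multiplicity. $\overline J$ is the integral closure of $J$. A parameter ideal is an $\mathfrak m$-primary ideal generated by $d$ elements, and $\Lambda(J)=\{e_{\mathfrak q}^1(A) : \mathfrak q \text{ a parameter ideal of } A,\ \overline{\mathfrak q}=\overline J\}$. An element $a\in J$ is superficial for $A$ with respect to $J$ if there is $c$ with $(J^{m+1}:a)\cap J^c=J^m$ for all $m\ge c$. $\mathcal R(J)=A[Jt]\subseteq A[t]$ is the Rees algebra. A scheme is locally Cohen-Macaulay if all its local rings are Cohen-Macaulay. If $\mathfrak q\subseteq J$ is a reduction, $S_{\mathfrak q}(J)=J\mathcal R(J)/J\mathcal R(\mathfrak q)\cong\bigoplus_{m\ge1}J^{m+1}/\mathfrak q^mJ$ is the Sally module, a graded $\mathcal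 R(\mathfrak q)$-module. **Statement.** Let $k$ be a field, $n\ge 2$ an integer, $A=k[[X,Y,Z,W]]/\big[(X^n,Y^n)\cap(Z,W)\big]$, with maximal ideal $\mathfrak m$, and let $x,y,z,w$ be the images of $X,Y,Z,W$ in $A$. Put $\mathfrak c=(x^n,y^n,z,w)$, $$Q=(x^n-z,\ y^n-w),\qquad Q'=(xy^{n-1}-z,\ x^n+y^n-w),\qquad I=\mathfrak m^n+(z,w).$$ Then $\dim A=2$, $\operatorname{depth}A=1$, $H^1_{\mathfrak m}(A)\cong A/\mathfrak c$ as $A$-modules, $Q$ and $Q'$ are parameter ideals of $A$, and the following hold. 1. $\overline Q=\overline{Q'}=\overline{\mathfrak c}=I$. 2. $e_Q^0(A)=e_{Q'}^0(A)=2n^2$. 3. $0>e_{Q'}^1(A)=-n^2+n-1>e_Q^1(A)=-n^2$; hence $\#\Lambda(\mathfrak c)>1$. 4. For all integers $\ell\ge 0$, $$\ell_A(A/Q^{\ell+1})=2n^2\binom{\ell+2}{2}+n^2\binom{\ell+1}{1},\qquad \ell_A(A/Q'^{\,\ell+1})=2n^2\binom{\ell+2}{2}+(n^2-n+1)\binom{\ell+1}{1}.$$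 5. The element $x^n+y^n-w$ is not superficial for $A$ with respect to $Q'$, and the scheme $\operatorname{Proj}\mathcal R(Q')$ is not locally Cohen-Macaulay. 6. Let $T=\mathcal R(Q)$, $T'=\mathcal R(Q')$, $S=S_Q(I)$, $S'=S_{Q'}(I)$. Then $\mathfrak p=\mathfrak mT$ and $\mathfrak p'=\mathfrak mT'$ are prime ideals, the modules $S_{\mathfrak p}$ and $S'_{\mathfrak p'}$ have finite length over $T_{\mathfrak p}$ and $T'_{\mathfrak p'}$, and $$\ell_{T_{\mathfrak p}}(S_{\mathfrak p})=\ell_{T'_{\mathfrak p'}}(S'_{\mathfrak p'})+(n-1).$$ -/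

import Mathlib

open Polynomial

universe u

noncomputable section

/-! ### Lengths, depth, Cohen-Macaulay local rings and schemes -/

/-- The `A`-module `M` has finite length, equal to the integer `c`. -/
def HasLength (A M : Type*) [Ring A] [AddCommGroup M] [Module A M] (c : ℤ) : Prop :=
  ∃ L : ℕ, Module.length A M = L ∧ (L : ℤ) = c

/-- The depth of a (Noetherian) local ring: the supremum of the lengths of the regular sequences
contained in the maximal ideal. -/
def localDepth (R : Type*) [CommRing R] [IsLocalRing R] : ℕ∞ :=
  ⨆ (rs : List R) (_ : (∀ r ∈ rs, r ∈ IsLocalRing.maximalIdeal R) ∧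
    RingTheory.Sequence.IsRegular R rs), (rs.length : ℕ∞)

/-- A local ring is Cohen-Macaulay if it is Noetherian and its depth is its dimension. -/
structure IsCohenMacaulayLocal (R : Type*) [CommRing R] [IsLocalRing R] : Prop where
  noetherian : IsNoetherianRing R
  depth_eq : (localDepth R : WithBot ℕ∞) = ringKrullDim R

/-- A scheme is locally Cohen-Macaulay if all its stalks are Cohen-Macaulay local rings. -/
def IsLocallyCohenMacaulay (X : AlgebraicGeometry.Scheme.{u}) : Prop :=
  ∀ x : X, IsCohenMacaulayLocal (X.presheaf.stalk x)

/-! ### Ideals: integral closure, superficial elements, parameter ideals, Hilbert coefficients -/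

/-- The integral closure of an ideal `I`: all `x` with an equation
`x ^ N + a₁ x ^ (N - 1) + ⋯ + a_N = 0`, `N ≥ 1`, `aᵢ ∈ I ^ i`. -/
def idealIntegralClosure {A : Type*} [CommRing A] (I : Ideal A) : Set A :=
  {x | ∃ N : ℕ, 1 ≤ N ∧ ∃ a : ℕ → A, (∀ i, a i ∈ I ^ i) ∧
    x ^ N + ∑ i ∈ Finset.Icc 1 N, a i * x ^ (N - i) = 0}

/-- `x` is a superficial element for `A` with respect to `I`: `x ∈ I` and there is `c` with
`(I ^ (m + 1) : x) ∩ I ^ c = I ^ m` for all `m ≥ c`. -/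
def IsSuperficial {A : Type*} [CommRing A] (I : Ideal A) (x : A) : Prop :=
  x ∈ I ∧ ∃ c : ℕ, ∀ m ≥ c, ∀ y : A, (x * y ∈ I ^ (m + 1) ∧ y ∈ I ^ c) ↔ y ∈ I ^ m

/-- A parameter ideal of a (Noetherian) local ring of dimension `d`: an ideal generated by `d`
elements whose radical is the maximal ideal. -/
def IsParameterIdeal {A : Type*} [CommRing A] [IsLocalRing A] (Q : Ideal A) : Prop :=
  ∃ d : ℕ, ringKrullDim A = d ∧ (∃ a : Fin d → A, Q = Ideal.span (Set.range a)) ∧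
    Q.radical = IsLocalRing.maximalIdeal A

/-- `c` is the `i`-th Hilbert coefficient `e_I^i(A)`: with `d = dim A` and `i ≤ d`, there are
integers `e₀, …, e_d` with `eᵢ = c` such that
`ℓ(A / I ^ (m + 1)) = ∑ⱼ (-1) ^ j eⱼ binom(m + d - j, d - j)` for all `m ≫ 0`. -/
def IsHilbertCoeff {A : Type*} [CommRing A] (I : Ideal A) (i : ℕ) (c : ℤ) : Prop :=
  ∃ d : ℕ, ringKrullDim A = d ∧ i ≤ d ∧ ∃ e : ℕ → ℤ, e i = c ∧
    ∀ᶠ m : ℕ in Filter.atTop, HasLength A (A ⧸ I ^ (m + 1))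
      (∑ j ∈ Finset.range (d + 1), (-1) ^ j * e j * ((m + (d - j)).choose (d - j) : ℤ))

/-- `Λ(I)`: the set of first Hilbert coefficients of the parameter ideals with the same integral
closure as `I`. -/
def firstCoeffSet {A : Type*} [CommRing A] [IsLocalRing A] (I : Ideal A) : Set ℤ :=
  {c | ∃ Q : Ideal A, IsParameterIdeal Q ∧ idealIntegralClosure Q = idealIntegralClosure I ∧
    IsHilbertCoeff Q 1 c}

/-! ### The grading of the Rees algebra, `Proj`, and the Sally module -/

section Rees

variable {A : Type u} [CommRing A] (I : Ideal A)

/-- The degree `i` component `I ^ i t ^ i` of the Rees algebra `A[It]`. -/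
def reesGrading (i : ℕ) : Submodule A (reesAlgebra I) where
  carrier := {f | ∀ j, j ≠ i → (f : A[X]).coeff j = 0}
  add_mem' {f g} hf hg j hj := by simp [hf j hj, hg j hj]
  zero_mem' := by simp
  smul_mem' a f hf j hj := by simp [hf j hj]

/-- The degree `i` part of an element of the Rees algebra. -/
def reesPart (f : reesAlgebra I) (i : ℕ) : reesGrading I i :=
  ⟨⟨monomial i ((f : A[X]).coeff i), reesAlgebra.monomial_mem.2 (f.2 i)⟩, fun j hj => by
    simp [coeff_monomial, hj.symm]⟩

instance : SetLike.GradedMonoid (reesGrading I) where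
  one_mem j hj := by simp [coeff_one, hj]
  mul_mem i j f g hf hg l hl := by
    simp only [MulMemClass.coe_mul, coeff_mul]
    refine Finset.sum_eq_zero fun p hp => ?_
    by_cases h1 : p.1 = i
    · have h2 : p.2 ≠ j := by
        rintro rfl
        exact hl (by rw [← h1, Finset.HasAntidiagonal.mem_antidiagonal.1 hp])
      rw [hg _ h2, mul_zero]
    · rw [hf _ h1, zero_mul]

lemma reesGrading_coeff_coe (x : DirectSum ℕ fun i => reesGrading I i) (i : ℕ) :
    ((DirectSum.coeAddMonoidHom (reesGrading I) x : reesAlgebra I) : A[X]).coeff i =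
      ((x i : reesAlgebra I) : A[X]).coeff i := by
  induction x using DirectSum.induction_on with
  | zero => simp
  | of j a =>
    rw [DirectSum.coeAddMonoidHom_of]
    by_cases h : j = i
    · subst h; rw [DirectSum.of_eq_same]
    · rw [DirectSum.of_eq_of_ne _ _ _ (Ne.symm h), a.2 i (Ne.symm h)]; simp
  | add a b ha hb => simp [ha, hb]

instance reesGradedRing : GradedRing (reesGrading I) where
  decompose' f := ∑ i ∈ (f : A[X]).support, DirectSum.of (fun i => reesGrading I i) i
    (reesPart I f i)
  left_inv f := by
    apply Subtype.ext
    simp only [map_sum, DirectSum.coeAddMonoidHom_of, AddSubmonoidClass.coe_finsetSum]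
    exact (f : A[X]).sum_monomial_eq
  right_inv x := by
    refine DFinsupp.ext fun i => Subtype.ext (Subtype.ext ?_)
    set f := DirectSum.coeAddMonoidHom (reesGrading I) x with hf
    have h1 : (∑ j ∈ (f : A[X]).support, DirectSum.of (fun i => reesGrading I i) j
        (reesPart I f j)) i = reesPart I f i := by
      rw [DFinsupp.finsetSum_apply]
      rw [Finset.sum_eq_single i]
      · exact DirectSum.of_eq_same _ _
      · intro j _ hj
        exact DirectSum.of_eq_of_ne _ _ _ (Ne.symm hj)
      · intro hi
        rw [DirectSum.of_eq_same]
        apply Subtype.ext; apply Subtype.ext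
        simp [reesPart, notMem_support_iff.1 hi]
    rw [h1]
    ext j
    by_cases h : j = i
    · subst h
      simp [reesPart, hf, reesGrading_coeff_coe]
    · rw [(reesPart I f i).2 j h, (x i).2 j h]

/-- The scheme `Proj` of the Rees algebra `A[It]`. -/
def projRees : AlgebraicGeometry.Scheme.{u} := AlgebraicGeometry.Proj (reesGrading I)

/-- The `A[Qt]`-submodule of `A[t]` generated by the products `a * f` with `a ∈ I` and `f` in the
Rees algebra `A[Jt]`. For `Q ⊆ J` this is `I A[Jt]`. -/
def idealTimesRees (Q I J : Ideal A) : Submodule (reesAlgebra Q) A[X] :=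
  Submodule.span (reesAlgebra Q) {g | ∃ a ∈ I, ∃ f ∈ reesAlgebra J, g = C a * f}

/-- The Sally module `S_Q(I) = I A[It] / I A[Qt]`, a module over `A[Qt]` (for `Q ⊆ I`), realized as
the image of `I A[It]` in `A[t] / I A[Qt]`. -/
abbrev SallyModule (Q I : Ideal A) : Type u :=
  (idealTimesRees Q I I).map (idealTimesRees Q I Q).mkQ

/-- The extension `𝔪 A[Qt]` of the maximal ideal to the Rees algebra. -/
def reesFiberIdeal [IsLocalRing A] (Q : Ideal A) : Ideal (reesAlgebra Q) :=
  (IsLocalRing.maximalIdeal A).map (algebraMap A (reesAlgebra Q))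

/-- `𝔭 = 𝔪 A[Qt]` is a prime ideal, and the localization of the Sally module `S_Q(I)` at `𝔭` has
finite length `r` over `A[Qt]_𝔭`. -/
def HasSallyRank [IsLocalRing A] (Q I : Ideal A) (r : ℤ) : Prop :=
  ∃ _ : (reesFiberIdeal Q).IsPrime,
    HasLength (Localization.AtPrime (reesFiberIdeal Q))
      (LocalizedModule (reesFiberIdeal Q).primeCompl (SallyModule Q I)) r

end Rees

/-! ### The ring of the example -/

section Ring

variable (k : Type u) [Field k] (n : ℕ)

open MvPowerSeries in
/-- The ideal `(X ^ n, Y ^ n) ∩ (Z, W)` of `k[[X, Y, Z, W]]`; the variables are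
`X = X 0`, `Y = X 1`, `Z = X 2`, `W = X 3`. -/
def relIdeal : Ideal (MvPowerSeries (Fin 4) k) :=
  Ideal.span {X 0 ^ n, X 1 ^ n} ⊓ Ideal.span {X 2, X 3}

/-- The ring `k[[X, Y, Z, W]] / ((X ^ n, Y ^ n) ∩ (Z, W))`. -/
abbrev ExRing : Type u := MvPowerSeries (Fin 4) k ⧸ relIdeal k n

/-- The image in the quotient ring of the `i`-th variable. -/
def exVar (i : Fin 4) : ExRing k n := Ideal.Quotient.mk (relIdeal k n) (MvPowerSeries.X i)

lemma relIdeal_ne_top : relIdeal k n ≠ ⊤ := by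
  intro h
  have h1 : relIdeal k n ≤ RingHom.ker (MvPowerSeries.constantCoeff (σ := Fin 4) (R := k)) := by
    refine inf_le_right.trans (Ideal.span_le.2 ?_)
    rintro _ (rfl | rfl) <;> simp
  exact RingHom.ker_ne_top _ (top_le_iff.1 (h ▸ h1))

instance : Nontrivial (ExRing k n) := Ideal.Quotient.nontrivial_iff.2 (relIdeal_ne_top k n)

instance : IsLocalRing (ExRing k n) :=
  IsLocalRing.of_surjective' (Ideal.Quotient.mk (relIdeal k n)) Ideal.Quotient.mk_surjective

end Ring

end

/-!
Write `𝔟 = (x ^ n, y ^ n)`, `𝔷 = (z, w)`, `𝔠 = 𝔟 + 𝔷` in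
`A = k[[X, Y, Z, W]] / ((X ^ n, Y ^ n) ∩ (Z, W))`, and let `a, b` be the two generators of `Q` or of
`Q'`. Since `𝔟 ∩ 𝔷 = 0`, the ring `A` is glued from the two-dimensional Cohen-Macaulay rings `A / 𝔟`
and `A / 𝔷 = k[[x, y]]` along the Artinian ring `A / 𝔠`, and everything is computed on the two pieces.
The colons and colengths needed there are those of monomial ideals, `exIdeal`.

*Local cohomology.* The pair `a, b` of `Q` is regular on both pieces, so `H⁰` and `H¹` of
`A / 𝔟 × A / 𝔷` vanish and `0 → A → A / 𝔟 × A / 𝔷 → A / 𝔠 → 0` gives `H¹(A) ≅ A / 𝔠`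
(`nonempty_localCohomology_one_iso_quotient_sup`). The cocycles of `Hom(P, A)`, for a projective
resolution `P` of `A / 𝔪 ^ t`, are compared with `A / 𝔠` directly.

*Hilbert functions.* As `a, b` is regular modulo `𝔷`, one has `Q ^ s ∩ 𝔷 = 𝔷 Q ^ s`. Hence
`A / Q ^ s` has a filtration whose pieces are computed in `A / 𝔷` and in `A / 𝔟`, where the associated
graded ring of `Q` is a polynomial ring; the linear term of the Hilbert function is
`ℓ(A / (𝔠 + Q))` (`colength_pow_of_isRegularPair`). This is `n ^ 2` for `Q ⊆ 𝔠`, but only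
`n ^ 2 - n + 1` for `Q'`, because `𝔠 + Q' = 𝔠 + (x y ^ (n - 1))`.

*Integral closures.* Both `Q` and `Q'` satisfy `I ^ 3 = Q I ^ 2`, so that `I` is integral over them by
the Cayley-Hamilton theorem; and `I` is integrally closed, being the ideal of the elements whose image
in `k[[X, Y]]` has order at least `n` (`idealIntegralClosure_eq`).

*The generator `b = x ^ n + y ^ n - w` and `Proj`.* With `θ = x y ^ (n - 1)`, `a = θ - z` and
`f = x ^ (n - 2) z (z - 2 θ)`, one has `b f = -a ^ 2 x ^ (n - 2) w` and `𝔪 f ⊆ (a)`, whereas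
`a ^ m f` is not in `Q' ^ (m + 1)`. The first and the last property show that `b` is not superficial
(`not_isSuperficial`). All three together show that `f` represents a socle element modulo the
non-zero-divisor `a` in the local ring of `Proj A[Q't]` at the prime of the elements whose leading
forms vanish along `x = y = w = 0`. So this ring has depth at most one, and it has dimension at least
two (`not_isLocallyCohenMacaulay`).

*Sally modules.* The generators of `Q` map to `-Z, -W` in `k[[Z, W]]`, hence `𝔪 A[Qt]` is the ideal of
the elements whose leading forms in `k[[Z, W]]` vanish, and it is prime
(`reesFiberIdeal_eq_leadingFormIdeal`). Locally at this prime, `a t` and `b t` are units, and the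
Sally module has a composition series given by the classes of `x ^ i y ^ j z t` with `i < n`,
`j < J` and `i + j ≥ n`, where `J = n` for `Q` and `J = n - 1` for `Q'`, as `b t` kills
`x y ^ (n - 1) z t` in the second case (`IsSallyPair.hasSallyRank`). The two index sets differ by
`n - 1` elements.
-/


/-! ### Colengths of ideals -/

section Colength

variable {R : Type*} [CommRing R]

/-- The colength `ℓ(R / J)` of an ideal `J`. -/
noncomputable def Ideal.colength (J : Ideal R) : ℕ∞ := Module.length R (R ⧸ J)

/-- Additivity of length on `0 → R / (J : u) → R / J → R / (J + (u)) → 0`. -/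
lemma Ideal.colength_eq_add_of_colon {J K : Ideal R} (u : R) (hK : ∀ y, y ∈ K ↔ u * y ∈ J) :
    J.colength = K.colength + (J ⊔ Ideal.span {u}).colength := by
  have h1 : K ≤ Submodule.comap (LinearMap.mulLeft R u) J := fun y hy => (hK y).1 hy
  refine Module.length_eq_add_of_exact (Submodule.mapQ K J (LinearMap.mulLeft R u) h1)
    (Submodule.factor (le_sup_left : J ≤ J ⊔ Ideal.span {u})) ?_ (Submodule.factor_surjective _) ?_
  · rw [injective_iff_map_eq_zero]
    intro y
    obtain ⟨y, rfl⟩ := Submodule.Quotient.mk_surjective _ y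
    intro h
    rw [Submodule.mapQ_apply, Submodule.Quotient.mk_eq_zero] at h
    exact (Submodule.Quotient.mk_eq_zero _).2 ((hK y).2 h)
  · intro y
    obtain ⟨y, rfl⟩ := Submodule.Quotient.mk_surjective _ y
    change Submodule.Quotient.mk y = 0 ↔ _
    rw [Submodule.Quotient.mk_eq_zero]
    constructor
    · intro h
      obtain ⟨j, hj, v, hv, rfl⟩ := Submodule.mem_sup.1 h
      obtain ⟨c, rfl⟩ := Ideal.mem_span_singleton'.1 hv
      refine ⟨Submodule.Quotient.mk c, ?_⟩
      rw [Submodule.mapQ_apply]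
      refine (Submodule.Quotient.eq _).2 ?_
      have : LinearMap.mulLeft R u c - (j + c * u) = -j := by
        rw [LinearMap.mulLeft_apply]; ring
      rw [this]
      exact J.neg_mem hj
    · rintro ⟨c, hc⟩
      obtain ⟨c, rfl⟩ := Submodule.Quotient.mk_surjective _ c
      rw [Submodule.mapQ_apply] at hc
      have h2 := (Submodule.Quotient.eq _).1 hc
      have h3 : y = -(LinearMap.mulLeft R u c - y) + c * u := by
        rw [LinearMap.mulLeft_apply]; ring
      rw [h3]
      exact add_mem (Ideal.mem_sup_left (J.neg_mem h2))
        (Ideal.mem_sup_right (Ideal.mem_span_singleton'.2 ⟨c, rfl⟩))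

/-- The colength of the intermediate ideal in `0 → K / J → R / J → R / K → 0`. -/
lemma Ideal.colength_eq_of_le {J K : Ideal R} (h : J ≤ K) :
    J.colength = Module.length R (↥K ⧸ Submodule.comap K.subtype J) + K.colength := by
  refine Module.length_eq_add_of_exact
    (Submodule.mapQ (Submodule.comap K.subtype J) J K.subtype le_rfl)
    (Submodule.factor h) ?_ (Submodule.factor_surjective _) ?_
  · rw [injective_iff_map_eq_zero]
    intro y
    obtain ⟨y, rfl⟩ := Submodule.Quotient.mk_surjective _ y
    intro h
    rw [Submodule.mapQ_apply, Submodule.Quotient.mk_eq_zero] at h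
    exact (Submodule.Quotient.mk_eq_zero _).2 h
  · intro y
    obtain ⟨y, rfl⟩ := Submodule.Quotient.mk_surjective _ y
    change Submodule.Quotient.mk y = 0 ↔ _
    rw [Submodule.Quotient.mk_eq_zero]
    constructor
    · intro hy
      exact ⟨Submodule.Quotient.mk ⟨y, hy⟩, rfl⟩
    · rintro ⟨c, hc⟩
      obtain ⟨c, rfl⟩ := Submodule.Quotient.mk_surjective _ c
      rw [Submodule.mapQ_apply] at hc
      have h2 := h ((Submodule.Quotient.eq _).1 hc)
      have := sub_mem c.2 h2
      simpa using this

/-- If `𝔟 ∩ 𝔷 = 0`, then `(J + 𝔷) / J` and `(𝔟 + 𝔷) / ((J ∩ 𝔷) + 𝔟)` are both isomorphic to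
`𝔷 / (J ∩ 𝔷)`. -/
lemma Ideal.colength_add_colength_sup {J 𝔟 𝔷 : Ideal R} (h : 𝔟 ⊓ 𝔷 = ⊥) :
    ∃ t : ℕ∞, J.colength = t + (J ⊔ 𝔷).colength ∧
      ((J ⊓ 𝔷) ⊔ 𝔟).colength = t + (𝔟 ⊔ 𝔷).colength := by
  refine ⟨Module.length R (𝔷 ⧸ Submodule.comap 𝔷.subtype (J ⊓ 𝔷)), ?_, ?_⟩
  · rw [Ideal.colength_eq_of_le (le_sup_left : J ≤ J ⊔ 𝔷)]
    congr 1
    have e := LinearMap.quotientInfEquivSupQuotient 𝔷 J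
    have e2 := e.length_eq
    rw [sup_comm] at e2
    rw [← e2, ← Submodule.comap_inf, inf_comm]
  · have h1 : (J ⊓ 𝔷) ⊔ 𝔟 ≤ 𝔟 ⊔ 𝔷 := sup_le (inf_le_right.trans le_sup_right) le_sup_left
    rw [Ideal.colength_eq_of_le h1]
    congr 1
    have e := LinearMap.quotientInfEquivSupQuotient 𝔷 ((J ⊓ 𝔷) ⊔ 𝔟)
    have e2 := e.length_eq
    have h3 : 𝔷 ⊔ ((J ⊓ 𝔷) ⊔ 𝔟) = 𝔟 ⊔ 𝔷 := by
      apply le_antisymm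
      · exact sup_le le_sup_right h1
      · exact sup_le (le_sup_right.trans le_sup_right) le_sup_left
    rw [h3] at e2
    rw [← e2]
    have h4 : 𝔷 ⊓ ((J ⊓ 𝔷) ⊔ 𝔟) = J ⊓ 𝔷 := by
      rw [inf_comm, sup_inf_assoc_of_le _ inf_le_right, h, sup_bot_eq]
    rw [← Submodule.comap_inf, h4]

end Colength

/-! ### Powers of an ideal generated by a regular sequence -/

section Koszul

variable {R : Type*} [CommRing R] {𝔟 : Ideal R} {a b : R}

/-- `(b, a)`, in this order, is a regular sequence modulo `𝔟` (the quotient may vanish). -/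
structure IsRegularPair (𝔟 : Ideal R) (a b : R) : Prop where
  fst : ∀ y, b * y ∈ 𝔟 → y ∈ 𝔟
  snd : ∀ y, a * y ∈ 𝔟 ⊔ Ideal.span {b} → y ∈ 𝔟 ⊔ Ideal.span {b}

lemma IsRegularPair.snd_pow (h : IsRegularPair 𝔟 a b) (s : ℕ) :
    ∀ y, a ^ s * y ∈ 𝔟 ⊔ Ideal.span {b} → y ∈ 𝔟 ⊔ Ideal.span {b} := by
  induction s with
  | zero => simp
  | succ s ih => exact fun y hy => ih y (h.snd _ (by rwa [← mul_assoc, ← pow_succ']))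

lemma span_pair_pow_succ (a b : R) (s : ℕ) :
    Ideal.span {a, b} ^ (s + 1) =
      Ideal.span {a ^ (s + 1)} ⊔ Ideal.span {b} * Ideal.span {a, b} ^ s := by
  have h0 : Ideal.span {a, b} = Ideal.span {a} ⊔ Ideal.span {b} := Ideal.span_insert a {b}
  induction s with
  | zero => simp [h0]
  | succ s ih =>
    have e1 : Ideal.span {a, b} ^ (s + 1 + 1) = Ideal.span {a} * Ideal.span {a, b} ^ (s + 1) ⊔
        Ideal.span {b} * Ideal.span {a, b} ^ (s + 1) := by
      rw [pow_succ' _ (s + 1), ← Ideal.sup_mul, ← h0]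
    have e2 : Ideal.span {a} * Ideal.span {a, b} ^ (s + 1) = Ideal.span {a ^ (s + 1 + 1)} ⊔
        Ideal.span {b} * (Ideal.span {a} * Ideal.span {a, b} ^ s) := by
      conv_lhs => rw [ih]
      rw [Ideal.mul_sup, Ideal.span_singleton_mul_span_singleton, ← pow_succ', mul_left_comm]
    rw [e1, e2, sup_assoc]
    congr 1
    refine sup_eq_right.2 (Ideal.mul_mono_right ?_)
    rw [pow_succ']
    exact Ideal.mul_mono_left (Ideal.span_mono (by simp))

lemma mem_span_pair_left (a b : R) : a ∈ Ideal.span ({a, b} : Set R) :=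
  Ideal.subset_span (by simp)

lemma mem_span_pair_right (a b : R) : b ∈ Ideal.span ({a, b} : Set R) :=
  Ideal.subset_span (by simp)

lemma mem_sup_span_singleton {I : Ideal R} {b y : R} :
    y ∈ I ⊔ Ideal.span {b} ↔ ∃ i ∈ I, ∃ c, y = i + b * c := by
  rw [Submodule.mem_sup]
  constructor
  · rintro ⟨i, hi, v, hv, rfl⟩
    obtain ⟨c, rfl⟩ := Ideal.mem_span_singleton'.1 hv
    exact ⟨i, hi, c, by rw [mul_comm b]⟩
  · rintro ⟨i, hi, c, rfl⟩
    exact ⟨i, hi, _, Ideal.mul_mem_right _ _ (Ideal.mem_span_singleton_self b), rfl⟩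

lemma mem_mul_span_pair_pow_succ {𝔢 : Ideal R} {a b y : R} {s : ℕ} :
    y ∈ 𝔢 * Ideal.span {a, b} ^ (s + 1) ↔
      ∃ e ∈ 𝔢, ∃ q ∈ 𝔢 * Ideal.span {a, b} ^ s, y = a ^ (s + 1) * e + b * q := by
  rw [span_pair_pow_succ, Ideal.mul_sup, mul_left_comm, Submodule.mem_sup]
  constructor
  · rintro ⟨u, hu, v, hv, rfl⟩
    obtain ⟨e, he, rfl⟩ := Ideal.mem_mul_span_singleton.1 hu
    obtain ⟨q, hq, rfl⟩ := Ideal.mem_span_singleton_mul.1 hv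
    exact ⟨e, he, q, hq, by ring⟩
  · rintro ⟨e, he, q, hq, rfl⟩
    exact ⟨_, Ideal.mem_mul_span_singleton.2 ⟨e, he, rfl⟩, _,
      Ideal.mem_span_singleton_mul.2 ⟨q, hq, rfl⟩, by ring⟩

/-- The colon by `b` of `𝔢 Q ^ (s + 1)`, for `Q = (a, b)` and `b ∈ 𝔢`, modulo `𝔟`. -/
lemma IsRegularPair.mem_mul_pow_iff (h : IsRegularPair 𝔟 a b) {𝔢 : Ideal R} (hb : b ∈ 𝔢) (s : ℕ)
    (y : R) : y ∈ (𝔢 ⊔ Ideal.span {a, b}) * Ideal.span {a, b} ^ s ⊔ 𝔟 ↔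
      b * y ∈ 𝔢 * Ideal.span {a, b} ^ (s + 1) ⊔ 𝔟 := by
  set Q := Ideal.span {a, b} with hQ
  have hbQ : b ∈ Q := mem_span_pair_right a b
  have haQ : a ∈ Q := mem_span_pair_left a b
  constructor
  · intro hy
    have h1 : Ideal.span {b} * ((𝔢 ⊔ Q) * Q ^ s ⊔ 𝔟) ≤ 𝔢 * Q ^ (s + 1) ⊔ 𝔟 := by
      rw [Ideal.mul_sup, Ideal.sup_mul, Ideal.mul_sup]
      refine sup_le (sup_le ?_ ?_) (Ideal.mul_le_right.trans le_sup_right)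
      · refine le_trans ?_ le_sup_left
        rw [mul_left_comm, pow_succ']
        exact Ideal.mul_mono_right (Ideal.mul_mono_left ((Ideal.span_singleton_le_iff_mem _).2 hbQ))
      · refine le_trans ?_ le_sup_left
        rw [← pow_succ']
        exact Ideal.mul_mono_left ((Ideal.span_singleton_le_iff_mem _).2 hb)
    exact h1 (Ideal.mul_mem_mul (Ideal.mem_span_singleton_self b) hy)
  · intro hy
    obtain ⟨u, hu, β, hβ, hy⟩ := Submodule.mem_sup.1 hy
    obtain ⟨e, he, q, hq, rfl⟩ := mem_mul_span_pair_pow_succ.1 hu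
    have h1 : a ^ (s + 1) * e ∈ 𝔟 ⊔ Ideal.span {b} :=
      mem_sup_span_singleton.2 ⟨-β, 𝔟.neg_mem hβ, y - q, by linear_combination hy⟩
    -- `a` is regular modulo `(b) + 𝔟`, so `e = β' + b c`; cancelling `b` gives `y ≡ a ^ (s + 1) c + q`
    obtain ⟨β', hβ', c, rfl⟩ := mem_sup_span_singleton.1 (h.snd_pow _ _ h1)
    have h2 : b * (y - a ^ (s + 1) * c - q) ∈ 𝔟 := by
      have : b * (y - a ^ (s + 1) * c - q) = a ^ (s + 1) * β' + β := by linear_combination -hy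
      rw [this]
      exact add_mem (𝔟.mul_mem_left _ hβ') hβ
    have h3 : y = (a ^ (s + 1) * c + q) + (y - a ^ (s + 1) * c - q) := by ring
    rw [h3]
    refine add_mem (Ideal.mem_sup_left ?_) (Ideal.mem_sup_right (h.fst _ h2))
    rw [Ideal.sup_mul]
    refine add_mem (Ideal.mem_sup_right ?_) (Ideal.mem_sup_left hq)
    rw [← pow_succ']
    exact Ideal.mul_mem_right _ _ (Ideal.pow_mem_pow haQ _)

/-- Filtering by the powers of `a`: the colon by `a` of `𝔢 a ^ (s + 1) + (b) + 𝔟` is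
`𝔢 a ^ s + (b) + 𝔟`. -/
lemma IsRegularPair.colength_mul_span_pow (h : IsRegularPair 𝔟 a b) {𝔢 : Ideal R} (hb : b ∈ 𝔢)
    (s : ℕ) : (𝔢 * Ideal.span {a ^ s} ⊔ Ideal.span {b} ⊔ 𝔟).colength =
      s * (Ideal.span {a, b} ⊔ 𝔟).colength + (𝔢 ⊔ 𝔟).colength := by
  induction s with
  | zero =>
    have : 𝔢 ⊔ Ideal.span {b} = 𝔢 := sup_eq_left.2 ((Ideal.span_singleton_le_iff_mem _).2 hb)
    simp [this]
  | succ s ih =>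
    have hcolon : ∀ y, y ∈ 𝔢 * Ideal.span {a ^ s} ⊔ Ideal.span {b} ⊔ 𝔟 ↔
        a * y ∈ 𝔢 * Ideal.span {a ^ (s + 1)} ⊔ Ideal.span {b} ⊔ 𝔟 := by
      intro y
      rw [sup_assoc, sup_assoc, sup_comm _ 𝔟]
      constructor
      · intro hy
        obtain ⟨u, hu, v, hv, rfl⟩ := Submodule.mem_sup.1 hy
        obtain ⟨e, he, rfl⟩ := Ideal.mem_mul_span_singleton.1 hu
        rw [mul_add]
        exact add_mem (Ideal.mem_sup_left (Ideal.mem_mul_span_singleton.2 ⟨e, he, by ring⟩))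
          (Ideal.mem_sup_right (Ideal.mul_mem_left _ _ hv))
      · intro hy
        obtain ⟨u, hu, v, hv, hy⟩ := Submodule.mem_sup.1 hy
        obtain ⟨e, he, rfl⟩ := Ideal.mem_mul_span_singleton.1 hu
        have h1 : y - e * a ^ s ∈ 𝔟 ⊔ Ideal.span {b} := by
          apply h.snd
          have : a * (y - e * a ^ s) = v := by linear_combination -hy
          rwa [this]
        have h2 : y = e * a ^ s + (y - e * a ^ s) := by ring
        rw [h2]
        exact add_mem (Ideal.mem_sup_left (Ideal.mem_mul_span_singleton.2 ⟨e, he, rfl⟩))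
          (Ideal.mem_sup_right h1)
    rw [Ideal.colength_eq_add_of_colon a hcolon, ih]
    have e1 : 𝔢 * Ideal.span {a ^ (s + 1)} ⊔ Ideal.span {b} ⊔ 𝔟 ⊔ Ideal.span {a} =
        Ideal.span {a, b} ⊔ 𝔟 := by
      rw [Ideal.span_insert]
      apply le_antisymm
      · refine sup_le (sup_le (sup_le ?_ ?_) le_sup_right) (le_sup_left.trans le_sup_left)
        · refine Ideal.mul_le_right.trans (le_trans ?_ (le_sup_left.trans le_sup_left))
          rw [Ideal.span_singleton_le_iff_mem, pow_succ']
          exact Ideal.mul_mem_right _ _ (Ideal.mem_span_singleton_self a)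
        · exact le_sup_right.trans le_sup_left
      · exact sup_le (sup_le le_sup_right (le_sup_right.trans (le_sup_left.trans le_sup_left)))
          (le_sup_right.trans le_sup_left)
    rw [e1]
    push_cast
    ring

/-- Additivity of length for multiplication by `b`: the colon by `b` is computed in
`IsRegularPair.mem_mul_pow_iff`, and modulo `b` only the power `a ^ (s + 1)` survives. -/
lemma IsRegularPair.colength_mul_pow_succ (h : IsRegularPair 𝔟 a b) {𝔢 : Ideal R} (hb : b ∈ 𝔢)
    (s : ℕ) : (𝔢 * Ideal.span {a, b} ^ (s + 1) ⊔ 𝔟).colength =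
      ((𝔢 ⊔ Ideal.span {a, b}) * Ideal.span {a, b} ^ s ⊔ 𝔟).colength +
      ((s + 1 : ℕ) * (Ideal.span {a, b} ⊔ 𝔟).colength + (𝔢 ⊔ 𝔟).colength) := by
  rw [Ideal.colength_eq_add_of_colon b (h.mem_mul_pow_iff hb s), ← h.colength_mul_span_pow hb]
  congr 2
  rw [span_pair_pow_succ, Ideal.mul_sup]
  apply le_antisymm
  · refine sup_le (sup_le (sup_le ?_ ?_) le_sup_right) (le_sup_right.trans le_sup_left)
    · exact le_sup_left.trans le_sup_left
    · exact (Ideal.mul_le_right.trans Ideal.mul_le_left).trans (le_sup_right.trans le_sup_left)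
  · exact sup_le (sup_le (le_sup_left.trans (le_sup_left.trans le_sup_left)) le_sup_right)
      (le_sup_right.trans le_sup_left)

/-- The Hilbert function of `𝔡 Q ^ j` modulo `𝔟`, for `Q = (a, b) ⊆ 𝔡`: the associated graded ring
of `Q` is a polynomial ring in two variables. -/
lemma IsRegularPair.colength_mul_pow (h : IsRegularPair 𝔟 a b) {𝔡 : Ideal R}
    (hd : Ideal.span {a, b} ≤ 𝔡) (j : ℕ) : (𝔡 * Ideal.span {a, b} ^ j ⊔ 𝔟).colength =
      (j + 1 : ℕ) * (𝔡 ⊔ 𝔟).colength +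
        ((j + 1).choose 2 : ℕ) * (Ideal.span {a, b} ⊔ 𝔟).colength := by
  induction j with
  | zero => simp
  | succ j ih =>
    rw [h.colength_mul_pow_succ (hd (mem_span_pair_right a b)), sup_eq_left.2 hd, ih,
      Nat.choose_succ_succ' (j + 1) 1, Nat.choose_one_right]
    push_cast
    ring

lemma IsRegularPair.colength_pow (h : IsRegularPair 𝔟 a b) (j : ℕ) :
    (Ideal.span {a, b} ^ (j + 1) ⊔ 𝔟).colength =
      ((j + 2).choose 2 : ℕ) * (Ideal.span {a, b} ⊔ 𝔟).colength := by
  rw [pow_succ', h.colength_mul_pow le_rfl, Nat.choose_succ_succ' (j + 1) 1, Nat.choose_one_right]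
  push_cast
  ring

/-- `Q ^ s ∩ 𝔷 = 𝔷 Q ^ s` if the generators of `Q = (a, b)` form a regular sequence modulo `𝔷`. -/
lemma IsRegularPair.mem_mul_pow_of_mem_pow {𝔷 : Ideal R} (h : IsRegularPair 𝔷 a b) (s : ℕ) :
    ∀ {f : R}, f ∈ Ideal.span {a, b} ^ s → f ∈ 𝔷 → f ∈ 𝔷 * Ideal.span {a, b} ^ s := by
  induction s with
  | zero => simp
  | succ s ih =>
    intro f hf hz
    have hf' : f ∈ (⊤ : Ideal R) * Ideal.span {a, b} ^ (s + 1) := by rwa [Ideal.top_mul]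
    obtain ⟨r, -, q, hq, rfl⟩ := mem_mul_span_pair_pow_succ.1 hf'
    rw [Ideal.top_mul] at hq
    have h1 : a ^ (s + 1) * r ∈ 𝔷 ⊔ Ideal.span {b} :=
      mem_sup_span_singleton.2 ⟨_, hz, -q, by ring⟩
    obtain ⟨ζ, hζ, c, rfl⟩ := mem_sup_span_singleton.1 (h.snd_pow _ _ h1)
    have h2 : b * (q + a ^ (s + 1) * c) ∈ 𝔷 := by
      have : b * (q + a ^ (s + 1) * c) =
        (a ^ (s + 1) * (ζ + b * c) + b * q) - a ^ (s + 1) * ζ := by ring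
      rw [this]
      exact sub_mem hz (𝔷.mul_mem_left _ hζ)
    have h3 : q + a ^ (s + 1) * c ∈ Ideal.span {a, b} ^ s := by
      refine add_mem hq (Ideal.mul_mem_right _ _ ?_)
      exact Ideal.pow_le_pow_right (Nat.le_succ s)
        (Ideal.pow_mem_pow (mem_span_pair_left a b) _)
    exact mem_mul_span_pair_pow_succ.2 ⟨ζ, hζ, _, ih h3 (h.fst _ h2), by ring⟩

lemma IsRegularPair.pow_inf_eq {𝔷 : Ideal R} (h : IsRegularPair 𝔷 a b) (s : ℕ) :
    Ideal.span {a, b} ^ s ⊓ 𝔷 = 𝔷 * Ideal.span {a, b} ^ s :=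
  le_antisymm (fun _ hf => h.mem_mul_pow_of_mem_pow s hf.1 hf.2)
    (le_inf Ideal.mul_le_right Ideal.mul_le_left)

end Koszul


/-! ### Monomial ideals of power series rings -/

namespace MvPowerSeries

variable {σ R : Type*} [CommRing R]

/-- The ideal of the power series in which no monomial `X ^ d` with `d i < α i` for all `i` occurs.
If `σ` is finite, it is generated by the powers `X i ^ α i` with `α i ≠ ⊤`. -/
def monoIdeal (R : Type*) [CommRing R] (α : σ → ℕ∞) : Ideal (MvPowerSeries σ R) where
  carrier := {f | ∀ d : σ →₀ ℕ, (∀ i, (d i : ℕ∞) < α i) → coeff d f = 0}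
  add_mem' hf hg d hd := by rw [map_add, hf d hd, hg d hd, add_zero]
  zero_mem' d _ := by simp
  smul_mem' c f hf d hd := by
    classical
    rw [smul_eq_mul, coeff_mul]
    refine Finset.sum_eq_zero fun p hp => ?_
    rw [hf p.2 fun i => lt_of_le_of_lt ?_ (hd i), mul_zero]
    rw [← Finset.HasAntidiagonal.mem_antidiagonal.1 hp]
    exact_mod_cast Nat.le_add_left _ _

lemma mem_monoIdeal {α : σ → ℕ∞} {f : MvPowerSeries σ R} :
    f ∈ monoIdeal R α ↔ ∀ d : σ →₀ ℕ, (∀ i, (d i : ℕ∞) < α i) → coeff d f = 0 := Iff.rfl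

lemma monoIdeal_top : monoIdeal R (fun _ : σ => (⊤ : ℕ∞)) = ⊥ := by
  rw [eq_bot_iff]
  intro f hf
  ext d
  exact hf d fun i => ENat.natCast_lt_top _

lemma monoIdeal_anti {α β : σ → ℕ∞} (h : α ≤ β) : monoIdeal R β ≤ monoIdeal R α :=
  fun _ hf d hd => hf d fun i => (hd i).trans_le (h i)

lemma coeff_X_pow_mul_eq [DecidableEq σ] (i : σ) (r : ℕ) (f : MvPowerSeries σ R) (d : σ →₀ ℕ) :
    coeff d (X i ^ r * f) = if r ≤ d i then coeff (d - Finsupp.single i r) f else 0 := by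
  rw [X_pow_eq, coeff_monomial_mul, one_mul]
  simp only [Finsupp.single_le_iff]

/-- The colon ideal of a monomial ideal by a power of a variable. -/
lemma X_pow_mul_mem_monoIdeal [DecidableEq σ] {α : σ → ℕ∞} {f : MvPowerSeries σ R} (i : σ) (r : ℕ) :
    X i ^ r * f ∈ monoIdeal R α ↔ f ∈ monoIdeal R (Function.update α i (α i - r)) := by
  constructor
  · intro h d hd
    have h1 := h (d + Finsupp.single i r) fun j => ?_
    · rw [coeff_X_pow_mul_eq, if_pos (by simp)] at h1
      simpa using h1
    · have h2 := hd j
      by_cases hj : j = i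
      · subst hj
        rw [Function.update_self] at h2
        simp only [Finsupp.coe_add, Pi.add_apply, Finsupp.single_eq_same, Nat.cast_add]
        exact lt_tsub_iff_right.1 h2
      · rw [Function.update_of_ne hj] at h2
        simpa [Finsupp.single_apply, Ne.symm hj] using h2
  · intro h d hd
    rw [coeff_X_pow_mul_eq]
    split_ifs with hr
    · refine h _ fun j => ?_
      by_cases hj : j = i
      · subst hj
        rw [Function.update_self]
        refine lt_tsub_iff_right.2 ?_
        have : (d - Finsupp.single j r) j + r = d j := by simp [hr]
        exact_mod_cast this ▸ hd j
      · rw [Function.update_of_ne hj]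
        simpa [Finsupp.single_apply, Ne.symm hj] using hd j
    · rfl

lemma monoIdeal_eq_sup [DecidableEq σ] {α : σ → ℕ∞} (i : σ) (r : ℕ) (h : α i = r) :
    monoIdeal R α = monoIdeal R (Function.update α i ⊤) ⊔ Ideal.span {X i ^ r} := by
  apply le_antisymm
  · intro f hf
    let g : MvPowerSeries σ R := fun d => if d i < r then coeff d f else 0
    have hg : ∀ d, coeff d g = if d i < r then coeff d f else 0 := fun d => rfl
    have h1 : g ∈ monoIdeal R (Function.update α i ⊤) := by
      intro d hd
      rw [hg]
      split_ifs with hr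
      · refine hf d fun j => ?_
        by_cases hj : j = i
        · subst hj; rw [h]; exact_mod_cast hr
        · simpa [hj] using hd j
      · rfl
    have h2 : (X i : MvPowerSeries σ R) ^ r ∣ f - g := by
      rw [X_pow_dvd_iff]
      intro d hd
      rw [map_sub, hg, if_pos hd, sub_self]
    have h3 : f = g + (f - g) := by ring
    rw [h3]
    exact add_mem (Ideal.mem_sup_left h1) (Ideal.mem_sup_right (Ideal.mem_span_singleton.2 h2))
  · refine sup_le (monoIdeal_anti fun j => ?_) ?_
    · by_cases hj : j = i
      · subst hj; simp
      · simp [hj]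
    · rw [Ideal.span_singleton_le_iff_mem]
      intro d hd
      rw [← mul_one (X i ^ r), coeff_X_pow_mul_eq, if_neg]
      have := hd i
      rw [h] at this
      exact not_le.2 (by exact_mod_cast this)

end MvPowerSeries

/-! ### Monomial ideals of the ring `A` -/

section ExRing

open MvPowerSeries

variable (k : Type u) [Field k] (n : ℕ)

/-- The image in `A` of the monomial ideal with exponents `p`, `q`, `r`, `s`. -/
noncomputable def exIdeal (p q r s : ℕ∞) : Ideal (ExRing k n) :=
  (monoIdeal k ![p, q, r, s]).map (Ideal.Quotient.mk (relIdeal k n))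

/-- The monomial ideal with exponents `p`, `q`, `r`, `s` contains one of the two ideals
`(X ^ n, Y ^ n)` and `(Z, W)`, hence the ideal of relations. -/
def IsAdmissible (n : ℕ) (p q r s : ℕ∞) : Prop := (p ≤ n ∧ q ≤ n) ∨ (r ≤ 1 ∧ s ≤ 1)

variable {k n} {p q r s : ℕ∞}

lemma update_vec0 (a : ℕ∞) : Function.update ![p, q, r, s] 0 a = ![a, q, r, s] := by
  ext i; fin_cases i <;> rfl
lemma update_vec1 (a : ℕ∞) : Function.update ![p, q, r, s] 1 a = ![p, a, r, s] := by
  ext i; fin_cases i <;> rfl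
lemma update_vec2 (a : ℕ∞) : Function.update ![p, q, r, s] 2 a = ![p, q, a, s] := by
  ext i; fin_cases i <;> rfl
lemma update_vec3 (a : ℕ∞) : Function.update ![p, q, r, s] 3 a = ![p, q, r, a] := by
  ext i; fin_cases i <;> rfl

lemma exIdeal_sup0 (p : ℕ) :
    exIdeal k n p q r s = exIdeal k n ⊤ q r s ⊔ Ideal.span {exVar k n 0 ^ p} := by
  rw [exIdeal, monoIdeal_eq_sup 0 p rfl, Ideal.map_sup, update_vec0, Ideal.map_span,
    Set.image_singleton, map_pow]
  rfl
lemma exIdeal_sup1 (q : ℕ) :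
    exIdeal k n p q r s = exIdeal k n p ⊤ r s ⊔ Ideal.span {exVar k n 1 ^ q} := by
  rw [exIdeal, monoIdeal_eq_sup 1 q rfl, Ideal.map_sup, update_vec1, Ideal.map_span,
    Set.image_singleton, map_pow]
  rfl
lemma exIdeal_sup2 (r : ℕ) :
    exIdeal k n p q r s = exIdeal k n p q ⊤ s ⊔ Ideal.span {exVar k n 2 ^ r} := by
  rw [exIdeal, monoIdeal_eq_sup 2 r rfl, Ideal.map_sup, update_vec2, Ideal.map_span,
    Set.image_singleton, map_pow]
  rfl
lemma exIdeal_sup3 (s : ℕ) :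
    exIdeal k n p q r s = exIdeal k n p q r ⊤ ⊔ Ideal.span {exVar k n 3 ^ s} := by
  rw [exIdeal, monoIdeal_eq_sup 3 s rfl, Ideal.map_sup, update_vec3, Ideal.map_span,
    Set.image_singleton, map_pow]
  rfl

lemma exIdeal_top : exIdeal k n ⊤ ⊤ ⊤ ⊤ = ⊥ := by
  have : ![(⊤ : ℕ∞), ⊤, ⊤, ⊤] = fun _ => ⊤ := by ext i; fin_cases i <;> rfl
  rw [exIdeal, this, monoIdeal_top, Ideal.map_bot]

lemma exIdeal_xy (p q : ℕ) :
    exIdeal k n p q ⊤ ⊤ = Ideal.span {exVar k n 0 ^ p, exVar k n 1 ^ q} := by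
  rw [exIdeal_sup0, exIdeal_sup1, exIdeal_top, bot_sup_eq, Ideal.span_insert, sup_comm]

lemma exIdeal_zw : exIdeal k n ⊤ ⊤ 1 1 = Ideal.span {exVar k n 2, exVar k n 3} := by
  have h2 := exIdeal_sup2 (k := k) (n := n) (p := ⊤) (q := ⊤) (s := 1) 1
  have h3 := exIdeal_sup3 (k := k) (n := n) (p := ⊤) (q := ⊤) (r := ⊤) 1
  simp only [Nat.cast_one, pow_one] at h2 h3
  rw [h2, h3, exIdeal_top, bot_sup_eq, Ideal.span_insert, sup_comm]

lemma exIdeal_one_one : exIdeal k n p q 1 1 = exIdeal k n p q ⊤ ⊤ ⊔ exIdeal k n ⊤ ⊤ 1 1 := by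
  have h2 := exIdeal_sup2 (k := k) (n := n) (p := p) (q := q) (s := 1) 1
  have h3 := exIdeal_sup3 (k := k) (n := n) (p := p) (q := q) (r := ⊤) 1
  simp only [Nat.cast_one, pow_one] at h2 h3
  rw [h2, h3, exIdeal_zw, Ideal.span_insert, sup_assoc, sup_comm (Ideal.span _)]

lemma exIdeal_anti {p' q' r' s' : ℕ∞} (hp : p' ≤ p) (hq : q' ≤ q) (hr : r' ≤ r) (hs : s' ≤ s) :
    exIdeal k n p q r s ≤ exIdeal k n p' q' r' s' := by
  refine Ideal.map_mono (monoIdeal_anti fun i => ?_)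
  fin_cases i <;> assumption

lemma span_XY_eq : Ideal.span {(X 0 : MvPowerSeries (Fin 4) k) ^ n, X 1 ^ n} =
    monoIdeal k ![n, n, ⊤, ⊤] := by
  have : ![(⊤ : ℕ∞), ⊤, ⊤, ⊤] = fun _ => ⊤ := by ext i; fin_cases i <;> rfl
  rw [monoIdeal_eq_sup 0 n rfl, update_vec0, monoIdeal_eq_sup 1 n rfl, update_vec1, this,
    monoIdeal_top, bot_sup_eq, Ideal.span_insert, sup_comm]

lemma span_ZW_eq : Ideal.span {(X 2 : MvPowerSeries (Fin 4) k), X 3} =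
    monoIdeal k ![⊤, ⊤, 1, 1] := by
  have : ![(⊤ : ℕ∞), ⊤, ⊤, ⊤] = fun _ => ⊤ := by ext i; fin_cases i <;> rfl
  rw [monoIdeal_eq_sup 2 1 (by simp), update_vec2, monoIdeal_eq_sup 3 1 (by simp), update_vec3,
    this, monoIdeal_top, bot_sup_eq, Ideal.span_insert, sup_comm, pow_one, pow_one]

lemma relIdeal_eq :
    relIdeal k n = monoIdeal k ![n, n, ⊤, ⊤] ⊓ monoIdeal k ![⊤, ⊤, 1, 1] := by
  rw [relIdeal, span_XY_eq, span_ZW_eq]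

lemma IsAdmissible.relIdeal_le (h : IsAdmissible n p q r s) :
    relIdeal k n ≤ monoIdeal k ![p, q, r, s] := by
  rw [relIdeal_eq]
  rcases h with h | h
  · refine inf_le_left.trans (monoIdeal_anti fun i => ?_)
    fin_cases i
    exacts [h.1, h.2, le_top, le_top]
  · refine inf_le_right.trans (monoIdeal_anti fun i => ?_)
    fin_cases i
    exacts [le_top, le_top, h.1, h.2]

lemma IsAdmissible.mk_mem (h : IsAdmissible n p q r s) {F : MvPowerSeries (Fin 4) k} :
    Ideal.Quotient.mk (relIdeal k n) F ∈ exIdeal k n p q r s ↔ F ∈ monoIdeal k ![p, q, r, s] :=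
  Ideal.mem_quotient_iff_mem h.relIdeal_le

lemma IsAdmissible.x_pow_mul_mem (h : IsAdmissible n p q r s) {f : ExRing k n} (t : ℕ) :
    exVar k n 0 ^ t * f ∈ exIdeal k n p q r s ↔ f ∈ exIdeal k n (p - t) q r s := by
  obtain ⟨F, rfl⟩ := Ideal.Quotient.mk_surjective f
  have h' : IsAdmissible n (p - t) q r s := h.imp_left (And.imp_left tsub_le_self.trans)
  rw [h'.mk_mem, exVar, ← map_pow, ← map_mul, h.mk_mem, X_pow_mul_mem_monoIdeal, update_vec0]
  rfl
lemma IsAdmissible.y_pow_mul_mem (h : IsAdmissible n p q r s) {f : ExRing k n} (t : ℕ) :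
    exVar k n 1 ^ t * f ∈ exIdeal k n p q r s ↔ f ∈ exIdeal k n p (q - t) r s := by
  obtain ⟨F, rfl⟩ := Ideal.Quotient.mk_surjective f
  have h' : IsAdmissible n p (q - t) r s := h.imp_left (And.imp_right tsub_le_self.trans)
  rw [h'.mk_mem, exVar, ← map_pow, ← map_mul, h.mk_mem, X_pow_mul_mem_monoIdeal, update_vec1]
  rfl
lemma IsAdmissible.z_pow_mul_mem (h : IsAdmissible n p q r s) {f : ExRing k n} (t : ℕ) :
    exVar k n 2 ^ t * f ∈ exIdeal k n p q r s ↔ f ∈ exIdeal k n p q (r - t) s := by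
  obtain ⟨F, rfl⟩ := Ideal.Quotient.mk_surjective f
  have h' : IsAdmissible n p q (r - t) s := h.imp_right (And.imp_left tsub_le_self.trans)
  rw [h'.mk_mem, exVar, ← map_pow, ← map_mul, h.mk_mem, X_pow_mul_mem_monoIdeal, update_vec2]
  rfl
lemma IsAdmissible.w_pow_mul_mem (h : IsAdmissible n p q r s) {f : ExRing k n} (t : ℕ) :
    exVar k n 3 ^ t * f ∈ exIdeal k n p q r s ↔ f ∈ exIdeal k n p q r (s - t) := by
  obtain ⟨F, rfl⟩ := Ideal.Quotient.mk_surjective f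
  have h' : IsAdmissible n p q r (s - t) := h.imp_right (And.imp_right tsub_le_self.trans)
  rw [h'.mk_mem, exVar, ← map_pow, ← map_mul, h.mk_mem, X_pow_mul_mem_monoIdeal, update_vec3]
  rfl

variable (k n)

/-- The two ideals `(x ^ n, y ^ n)` and `(z, w)` of `A` intersect in zero. -/
lemma exIdeal_inf_eq_bot : exIdeal k n n n ⊤ ⊤ ⊓ exIdeal k n ⊤ ⊤ 1 1 = ⊥ := by
  rw [eq_bot_iff]
  rintro f ⟨h1, h2⟩
  obtain ⟨F, rfl⟩ := Ideal.Quotient.mk_surjective f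
  have a1 : IsAdmissible n n n ⊤ ⊤ := Or.inl ⟨le_rfl, le_rfl⟩
  have a2 : IsAdmissible n ⊤ ⊤ 1 1 := Or.inr ⟨le_rfl, le_rfl⟩
  refine Ideal.Quotient.eq_zero_iff_mem.2 ?_
  rw [relIdeal_eq]
  exact ⟨a1.mk_mem.1 h1, a2.mk_mem.1 h2⟩

lemma exIdeal_one : exIdeal k n 1 1 1 1 = IsLocalRing.maximalIdeal (ExRing k n) := by
  have a1 : IsAdmissible n 1 1 1 1 := Or.inr ⟨le_rfl, le_rfl⟩
  have : monoIdeal k ![1, 1, 1, 1] = RingHom.ker (constantCoeff (σ := Fin 4) (R := k)) := by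
    ext F
    rw [mem_monoIdeal, RingHom.mem_ker, ← coeff_zero_eq_constantCoeff_apply]
    constructor
    · intro h
      exact h 0 fun i => by fin_cases i <;> simp
    · intro h d hd
      have : d = 0 := by
        ext i
        have := hd i
        fin_cases i <;> simpa using this
      rwa [this]
  have hm : (exIdeal k n 1 1 1 1).IsMaximal := by
    rw [exIdeal, this]
    have hmax : (RingHom.ker (constantCoeff (σ := Fin 4) (R := k))).IsMaximal :=
      RingHom.ker_isMaximal_of_surjective _ (fun c => ⟨MvPowerSeries.C c, by simp⟩)
    rcases Ideal.map_eq_top_or_isMaximal_of_surjective (Ideal.Quotient.mk (relIdeal k n))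
      Ideal.Quotient.mk_surjective hmax with h | h
    · rw [← this] at h
      have h1 : (1 : ExRing k n) ∈ exIdeal k n 1 1 1 1 := by
        rw [exIdeal]
        exact h.symm ▸ Submodule.mem_top
      rw [← map_one (Ideal.Quotient.mk (relIdeal k n)), a1.mk_mem] at h1
      have := h1 0 fun i => by fin_cases i <;> simp
      simp at this
    · exact h
  exact IsLocalRing.eq_maximalIdeal hm

lemma colength_exIdeal_one : (exIdeal k n 1 1 1 1).colength = 1 := by
  rw [exIdeal_one, Ideal.colength, Module.length_eq_one_iff]
  exact isSimpleModule_iff_isCoatom.2 (Ideal.isMaximal_def.1 inferInstance)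

lemma colength_exIdeal (p q : ℕ) : (exIdeal k n p q 1 1).colength = p * q := by
  have adm : ∀ p q : ℕ∞, IsAdmissible n p q 1 1 := fun p q => Or.inr ⟨le_rfl, le_rfl⟩
  have hy : ∀ q : ℕ, (exIdeal k n 1 q 1 1).colength = q := by
    intro q
    induction q with
    | zero =>
      have : exIdeal k n 1 (0 : ℕ) 1 1 = ⊤ := by
        rw [exIdeal_sup1, pow_zero, Ideal.span_singleton_one, sup_top_eq]
      rw [this, Ideal.colength]
      simp
    | succ q ih =>
      rw [Ideal.colength_eq_add_of_colon (K := exIdeal k n 1 q 1 1) (exVar k n 1), ih]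
      · have : exIdeal k n 1 (q + 1 : ℕ) 1 1 ⊔ Ideal.span {exVar k n 1} = exIdeal k n 1 1 1 1 := by
          have h1 := exIdeal_sup1 (k := k) (n := n) (p := 1) (r := 1) (s := 1) 1
          rw [pow_one, Nat.cast_one] at h1
          rw [exIdeal_sup1, h1, sup_assoc]
          congr 1
          refine sup_eq_right.2 ((Ideal.span_singleton_le_span_singleton).2 ?_)
          exact dvd_pow_self _ (Nat.succ_ne_zero _)
        rw [this, colength_exIdeal_one]
        push_cast; rfl
      · intro f
        have := (adm 1 (q + 1 : ℕ)).y_pow_mul_mem (k := k) (f := f) 1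
        rw [pow_one, ← ENat.natCast_sub, Nat.add_sub_cancel] at this
        exact this.symm
  induction p with
  | zero =>
    have : exIdeal k n (0 : ℕ) q 1 1 = ⊤ := by
      rw [exIdeal_sup0, pow_zero, Ideal.span_singleton_one, sup_top_eq]
    rw [this, Ideal.colength]
    simp
  | succ p ih =>
    rw [Ideal.colength_eq_add_of_colon (K := exIdeal k n p q 1 1) (exVar k n 0), ih]
    · have : exIdeal k n (p + 1 : ℕ) q 1 1 ⊔ Ideal.span {exVar k n 0} = exIdeal k n 1 q 1 1 := by
        have h1 := exIdeal_sup0 (k := k) (n := n) (q := q) (r := 1) (s := 1) 1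
        rw [pow_one, Nat.cast_one] at h1
        rw [exIdeal_sup0, h1, sup_assoc]
        congr 1
        refine sup_eq_right.2 ((Ideal.span_singleton_le_span_singleton).2 ?_)
        exact dvd_pow_self _ (Nat.succ_ne_zero _)
      rw [this, hy]
      push_cast; ring
    · intro f
      have := (adm (p + 1 : ℕ) q).x_pow_mul_mem (k := k) (f := f) 1
      rw [pow_one, ← ENat.natCast_sub, Nat.add_sub_cancel] at this
      exact this.symm

end ExRing


section Koszul

variable {R : Type*} [CommRing R]

/-- The Hilbert function of `Q = (a, b)` in a ring with ideals `𝔟 ∩ 𝔷 = 0` modulo both of which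
the generators of `Q` are regular sequences. As `Q ^ s ∩ 𝔷 = 𝔷 Q ^ s`, the colength of `Q ^ s` is
computed modulo `𝔷` and modulo `𝔟`; the linear term is governed by the colength `δ` of
`𝔟 + 𝔷 + Q`. -/
lemma colength_pow_of_isRegularPair {𝔟 𝔷 : Ideal R} {a b : R} (h : 𝔟 ⊓ 𝔷 = ⊥)
    (hbr : IsRegularPair 𝔟 a b)
    (hzr : IsRegularPair 𝔷 a b ∨ IsRegularPair 𝔷 b a) (hb : b ∈ 𝔟 ⊔ 𝔷) {m δ : ℕ}
    (h1 : (Ideal.span {a, b} ⊔ 𝔟).colength = m) (h2 : (Ideal.span {a, b} ⊔ 𝔷).colength = m)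
    (h3 : (𝔟 ⊔ 𝔷).colength = m) (h4 : (𝔟 ⊔ 𝔷 ⊔ Ideal.span {a, b}).colength = δ) (s : ℕ) :
    (Ideal.span {a, b} ^ (s + 1)).colength = (2 * m * (s + 2).choose 2 + δ * (s + 1) : ℕ) := by
  set Q := Ideal.span {a, b} with hQ
  have hswap : Ideal.span {b, a} = Q := by rw [Set.pair_comm]
  have e1 : (Q ^ (s + 1) ⊔ 𝔷).colength = ((s + 2).choose 2 : ℕ) * m := by
    rcases hzr with hzr | hzr
    · rw [hzr.colength_pow, h2]
    · rw [← hswap, hzr.colength_pow, hswap, h2]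
  have e2 : Q ^ (s + 1) ⊓ 𝔷 = 𝔷 * Q ^ (s + 1) := by
    rcases hzr with hzr | hzr
    · exact hzr.pow_inf_eq _
    · rw [← hswap]; exact hzr.pow_inf_eq _
  have e3 : (Q ^ (s + 1) ⊓ 𝔷) ⊔ 𝔟 = (𝔟 ⊔ 𝔷) * Q ^ (s + 1) ⊔ 𝔟 := by
    rw [e2, Ideal.sup_mul, sup_comm (𝔟 * _), sup_assoc,
      sup_eq_right.2 (Ideal.mul_le_left : 𝔟 * Q ^ (s + 1) ≤ 𝔟)]
  -- `t` is the length of `𝔷 / (Q ^ (s + 1) ∩ 𝔷)`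
  obtain ⟨t, ht1, ht2⟩ := Ideal.colength_add_colength_sup (J := Q ^ (s + 1)) h
  have e4 : 𝔟 ⊔ 𝔷 ⊔ 𝔟 = 𝔟 ⊔ 𝔷 := sup_eq_left.2 le_sup_left
  have e5 : 𝔟 ⊔ 𝔷 ⊔ Q ⊔ 𝔟 = 𝔟 ⊔ 𝔷 ⊔ Q := sup_eq_left.2 (le_sup_left.trans le_sup_left)
  rw [e3, hbr.colength_mul_pow_succ hb, hbr.colength_mul_pow le_sup_right, ← hQ, h1, h3, e4, e5,
    h3, h4] at ht2
  have ht : t ≠ ⊤ := by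
    rintro rfl
    rw [top_add] at ht2
    exact ENat.natCast_ne_top ((s + 1) * δ + (s + 1).choose 2 * m + ((s + 1) * m + m))
      (by exact_mod_cast ht2)
  lift t to ℕ using ht
  rw [ht1, e1]
  have ht3 : (s + 1) * δ + (s + 1).choose 2 * m + ((s + 1) * m + m) = t + m := by
    exact_mod_cast ht2
  have h5 := Nat.choose_succ_succ' (s + 1) 1
  rw [Nat.choose_one_right] at h5
  have h6 : t = (s + 1) * δ + (s + 2).choose 2 * m := by
    have : s + 1 + 1 = s + 2 := rfl
    rw [← this, h5, add_mul]
    simp only [Nat.reduceAdd]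
    linarith
  rw [h6]
  norm_cast
  ring

lemma sup_span_singleton_congr {I : Ideal R} {b b' : R} (h : b - b' ∈ I) :
    I ⊔ Ideal.span {b} = I ⊔ Ideal.span {b'} := by
  apply le_antisymm
  · refine sup_le le_sup_left ((Ideal.span_singleton_le_iff_mem _).2 ?_)
    exact mem_sup_span_singleton.2 ⟨_, h, 1, by ring⟩
  · refine sup_le le_sup_left ((Ideal.span_singleton_le_iff_mem _).2 ?_)
    exact mem_sup_span_singleton.2 ⟨_, I.neg_mem h, 1, by ring⟩

lemma sup_span_pair_congr {I : Ideal R} {a b a' b' : R} (ha : a - a' ∈ I) (hb : b - b' ∈ I) :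
    Ideal.span {a, b} ⊔ I = Ideal.span {a', b'} ⊔ I := by
  rw [Ideal.span_insert, Ideal.span_insert, sup_comm, ← sup_assoc, sup_span_singleton_congr ha,
    sup_right_comm, sup_span_singleton_congr hb, sup_right_comm, sup_assoc, sup_comm]

end Koszul

/-! ### The two parameter ideals: regularity and colengths -/

section Pairs

variable (k : Type u) [Field k] (n : ℕ)

local notation "𝐱" => exVar k n 0
local notation "𝐲" => exVar k n 1
local notation "𝐳" => exVar k n 2
local notation "𝐰" => exVar k n 3
local notation "𝔟" => exIdeal k n n n ⊤ ⊤
local notation "𝔷" => exIdeal k n ⊤ ⊤ 1 1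

lemma xn_mem : 𝐱 ^ n ∈ 𝔟 := by rw [exIdeal_xy]; exact mem_span_pair_left _ _
lemma yn_mem : 𝐲 ^ n ∈ 𝔟 := by rw [exIdeal_xy]; exact mem_span_pair_right _ _
lemma z_mem : 𝐳 ∈ 𝔷 := by rw [exIdeal_zw]; exact mem_span_pair_left _ _
lemma w_mem : 𝐰 ∈ 𝔷 := by rw [exIdeal_zw]; exact mem_span_pair_right _ _

variable {k n} in
lemma mul_eq_zero_of_mem {f g : ExRing k n} (hf : f ∈ 𝔟) (hg : g ∈ 𝔷) : f * g = 0 := by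
  have : f * g ∈ 𝔟 ⊓ 𝔷 := ⟨Ideal.mul_mem_right _ _ hf, Ideal.mul_mem_left _ _ hg⟩
  rwa [exIdeal_inf_eq_bot] at this

lemma xn_mul_z : 𝐱 ^ n * 𝐳 = 0 := mul_eq_zero_of_mem (xn_mem k n) (z_mem k n)
lemma xn_mul_w : 𝐱 ^ n * 𝐰 = 0 := mul_eq_zero_of_mem (xn_mem k n) (w_mem k n)
lemma yn_mul_z : 𝐲 ^ n * 𝐳 = 0 := mul_eq_zero_of_mem (yn_mem k n) (z_mem k n)
lemma yn_mul_w : 𝐲 ^ n * 𝐰 = 0 := mul_eq_zero_of_mem (yn_mem k n) (w_mem k n)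

lemma adm_xy {r s : ℕ∞} : IsAdmissible n n n r s := Or.inl ⟨le_rfl, le_rfl⟩
lemma adm_zw {p q : ℕ∞} : IsAdmissible n p q 1 1 := Or.inr ⟨le_rfl, le_rfl⟩

lemma exIdeal_xyw : 𝔟 ⊔ Ideal.span {𝐰} = exIdeal k n n n ⊤ 1 := by
  have := exIdeal_sup3 (k := k) (n := n) (p := n) (q := n) (r := ⊤) 1
  rw [pow_one, Nat.cast_one] at this
  exact this.symm

lemma exIdeal_xyzw : 𝔟 ⊔ 𝔷 = exIdeal k n n n 1 1 := exIdeal_one_one.symm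

/-- Modulo `𝔟 = (x ^ n, y ^ n)` the sequence `w, z ^ 2` is regular, and `b ≡ -w`, while `z ^ 2` is a
multiple of `a` modulo `𝔟 + (w)`. -/
lemma isRegularPair_xy_aux {a b : ExRing k n} (hb : b + 𝐰 ∈ 𝔟)
    (ha : ∃ c, c * a - 𝐳 ^ 2 ∈ exIdeal k n n n ⊤ 1) : IsRegularPair 𝔟 a b := by
  have hs : 𝔟 ⊔ Ideal.span {b} = exIdeal k n n n ⊤ 1 := by
    rw [← exIdeal_xyw, ← Ideal.span_singleton_neg 𝐰]
    exact sup_span_singleton_congr (by simpa using hb)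
  refine ⟨fun f hf => ?_, fun f hf => ?_⟩
  · have h1 : 𝐰 ^ 1 * f ∈ 𝔟 := by
      have : 𝐰 ^ 1 * f = f * (b + 𝐰) - b * f := by ring
      rw [this]
      exact sub_mem (Ideal.mul_mem_left _ _ hb) hf
    simpa using ((adm_xy n).w_pow_mul_mem 1).1 h1
  · rw [hs] at hf ⊢
    obtain ⟨c, hc⟩ := ha
    have h1 : 𝐳 ^ 2 * f ∈ exIdeal k n n n ⊤ 1 := by
      have : 𝐳 ^ 2 * f = c * (a * f) - f * (c * a - 𝐳 ^ 2) := by ring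
      rw [this]
      exact sub_mem (Ideal.mul_mem_left _ _ hf) (Ideal.mul_mem_left _ _ hc)
    simpa using ((adm_xy n).z_pow_mul_mem 2).1 h1

/-- The square of `x y ^ (n - 1)` vanishes modulo `(x ^ n, y ^ n)` since `2 (n - 1) ≥ n`. -/
lemma theta_sq_mem (hn : 2 ≤ n) : (𝐱 * 𝐲 ^ (n - 1)) ^ 2 ∈ 𝔟 := by
  have h : (n - 1) * 2 = n + (n - 2) := by omega
  rw [mul_pow, ← pow_mul, h, pow_add, mul_left_comm]
  exact Ideal.mul_mem_right _ _ (yn_mem k n)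

/-- Modulo `(x ^ n, y ^ n)` the generators of `Q` become `-z` and `-w`. -/
lemma isRegularPair_Q_xy : IsRegularPair 𝔟 (𝐱 ^ n - 𝐳) (𝐲 ^ n - 𝐰) := by
  refine isRegularPair_xy_aux k n (by simpa using yn_mem k n) ⟨-𝐳, ?_⟩
  have : -𝐳 * (𝐱 ^ n - 𝐳) - 𝐳 ^ 2 = 0 := by linear_combination -xn_mul_z k n
  rw [this]
  exact zero_mem _

/-- Modulo `(x ^ n, y ^ n)` the element `x y ^ (n - 1)` is nilpotent of square zero, so `z ^ 2`
is a multiple of the first generator of `Q'`, while the second one becomes `-w`. -/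
lemma isRegularPair_Q'_xy (hn : 2 ≤ n) :
    IsRegularPair 𝔟 (𝐱 * 𝐲 ^ (n - 1) - 𝐳) (𝐱 ^ n + 𝐲 ^ n - 𝐰) := by
  refine isRegularPair_xy_aux k n ?_ ⟨-(𝐱 * 𝐲 ^ (n - 1) + 𝐳), ?_⟩
  · simpa using add_mem (xn_mem k n) (yn_mem k n)
  · have : -(𝐱 * 𝐲 ^ (n - 1) + 𝐳) * (𝐱 * 𝐲 ^ (n - 1) - 𝐳) - 𝐳 ^ 2 = -(𝐱 * 𝐲 ^ (n - 1)) ^ 2 := by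
      ring
    rw [this]
    exact neg_mem (exIdeal_anti le_rfl le_rfl le_rfl le_top (theta_sq_mem k n hn))

/-- Modulo `(z, w)` the generators of `Q` become `x ^ n` and `y ^ n`. -/
lemma isRegularPair_Q_zw : IsRegularPair 𝔷 (𝐱 ^ n - 𝐳) (𝐲 ^ n - 𝐰) := by
  have hs : 𝔷 ⊔ Ideal.span {𝐲 ^ n - 𝐰} = exIdeal k n ⊤ n 1 1 := by
    rw [exIdeal_sup1]
    exact sup_span_singleton_congr (by simpa using w_mem k n)
  refine ⟨fun f hf => ?_, fun f hf => ?_⟩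
  · have h1 : 𝐲 ^ n * f ∈ 𝔷 := by
      have : 𝐲 ^ n * f = (𝐲 ^ n - 𝐰) * f + f * 𝐰 := by ring
      rw [this]
      exact add_mem hf (Ideal.mul_mem_left _ _ (w_mem k n))
    simpa using ((adm_zw n).y_pow_mul_mem n).1 h1
  · rw [hs] at hf ⊢
    have h1 : 𝐱 ^ n * f ∈ exIdeal k n ⊤ n 1 1 := by
      have : 𝐱 ^ n * f = (𝐱 ^ n - 𝐳) * f + f * 𝐳 := by ring
      rw [this]
      exact add_mem hf (Ideal.mul_mem_left _ _
        (exIdeal_anti le_rfl le_top le_rfl le_rfl (z_mem k n)))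
    simpa using ((adm_zw n).x_pow_mul_mem n).1 h1

lemma theta_mul_mem_zw {f : ExRing k n} {m : ℕ} (h : 𝐱 * 𝐲 ^ m * f ∈ 𝔷) : f ∈ 𝔷 := by
  rw [mul_assoc] at h
  have h1 := ((adm_zw n).x_pow_mul_mem (k := k) (f := 𝐲 ^ m * f) 1).1 (by rwa [pow_one])
  simpa using ((adm_zw n).y_pow_mul_mem m).1 h1

/-- `x` is regular modulo `(x ^ n + y ^ n, z, w)`. -/
lemma x_mul_mem_sup {f : ExRing k n} (hn : 1 ≤ n) (h : 𝐱 * f ∈ 𝔷 ⊔ Ideal.span {𝐱 ^ n + 𝐲 ^ n}) :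
    f ∈ 𝔷 ⊔ Ideal.span {𝐱 ^ n + 𝐲 ^ n} := by
  obtain ⟨ζ, hζ, g, hg⟩ := mem_sup_span_singleton.1 h
  have hx : ∀ {g : ExRing k n}, g ∈ exIdeal k n 1 ⊤ 1 1 ↔ g ∈ 𝔷 ⊔ Ideal.span {𝐱} := by
    have := exIdeal_sup0 (k := k) (n := n) (q := ⊤) (r := 1) (s := 1) 1
    rw [pow_one, Nat.cast_one] at this
    rw [this]
    simp
  have h1 : 𝐲 ^ n * g ∈ exIdeal k n 1 ⊤ 1 1 := by
    rw [hx]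
    refine mem_sup_span_singleton.2 ⟨-ζ, neg_mem hζ, f - 𝐱 ^ (n - 1) * g, ?_⟩
    have h2 : 𝐱 ^ n = 𝐱 * 𝐱 ^ (n - 1) := by rw [← pow_succ']; congr 1; omega
    linear_combination -hg - g * h2
  have h2 := ((adm_zw n).y_pow_mul_mem n).1 h1
  rw [ENat.top_sub_natCast, hx] at h2
  obtain ⟨ζ', hζ', g', rfl⟩ := mem_sup_span_singleton.1 h2
  refine mem_sup_span_singleton.2 ⟨f - (𝐱 ^ n + 𝐲 ^ n) * g', ?_, g', by ring⟩
  refine theta_mul_mem_zw k n (m := 0) ?_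
  have : 𝐱 * 𝐲 ^ 0 * (f - (𝐱 ^ n + 𝐲 ^ n) * g') = ζ + (𝐱 ^ n + 𝐲 ^ n) * ζ' := by
    linear_combination hg
  rw [this]
  exact add_mem hζ (Ideal.mul_mem_left _ _ hζ')

/-- Modulo `(z, w)` the generators of `Q'` become `x y ^ (n - 1)` and `x ^ n + y ^ n`. They are taken in
this order: `x` and `y` are regular modulo `(z, w)`, and `x ^ n + y ^ n` is congruent to `y ^ n` modulo
`x` and to `x ^ n` modulo `y ^ (n - 1)`. -/
lemma isRegularPair_Q'_zw (hn : 2 ≤ n) :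
    IsRegularPair 𝔷 (𝐱 ^ n + 𝐲 ^ n - 𝐰) (𝐱 * 𝐲 ^ (n - 1) - 𝐳) := by
  have hs : 𝔷 ⊔ Ideal.span {𝐱 * 𝐲 ^ (n - 1) - 𝐳} = 𝔷 ⊔ Ideal.span {𝐱 * 𝐲 ^ (n - 1)} :=
    sup_span_singleton_congr (by simpa using z_mem k n)
  have hyn : 𝐲 ^ n = 𝐲 ^ (n - 1) * 𝐲 := by rw [← pow_succ]; congr 1; omega
  refine ⟨fun f hf => ?_, fun f hf => ?_⟩
  · refine theta_mul_mem_zw k n (m := n - 1) ?_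
    have : 𝐱 * 𝐲 ^ (n - 1) * f = (𝐱 * 𝐲 ^ (n - 1) - 𝐳) * f + f * 𝐳 := by ring
    rw [this]
    exact add_mem hf (Ideal.mul_mem_left _ _ (z_mem k n))
  · rw [hs] at hf ⊢
    obtain ⟨ζ, hζ, g, hg⟩ := mem_sup_span_singleton.1 hf
    have hx : ∀ {g : ExRing k n}, g ∈ exIdeal k n 1 ⊤ 1 1 ↔ g ∈ 𝔷 ⊔ Ideal.span {𝐱} := by
      have := exIdeal_sup0 (k := k) (n := n) (q := ⊤) (r := 1) (s := 1) 1
      rw [pow_one, Nat.cast_one] at this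
      rw [this]
      simp
    have hxn : 𝐱 ^ n = 𝐱 * 𝐱 ^ (n - 1) := by rw [← pow_succ']; congr 1; omega
    -- modulo `x`: `y ^ n f` vanishes, hence `f` is a multiple `x f1`
    have h1 : 𝐲 ^ n * f ∈ exIdeal k n 1 ⊤ 1 1 := by
      rw [hx]
      refine mem_sup_span_singleton.2 ⟨ζ + 𝐰 * f, add_mem hζ (Ideal.mul_mem_right _ _ (w_mem k n)),
        𝐲 ^ (n - 1) * g - 𝐱 ^ (n - 1) * f, ?_⟩
      linear_combination hg - f * hxn
    have h2 := ((adm_zw n).y_pow_mul_mem n).1 h1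
    rw [ENat.top_sub_natCast, hx] at h2
    obtain ⟨ζ', hζ', f1, rfl⟩ := mem_sup_span_singleton.1 h2
    -- cancel `x`, and argue modulo `y ^ (n - 1)`: `x ^ n f1` vanishes, hence so does `f1`
    have h3 : (𝐱 ^ n + 𝐲 ^ n) * f1 - 𝐲 ^ (n - 1) * g ∈ 𝔷 := by
      refine theta_mul_mem_zw k n (m := 0) ?_
      have : 𝐱 * 𝐲 ^ 0 * ((𝐱 ^ n + 𝐲 ^ n) * f1 - 𝐲 ^ (n - 1) * g) =
          ζ + (𝐱 * f1) * 𝐰 - (𝐱 ^ n + 𝐲 ^ n - 𝐰) * ζ' := by linear_combination hg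
      rw [this]
      exact sub_mem (add_mem hζ (Ideal.mul_mem_left _ _ (w_mem k n))) (Ideal.mul_mem_left _ _ hζ')
    have hy : ∀ {g : ExRing k n}, g ∈ exIdeal k n ⊤ (n - 1 : ℕ) 1 1 ↔
        g ∈ 𝔷 ⊔ Ideal.span {𝐲 ^ (n - 1)} := by rw [exIdeal_sup1]
    have h4 : 𝐱 ^ n * f1 ∈ exIdeal k n ⊤ (n - 1 : ℕ) 1 1 := by
      rw [hy]
      exact mem_sup_span_singleton.2 ⟨_, h3, g - 𝐲 * f1, by linear_combination -f1 * hyn⟩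
    have h5 := ((adm_zw n).x_pow_mul_mem n).1 h4
    rw [ENat.top_sub_natCast, hy] at h5
    obtain ⟨ζ'', hζ'', f2, rfl⟩ := mem_sup_span_singleton.1 h5
    exact mem_sup_span_singleton.2 ⟨ζ' + 𝐱 * ζ'', add_mem hζ' (Ideal.mul_mem_left _ _ hζ''), f2,
      by ring⟩

lemma colength_c : (𝔟 ⊔ 𝔷).colength = (n ^ 2 : ℕ) := by
  rw [exIdeal_xyzw, colength_exIdeal]; push_cast; ring

lemma span_Q_sup_xy : Ideal.span {𝐱 ^ n - 𝐳, 𝐲 ^ n - 𝐰} ⊔ 𝔟 = 𝔟 ⊔ 𝔷 := by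
  rw [sup_span_pair_congr (a' := -𝐳) (b' := -𝐰) (by simpa using xn_mem k n)
    (by simpa using yn_mem k n), exIdeal_zw, sup_comm, Ideal.span_insert, Ideal.span_insert,
    Ideal.span_singleton_neg, Ideal.span_singleton_neg]

lemma span_Q_sup_zw : Ideal.span {𝐱 ^ n - 𝐳, 𝐲 ^ n - 𝐰} ⊔ 𝔷 = 𝔟 ⊔ 𝔷 := by
  rw [sup_span_pair_congr (a' := 𝐱 ^ n) (b' := 𝐲 ^ n) (by simpa using z_mem k n)
    (by simpa using w_mem k n), exIdeal_xy]

lemma span_Q_le : Ideal.span {𝐱 ^ n - 𝐳, 𝐲 ^ n - 𝐰} ≤ 𝔟 ⊔ 𝔷 := by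
  rw [← span_Q_sup_xy]; exact le_sup_left

/-- The Hilbert function of `Q`. -/
lemma colength_Q_pow (s : ℕ) : (Ideal.span {𝐱 ^ n - 𝐳, 𝐲 ^ n - 𝐰} ^ (s + 1)).colength =
    (2 * n ^ 2 * (s + 2).choose 2 + n ^ 2 * (s + 1) : ℕ) := by
  refine colength_pow_of_isRegularPair (exIdeal_inf_eq_bot k n) (isRegularPair_Q_xy k n)
    (Or.inl (isRegularPair_Q_zw k n)) ?_ ?_ ?_ (colength_c k n) ?_ s
  · exact span_Q_le k n (mem_span_pair_right _ _)
  · rw [span_Q_sup_xy, colength_c]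
  · rw [span_Q_sup_zw, colength_c]
  · rw [sup_eq_left.2 (span_Q_le k n), colength_c]

/-- The colength of `(x y ^ (n - 1), x ^ n + y ^ n)` in `k[[x, y]]`: the colon by `x` is
`(x ^ n, y ^ (n - 1))`, and the sum with `(x)` is `(x, y ^ n)`. -/
lemma colength_Q'_sup_zw (hn : 2 ≤ n) :
    (Ideal.span {𝐱 * 𝐲 ^ (n - 1) - 𝐳, 𝐱 ^ n + 𝐲 ^ n - 𝐰} ⊔ 𝔷).colength = (n ^ 2 : ℕ) := by
  have hyn : 𝐲 ^ n = 𝐲 ^ (n - 1) * 𝐲 := by rw [← pow_succ]; congr 1; omega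
  have hxn : 𝐱 ^ n = 𝐱 * 𝐱 ^ (n - 1) := by rw [← pow_succ']; congr 1; omega
  rw [sup_span_pair_congr (a' := 𝐱 * 𝐲 ^ (n - 1)) (b' := 𝐱 ^ n + 𝐲 ^ n) (by simpa using z_mem k n)
    (by simpa using w_mem k n), sup_comm, Ideal.span_insert, sup_comm (Ideal.span _), ← sup_assoc]
  have e1 : 𝔷 ⊔ Ideal.span {𝐱 ^ n + 𝐲 ^ n} ⊔ Ideal.span {𝐲 ^ (n - 1)} =
      exIdeal k n n (n - 1 : ℕ) 1 1 := by
    rw [exIdeal_sup0, exIdeal_sup1, sup_right_comm]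
    refine sup_span_singleton_congr ?_
    exact mem_sup_span_singleton.2 ⟨0, zero_mem _, 𝐲, by linear_combination hyn⟩
  have e2 : 𝔷 ⊔ Ideal.span {𝐱 ^ n + 𝐲 ^ n} ⊔ Ideal.span {𝐱} = exIdeal k n (1 : ℕ) n 1 1 := by
    rw [exIdeal_sup1, exIdeal_sup0, pow_one, sup_right_comm]
    refine sup_span_singleton_congr ?_
    exact mem_sup_span_singleton.2 ⟨0, zero_mem _, 𝐱 ^ (n - 1), by linear_combination hxn⟩
  have e3 : 𝔷 ⊔ Ideal.span {𝐱 ^ n + 𝐲 ^ n} ⊔ Ideal.span {𝐱 * 𝐲 ^ (n - 1)} ⊔ Ideal.span {𝐱} =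
      𝔷 ⊔ Ideal.span {𝐱 ^ n + 𝐲 ^ n} ⊔ Ideal.span {𝐱} := by
    rw [sup_assoc]
    congr 1
    exact sup_eq_right.2 ((Ideal.span_singleton_le_span_singleton).2 (dvd_mul_right _ _))
  rw [Ideal.colength_eq_add_of_colon
    (K := 𝔷 ⊔ Ideal.span {𝐱 ^ n + 𝐲 ^ n} ⊔ Ideal.span {𝐲 ^ (n - 1)}) 𝐱, e3, e2, e1,
    colength_exIdeal, colength_exIdeal]
  · norm_cast
    obtain ⟨m, rfl⟩ := Nat.exists_eq_add_of_le' (le_trans one_le_two hn)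
    simp only [Nat.add_sub_cancel]; ring
  · intro f
    rw [mem_sup_span_singleton, mem_sup_span_singleton]
    constructor
    · rintro ⟨i, hi, c, rfl⟩
      exact ⟨𝐱 * i, Ideal.mul_mem_left _ _ hi, c, by ring⟩
    · rintro ⟨i, hi, c, hc⟩
      refine ⟨f - 𝐲 ^ (n - 1) * c, x_mul_mem_sup k n (by omega) ?_, c, by ring⟩
      have : 𝐱 * (f - 𝐲 ^ (n - 1) * c) = i := by linear_combination hc
      rwa [this]

lemma theta_mul_mem_iff (hn : 2 ≤ n) (f : ExRing k n) :
    f ∈ exIdeal k n (n - 1 : ℕ) (1 : ℕ) 1 1 ↔ 𝐱 * 𝐲 ^ (n - 1) * f ∈ 𝔟 ⊔ 𝔷 := by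
  rw [exIdeal_xyzw, mul_assoc]
  have h1 := (adm_zw n (p := n) (q := n)).x_pow_mul_mem (k := k) (f := 𝐲 ^ (n - 1) * f) 1
  rw [pow_one] at h1
  rw [h1, (adm_zw n).y_pow_mul_mem (n - 1), ← ENat.natCast_sub, ← ENat.natCast_sub]
  have : n - (n - 1) = 1 := by omega
  rw [this]

/-- The colength of `𝔠 + (x y ^ (n - 1))`, which is the linear term of the Hilbert function of `Q'`. The
colon of `𝔠` by `x y ^ (n - 1)` is `(x ^ (n - 1), y, z, w)`, of colength `n - 1`. -/
lemma colength_c_sup_theta (hn : 2 ≤ n) :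
    (𝔟 ⊔ 𝔷 ⊔ Ideal.span {𝐱 * 𝐲 ^ (n - 1)}).colength = (n ^ 2 - n + 1 : ℕ) := by
  have h1 := Ideal.colength_eq_add_of_colon (𝐱 * 𝐲 ^ (n - 1)) (theta_mul_mem_iff k n hn)
  rw [colength_c, colength_exIdeal] at h1
  have hfin : (𝔟 ⊔ 𝔷 ⊔ Ideal.span {𝐱 * 𝐲 ^ (n - 1)}).colength ≠ ⊤ := by
    intro h
    rw [h, add_top] at h1
    exact ENat.natCast_ne_top _ h1
  lift (𝔟 ⊔ 𝔷 ⊔ Ideal.span {𝐱 * 𝐲 ^ (n - 1)}).colength to ℕ using hfin with c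
  norm_cast at h1 ⊢
  have : n ≤ n ^ 2 := Nat.le_self_pow two_ne_zero n
  omega

lemma span_Q'_sup_c : 𝔟 ⊔ 𝔷 ⊔ Ideal.span {𝐱 * 𝐲 ^ (n - 1) - 𝐳, 𝐱 ^ n + 𝐲 ^ n - 𝐰} =
    𝔟 ⊔ 𝔷 ⊔ Ideal.span {𝐱 * 𝐲 ^ (n - 1)} := by
  rw [sup_comm, sup_span_pair_congr (a' := 𝐱 * 𝐲 ^ (n - 1)) (b' := 0), sup_comm, Ideal.span_insert]
  · simp
  · simpa using Ideal.mem_sup_right (z_mem k n)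
  · rw [sub_zero]
    exact sub_mem (Ideal.mem_sup_left (add_mem (xn_mem k n) (yn_mem k n)))
      (Ideal.mem_sup_right (w_mem k n))

/-- The colength of `Q' + (x ^ n, y ^ n)`: the colon by `z` is the colon of `𝔠` by
`x y ^ (n - 1)`. -/
lemma colength_Q'_sup_xy (hn : 2 ≤ n) :
    (Ideal.span {𝐱 * 𝐲 ^ (n - 1) - 𝐳, 𝐱 ^ n + 𝐲 ^ n - 𝐰} ⊔ 𝔟).colength = (n ^ 2 : ℕ) := by
  have e0 : Ideal.span {𝐱 * 𝐲 ^ (n - 1) - 𝐳, 𝐱 ^ n + 𝐲 ^ n - 𝐰} ⊔ 𝔟 =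
      exIdeal k n n n ⊤ 1 ⊔ Ideal.span {𝐱 * 𝐲 ^ (n - 1) - 𝐳} := by
    rw [sup_span_pair_congr (a' := 𝐱 * 𝐲 ^ (n - 1) - 𝐳) (b' := -𝐰) (by simp)
      (by simpa using add_mem (xn_mem k n) (yn_mem k n)), Ideal.span_insert,
      Ideal.span_singleton_neg, ← exIdeal_xyw, sup_comm, sup_comm (Ideal.span _), ← sup_assoc]
  have e1 : exIdeal k n n n ⊤ 1 ⊔ Ideal.span {𝐱 * 𝐲 ^ (n - 1) - 𝐳} ⊔ Ideal.span {𝐳} =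
      𝔟 ⊔ 𝔷 ⊔ Ideal.span {𝐱 * 𝐲 ^ (n - 1)} := by
    have h2 := exIdeal_sup2 (k := k) (n := n) (p := n) (q := n) (s := 1) 1
    rw [pow_one, Nat.cast_one] at h2
    rw [sup_right_comm, ← h2, ← exIdeal_xyzw]
    exact sup_span_singleton_congr (by simpa using Ideal.mem_sup_right (z_mem k n))
  rw [e0, Ideal.colength_eq_add_of_colon (K := exIdeal k n (n - 1 : ℕ) (1 : ℕ) 1 1) 𝐳, e1,
    colength_c_sup_theta k n hn, colength_exIdeal]
  · norm_cast
    have : n ≤ n ^ 2 := Nat.le_self_pow two_ne_zero n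
    omega
  · intro f
    rw [theta_mul_mem_iff k n hn, exIdeal_xyzw]
    have h2 := exIdeal_sup2 (k := k) (n := n) (p := n) (q := n) (s := 1) 1
    rw [pow_one, Nat.cast_one] at h2
    have hth : (𝐱 * 𝐲 ^ (n - 1)) ^ 2 ∈ exIdeal k n n n ⊤ 1 :=
      exIdeal_anti le_rfl le_rfl le_rfl le_top (theta_sq_mem k n hn)
    constructor
    · intro hf
      rw [h2] at hf
      obtain ⟨i, hi, c, hc⟩ := mem_sup_span_singleton.1 hf
      refine mem_sup_span_singleton.2 ⟨?_, ?_, -f - c, ?_⟩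
      · exact 𝐳 * f + (𝐱 * 𝐲 ^ (n - 1) - 𝐳) * (f + c)
      · -- `θ f + (θ - z) c = θ c` up to `i`, and `θ c z = θ (θ f - i)` lies in the ideal
        have h3 : 𝐳 ^ 1 * (𝐱 * 𝐲 ^ (n - 1) * c) ∈ exIdeal k n n n ⊤ 1 := by
          have : 𝐳 ^ 1 * (𝐱 * 𝐲 ^ (n - 1) * c) =
            f * (𝐱 * 𝐲 ^ (n - 1)) ^ 2 - 𝐱 * 𝐲 ^ (n - 1) * i := by
            linear_combination -(𝐱 * 𝐲 ^ (n - 1)) * hc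
          rw [this]
          exact sub_mem (Ideal.mul_mem_left _ _ hth) (Ideal.mul_mem_left _ _ hi)
        have h4 := ((adm_xy n).z_pow_mul_mem 1).1 h3
        rw [ENat.top_sub_natCast] at h4
        have : 𝐳 * f + (𝐱 * 𝐲 ^ (n - 1) - 𝐳) * (f + c) = i + 𝐱 * 𝐲 ^ (n - 1) * c := by
          linear_combination hc
        rw [this]
        exact add_mem hi h4
      · ring
    · intro hf
      obtain ⟨i, hi, c, hc⟩ := mem_sup_span_singleton.1 hf
      have h3 : 𝐳 ^ 1 * (𝐱 * 𝐲 ^ (n - 1) * f + 𝐳 * (f + c)) ∈ exIdeal k n n n ⊤ 1 := by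
        have : 𝐳 ^ 1 * (𝐱 * 𝐲 ^ (n - 1) * f + 𝐳 * (f + c)) =
          (𝐱 * 𝐲 ^ (n - 1) + 𝐳) * i + c * (𝐱 * 𝐲 ^ (n - 1)) ^ 2 := by
          linear_combination (𝐱 * 𝐲 ^ (n - 1) + 𝐳) * hc
        rw [this]
        exact add_mem (Ideal.mul_mem_left _ _ hi) (Ideal.mul_mem_left _ _ hth)
      have h4 := ((adm_xy n).z_pow_mul_mem 1).1 h3
      rw [ENat.top_sub_natCast] at h4
      rw [h2]
      exact mem_sup_span_singleton.2 ⟨_, h4, -(f + c), by ring⟩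

/-- The Hilbert function of `Q'`. -/
lemma colength_Q'_pow (hn : 2 ≤ n) (s : ℕ) :
    (Ideal.span {𝐱 * 𝐲 ^ (n - 1) - 𝐳, 𝐱 ^ n + 𝐲 ^ n - 𝐰} ^ (s + 1)).colength =
    (2 * n ^ 2 * (s + 2).choose 2 + (n ^ 2 - n + 1) * (s + 1) : ℕ) := by
  refine colength_pow_of_isRegularPair (exIdeal_inf_eq_bot k n) (isRegularPair_Q'_xy k n hn)
    (Or.inr (isRegularPair_Q'_zw k n hn)) ?_ (colength_Q'_sup_xy k n hn)
    (colength_Q'_sup_zw k n hn) (colength_c k n) ?_ s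
  · exact sub_mem (Ideal.mem_sup_left (add_mem (xn_mem k n) (yn_mem k n)))
      (Ideal.mem_sup_right (w_mem k n))
  · rw [span_Q'_sup_c, colength_c_sup_theta k n hn]

end Pairs


/-! ### First local cohomology -/

section ExtOne

open CategoryTheory Opposite

variable {R : Type u} [CommRing R]

/-- A linear map out of the image of `d : P₁ → P₀` into a module `E` extends uniquely to `P₀` if
the cokernel of `d` is annihilated by elements `r`, `s` forming a regular sequence on `E`. -/
lemma existsUnique_extension {P₀ P₁ E : Type*} [AddCommGroup P₀] [Module R P₀] [AddCommGroup P₁]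
    [Module R P₁] [AddCommGroup E] [Module R E] (d : P₁ →ₗ[R] P₀) (h : P₁ →ₗ[R] E)
    (hd : ∀ p, d p = 0 → h p = 0) {r s : R} (hr0 : ∀ e : E, r • e = 0 → e = 0)
    (hs0 : ∀ e f : E, s • e = r • f → ∃ e', e = r • e')
    (hr : ∀ p, ∃ p', d p' = r • p) (hs : ∀ p, ∃ p', d p' = s • p) :
    ∃ g : P₀ →ₗ[R] E, (∀ p, g (d p) = h p) ∧
      ∀ g' : P₀ →ₗ[R] E, (∀ p, g' (d p) = h p) → g' = g := by
  have hinj : ∀ {e f : E}, r • e = r • f → e = f := fun {e f} hef =>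
    sub_eq_zero.1 (hr0 _ (by rw [smul_sub, hef, sub_self]))
  have hwd : ∀ {p q}, d p = d q → h p = h q := fun {p q} hpq =>
    sub_eq_zero.1 (by rw [← map_sub]; exact hd _ (by rw [map_sub, hpq, sub_self]))
  choose u hu using hr
  have hex : ∀ p, ∃ e', h (u p) = r • e' := by
    intro p
    obtain ⟨v, hv⟩ := hs p
    refine hs0 _ (h v) ?_
    rw [← map_smul, ← map_smul]
    apply hwd
    rw [map_smul, map_smul, hu, hv, smul_comm]
  choose g hg using hex
  refine ⟨⟨⟨g, fun p q => hinj ?_⟩, fun c p => hinj ?_⟩, fun p => hinj ?_, fun g' hg' => ?_⟩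
  · rw [smul_add, ← hg, ← hg, ← hg, ← map_add]
    exact hwd (by rw [map_add, hu, hu, hu, smul_add])
  · rw [RingHom.id_apply, smul_comm, ← hg, ← hg, ← map_smul]
    exact hwd (by rw [map_smul, hu, hu, smul_comm])
  · change r • g (d p) = r • h p
    rw [← hg, ← map_smul]
    exact hwd (by rw [hu, map_smul])
  · ext p
    apply hinj
    change r • g' p = r • g p
    rw [← hg, ← map_smul, ← hu, hg']

variable {X X' : ModuleCat.{u} R} (P : ProjectiveResolution X) (P' : ProjectiveResolution X')

/-- The map on `Hom`-complexes into `Y` induced by a chain map. -/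
noncomputable def homComplexMap (φ : P'.complex ⟶ P.complex) (Y : ModuleCat.{u} R) :
    P.complex.linearYonedaObj R Y ⟶ P'.complex.linearYonedaObj R Y :=
  (HomologicalComplex.unopFunctor _ _).map
    (((((linearYoneda R (ModuleCat.{u} R)).obj Y).rightOp.mapHomologicalComplex _).map φ).op)

lemma inv_comp_eq_comp_inv_of_comp_eq {C : Type*} [Category* C] {A B A' B' : C} {a : A ≅ A'}
    {b : B ≅ B'} {f : B ⟶ A} {g : B' ⟶ A'} (h : f ≫ a.hom = b.hom ≫ g) :
    b.inv ≫ f = g ≫ a.inv := by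
  rw [Iso.inv_comp_eq, ← Category.assoc, ← h, Category.assoc, a.hom_inv_id, Category.comp_id]

lemma comp_comp_eq_of_squares {C : Type*} [Category* C] {A B A' B' A'' B'' : C} {p : A ⟶ B}
    {q : B ⟶ B'} {u : A ⟶ A'} {v : A' ⟶ B'} {w : B' ⟶ B''} {t : A' ⟶ A''} {s : A'' ⟶ B''}
    (h : p ≫ q = u ≫ v) (h' : v ≫ w = t ≫ s) : p ≫ q ≫ w = (u ≫ t) ≫ s := by
  rw [← Category.assoc, h, Category.assoc, h', Category.assoc]

/-- The functoriality of `Ext` in the first variable, computed by projective resolutions. -/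
lemma ext_map_comp_isoExt (f : X' ⟶ X) (φ : P'.complex ⟶ P.complex)
    (comm : φ.f 0 ≫ P.π.f 0 = P'.π.f 0 ≫ f) (Y : ModuleCat.{u} R) (n : ℕ) :
    ((Ext R (ModuleCat.{u} R) n).map f.op).app Y ≫ (P'.isoExt n Y).hom =
      (P.isoExt n Y).hom ≫ HomologicalComplex.homologyMap (homComplexMap P P' φ Y) n := by
  have h1 := ProjectiveResolution.isoLeftDerivedObj_inv_naturality f P' P φ comm
    ((linearYoneda R (ModuleCat.{u} R)).obj Y).rightOp n
  have h2 : ((((linearYoneda R (ModuleCat.{u} R)).obj Y).rightOp.leftDerived n).map f).unop ≫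
      (P'.isoLeftDerivedObj ((linearYoneda R (ModuleCat.{u} R)).obj Y).rightOp n).inv.unop =
      (P.isoLeftDerivedObj ((linearYoneda R (ModuleCat.{u} R)).obj Y).rightOp n).inv.unop ≫
      (HomologicalComplex.homologyMap
        ((((linearYoneda R (ModuleCat.{u} R)).obj Y).rightOp.mapHomologicalComplex _).map φ)
        n).unop :=
    congrArg Quiver.Hom.unop h1
  have h4 := HomologicalComplex.homologyOp_hom_naturality (homComplexMap P P' φ Y) n
  have h5 : (HomologicalComplex.homologyMap
        ((((linearYoneda R (ModuleCat.{u} R)).obj Y).rightOp.mapHomologicalComplex _).map φ)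
        n).unop ≫ ((P'.complex.linearYonedaObj R Y).homologyOp n).inv.unop =
        ((P.complex.linearYonedaObj R Y).homologyOp n).inv.unop ≫
          HomologicalComplex.homologyMap (homComplexMap P P' φ Y) n :=
    congrArg Quiver.Hom.unop (inv_comp_eq_comp_inv_of_comp_eq h4)
  exact comp_comp_eq_of_squares h2 h5

end ExtOne


section ExtOneEval

open CategoryTheory Opposite

variable {R : Type u} [CommRing R]

/-- The ideal `J` contains a regular sequence of length two on the module `E`. -/
def HasRegularPair (J : Ideal R) (E : Type*) [AddCommGroup E] [Module R E] : Prop :=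
  ∃ r ∈ J, ∃ s ∈ J, (∀ e : E, r • e = 0 → e = 0) ∧
    ∀ e f : E, s • e = r • f → ∃ e', e = r • e'

variable {J : Ideal R} (P : ProjectiveResolution (ModuleCat.of R (R ⧸ J)))

/-- The augmentation of a projective resolution of `R / J`. -/
noncomputable def augmentation : P.complex.X 0 →ₗ[R] R ⧸ J := (P.π.f 0).hom

lemma augmentation_surjective : Function.Surjective (augmentation P) :=
  (ModuleCat.epi_iff_surjective (P.π.f 0)).1 inferInstance

lemma augmentation_d (p : P.complex.X 1) : augmentation P (P.complex.d 1 0 p) = 0 := by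
  have := P.complex_d_comp_π_f_zero
  exact congrArg (fun f => f.hom p) this

lemma exists_d_of_augmentation_eq_zero (p : P.complex.X 0) (h : augmentation P p = 0) :
    ∃ p', P.complex.d 1 0 p' = p :=
  (ShortComplex.moduleCat_exact_iff _).1 P.exact₀ p h

lemma exists_d_of_d_eq_zero (p : P.complex.X 1) (h : P.complex.d 1 0 p = 0) :
    ∃ p', P.complex.d 2 1 p' = p :=
  (ShortComplex.moduleCat_exact_iff _).1 (P.exact_succ 0) p h

lemma exists_d_eq_smul {r : R} (hr : r ∈ J) (p : P.complex.X 0) :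
    ∃ p', P.complex.d 1 0 p' = r • p := by
  refine exists_d_of_augmentation_eq_zero P _ ?_
  rw [map_smul]
  obtain ⟨a, ha⟩ := Ideal.Quotient.mk_surjective (augmentation P p)
  rw [← ha]
  exact (Submodule.Quotient.mk_eq_zero J).2 (J.mul_mem_right a hr)

variable {Y E Z : Type u} [AddCommGroup Y] [Module R Y] [AddCommGroup E] [Module R E]
  [AddCommGroup Z] [Module R Z] (i : Y →ₗ[R] E) (q : E →ₗ[R] Z)

/-- As `R / J` is annihilated by a regular sequence of length two on `E`, one has
`Hom(R / J, E) = Ext¹(R / J, E) = 0`: a cocycle with values in `Y ⊆ E` is the coboundary of a unique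
cochain with values in `E`. -/
lemma existsUnique_extension_of_cocycle (hE : HasRegularPair J E)
    (h : P.complex.X 1 ⟶ ModuleCat.of R Y) (hh : P.complex.d 2 1 ≫ h = 0) :
    ∃ g : P.complex.X 0 →ₗ[R] E, (∀ p, g (P.complex.d 1 0 p) = i (h p)) ∧
      ∀ g' : P.complex.X 0 →ₗ[R] E, (∀ p, g' (P.complex.d 1 0 p) = i (h p)) → g' = g := by
  obtain ⟨r, hr, s, hs, h1, h2⟩ := hE
  refine existsUnique_extension (P.complex.d 1 0).hom (i ∘ₗ h.hom) ?_ h1 h2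
    (exists_d_eq_smul P hr) (exists_d_eq_smul P hs)
  intro p hp
  obtain ⟨p', rfl⟩ := exists_d_of_d_eq_zero P p hp
  have : h (P.complex.d 2 1 p') = 0 := congrArg (fun f => f.hom p') hh
  change i (h _) = 0
  rw [this, map_zero]

/-- The cochain complex `Hom(P, Y)`. -/
noncomputable abbrev homComplex (Y : Type u) [AddCommGroup Y] [Module R Y] :
    CochainComplex (ModuleCat.{u} R) ℕ :=
  P.complex.linearYonedaObj R (ModuleCat.of R Y)

/-- The homomorphism `P₁ → Y` underlying a cocycle. -/
noncomputable def cocycleHom (c : (homComplex P Y).cycles 1) :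
    P.complex.X 1 ⟶ ModuleCat.of R Y :=
  (homComplex P Y).iCycles 1 c

lemma cocycleHom_add (c c' : (homComplex P Y).cycles 1) :
    cocycleHom P (c + c') = cocycleHom P c + cocycleHom P c' :=
  map_add ((homComplex P Y).iCycles 1).hom c c'

lemma cocycleHom_smul (a : R) (c : (homComplex P Y).cycles 1) :
    cocycleHom P (a • c) = a • cocycleHom P c :=
  map_smul ((homComplex P Y).iCycles 1).hom a c

lemma d_comp_cocycleHom (c : (homComplex P Y).cycles 1) :
    P.complex.d 2 1 ≫ cocycleHom P c = 0 :=
  congrArg (fun f => f.hom c) ((homComplex P Y).iCycles_d 1 2)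

/-- The extension to `P₀ → E` of a cocycle `P₁ → Y`. -/
noncomputable def cocycleExt (hE : HasRegularPair J E) (c : (homComplex P Y).cycles 1) :
    P.complex.X 0 →ₗ[R] E :=
  (existsUnique_extension_of_cocycle P i hE (cocycleHom P c) (d_comp_cocycleHom P c)).choose

lemma cocycleExt_d (hE : HasRegularPair J E) (c : (homComplex P Y).cycles 1)
    (p : P.complex.X 1) : cocycleExt P i hE c (P.complex.d 1 0 p) = i (cocycleHom P c p) :=
  (existsUnique_extension_of_cocycle P i hE (cocycleHom P c)
    (d_comp_cocycleHom P c)).choose_spec.1 p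

lemma eq_cocycleExt (hE : HasRegularPair J E) (c : (homComplex P Y).cycles 1)
    (g : P.complex.X 0 →ₗ[R] E) (hg : ∀ p, g (P.complex.d 1 0 p) = i (cocycleHom P c p)) :
    g = cocycleExt P i hE c :=
  (existsUnique_extension_of_cocycle P i hE (cocycleHom P c)
    (d_comp_cocycleHom P c)).choose_spec.2 g hg

/-- A lift to `P₀` of the class of `1` in `R / J`. -/
noncomputable def liftOne : P.complex.X 0 := (augmentation_surjective P 1).choose

lemma augmentation_liftOne : augmentation P (liftOne P) = 1 :=
  (augmentation_surjective P 1).choose_spec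

/-- For a short exact sequence `0 → Y → E → Z → 0`, the map from cocycles `P₁ → Y` to `Z` which
extends a cocycle to `P₀ → E` and evaluates at a lift of `1`. -/
noncomputable def cocycleEval (hE : HasRegularPair J E) : (homComplex P Y).cycles 1 →ₗ[R] Z where
  toFun c := q (cocycleExt P i hE c (liftOne P))
  map_add' c c' := by
    rw [← map_add, ← LinearMap.add_apply]
    congr 2
    refine (eq_cocycleExt P i hE _ _ fun p => ?_).symm
    rw [LinearMap.add_apply, cocycleExt_d, cocycleExt_d, cocycleHom_add, ← map_add]
    rfl
  map_smul' a c := by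
    rw [RingHom.id_apply, ← map_smul, ← LinearMap.smul_apply]
    congr 2
    refine (eq_cocycleExt P i hE _ _ fun p => ?_).symm
    rw [LinearMap.smul_apply, cocycleExt_d, cocycleHom_smul, ← map_smul]
    rfl

variable (hiq : Function.Exact i q)

include hiq in
/-- The value does not depend on the lift of `1`. -/
lemma cocycleEval_eq (hE : HasRegularPair J E) (c : (homComplex P Y).cycles 1)
    (p : P.complex.X 0) (hp : augmentation P p = 1) :
    cocycleEval P i q hE c = q (cocycleExt P i hE c p) := by
  change q (cocycleExt P i hE c (liftOne P)) = _
  obtain ⟨p', hp'⟩ := exists_d_of_augmentation_eq_zero P (liftOne P - p)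
    (by rw [map_sub, augmentation_liftOne, hp, sub_self])
  rw [← sub_eq_zero, ← map_sub, ← map_sub, ← hp', cocycleExt_d]
  exact hiq.apply_apply_eq_zero _

lemma cocycleHom_toCycles (m : P.complex.X 0 ⟶ ModuleCat.of R Y) :
    cocycleHom P ((homComplex P Y).toCycles 0 1 m) = P.complex.d 1 0 ≫ m :=
  congrArg (fun f => f.hom m) ((homComplex P Y).toCycles_i 0 1)

include hiq in
lemma toCycles_comp_cocycleEval (hE : HasRegularPair J E) :
    (homComplex P Y).toCycles 0 1 ≫ ModuleCat.ofHom (cocycleEval P i q hE) = 0 := by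
  ext m
  change cocycleEval P i q hE ((homComplex P Y).toCycles 0 1 m) = 0
  have h1 : i ∘ₗ (m : P.complex.X 0 ⟶ ModuleCat.of R Y).hom =
      cocycleExt P i hE ((homComplex P Y).toCycles 0 1 m) :=
    eq_cocycleExt P i hE _ _ fun p => by
      have h2 := congrArg (fun f => f.hom p) (cocycleHom_toCycles P m)
      exact congrArg i h2.symm
  rw [cocycleEval_eq P i q hiq hE _ _ (augmentation_liftOne P), ← h1]
  exact hiq.apply_apply_eq_zero _

/-- The map `Ext¹(R / J, Y) → Z` attached to a short exact sequence `0 → Y → E → Z → 0`, inverse to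
the connecting homomorphism `Hom(R / J, Z) → Ext¹(R / J, Y)` followed by evaluation at `1`. -/
noncomputable def homologyEval (hE : HasRegularPair J E) :
    (homComplex P Y).homology 1 ⟶ ModuleCat.of R Z :=
  ((homComplex P Y).homologyIsCokernel 0 1 (by simp)).desc
    (Limits.CokernelCofork.ofπ (ModuleCat.ofHom (cocycleEval P i q hE))
      (toCycles_comp_cocycleEval P i q hiq hE))

lemma homologyEval_homologyπ (hE : HasRegularPair J E) (c : (homComplex P Y).cycles 1) :
    homologyEval P i q hiq hE ((homComplex P Y).homologyπ 1 c) = cocycleEval P i q hE c := by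
  have : (homComplex P Y).homologyπ 1 ≫ homologyEval P i q hiq hE =
      ModuleCat.ofHom (cocycleEval P i q hE) :=
    ((homComplex P Y).homologyIsCokernel 0 1 (by simp)).fac
      (Limits.CokernelCofork.ofπ (ModuleCat.ofHom (cocycleEval P i q hE))
        (toCycles_comp_cocycleEval P i q hiq hE)) Limits.WalkingParallelPair.one
  exact congrArg (fun f => f.hom c) this

lemma homologyπ_surjective' (K : CochainComplex (ModuleCat.{u} R) ℕ) (n : ℕ) :
    Function.Surjective (K.homologyπ n) :=
  (ModuleCat.epi_iff_surjective _).1 inferInstance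

lemma cocycleHom_injective : Function.Injective (cocycleHom (Y := Y) P) :=
  (ModuleCat.mono_iff_injective ((homComplex P Y).iCycles 1)).1 inferInstance

lemma homologyEval_injective (hi : Function.Injective i) (hE : HasRegularPair J E) :
    Function.Injective (homologyEval P i q hiq hE) := by
  rw [injective_iff_map_eq_zero]
  intro ξ hξ
  obtain ⟨c, rfl⟩ := homologyπ_surjective' _ _ ξ
  rw [homologyEval_homologyπ] at hξ
  have h1 : ∀ p, q (cocycleExt P i hE c p) = 0 := by
    intro p
    obtain ⟨a, ha⟩ := Ideal.Quotient.mk_surjective (augmentation P p)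
    obtain ⟨p', hp'⟩ := exists_d_of_augmentation_eq_zero P (p - a • liftOne P) (by
      rw [map_sub, map_smul, augmentation_liftOne, ← ha, sub_eq_zero]
      exact (mul_one (Ideal.Quotient.mk J a)).symm)
    have h2 : p = a • liftOne P + P.complex.d 1 0 p' := by rw [hp']; abel
    rw [h2, map_add, map_smul, map_add, map_smul, cocycleExt_d, hiq.apply_apply_eq_zero, add_zero]
    change a • cocycleEval P i q hE c = 0
    rw [hξ, smul_zero]
  -- the extension has values in `Y`, so the cocycle is a coboundary over `Y`
  have h2 : ∀ p, cocycleExt P i hE c p ∈ LinearMap.range i := fun p => (hiq _).1 (h1 p)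
  let m : P.complex.X 0 ⟶ ModuleCat.of R Y := ModuleCat.ofHom
    ((LinearEquiv.ofInjective i hi).symm.toLinearMap ∘ₗ
      (cocycleExt P i hE c).codRestrict (LinearMap.range i) h2)
  have hm : ∀ p, i (m p) = cocycleExt P i hE c p := fun p =>
    congrArg Subtype.val ((LinearEquiv.ofInjective i hi).apply_symm_apply
      ((cocycleExt P i hE c).codRestrict (LinearMap.range i) h2 p))
  have hc : c = (homComplex P Y).toCycles 0 1 m := by
    apply cocycleHom_injective P
    rw [cocycleHom_toCycles]
    ext p
    apply hi
    rw [← cocycleExt_d P i hE]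
    exact (hm _).symm
  rw [hc]
  exact congrArg (fun f => f.hom m) ((homComplex P Y).toCycles_comp_homologyπ 0 1)

lemma homologyEval_surjective (hi : Function.Injective i) (hq : Function.Surjective q)
    (hE : HasRegularPair J E) (hJ : ∀ a ∈ J, ∀ z : Z, a • z = 0) :
    Function.Surjective (homologyEval P i q hiq hE) := by
  intro z
  let ψ : R ⧸ J →ₗ[R] Z := Submodule.liftQ J (LinearMap.toSpanSingleton R Z z) fun a ha => by
    simpa using hJ a ha z
  have hψ1 : ψ 1 = z := by
    change ψ (Submodule.Quotient.mk 1) = z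
    rw [Submodule.liftQ_apply, LinearMap.toSpanSingleton_apply, one_smul]
  have : Module.Projective R (P.complex.X 0) :=
    (IsProjective.iff_projective (P.complex.X 0)).2 (P.projective 0)
  -- lift `P₀ → R / J → Z` to `P₀ → E`; its restriction along `P₁ → P₀` is a cocycle with values in `Y`
  obtain ⟨g, hg⟩ := Module.projective_lifting_property q (ψ ∘ₗ augmentation P) hq
  have hg' : ∀ p, q (g p) = ψ (augmentation P p) := fun p => congrArg (fun f => f p) hg
  have h2 : ∀ p, (g ∘ₗ (P.complex.d 1 0).hom) p ∈ LinearMap.range i := fun p => (hiq _).1 (by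
    change q (g (P.complex.d 1 0 p)) = 0
    rw [hg', augmentation_d, map_zero])
  let h : P.complex.X 1 ⟶ ModuleCat.of R Y := ModuleCat.ofHom
    ((LinearEquiv.ofInjective i hi).symm.toLinearMap ∘ₗ
      (g ∘ₗ (P.complex.d 1 0).hom).codRestrict (LinearMap.range i) h2)
  have hh : ∀ p, i (h p) = g (P.complex.d 1 0 p) := fun p =>
    congrArg Subtype.val ((LinearEquiv.ofInjective i hi).apply_symm_apply
      ((g ∘ₗ (P.complex.d 1 0).hom).codRestrict (LinearMap.range i) h2 p))
  have hd : P.complex.d 2 1 ≫ h = 0 := by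
    ext p
    apply hi
    change i (h (P.complex.d 2 1 p)) = i 0
    have : P.complex.d 1 0 (P.complex.d 2 1 p) = 0 :=
      congrArg (fun f => f.hom p) (P.complex.d_comp_d 2 1 0)
    rw [hh, this, map_zero, map_zero]
  -- the cocycle as an element of `cycles`, obtained from the map `R → Hom(P₁, Y)` sending `1` to it
  obtain ⟨c, hc⟩ : ∃ c, cocycleHom (Y := Y) P c = h := by
    let m : ModuleCat.of R R ⟶ (homComplex P Y).X 1 :=
      ModuleCat.ofHom (LinearMap.toSpanSingleton R _ h)
    have hm : m ≫ (homComplex P Y).d 1 2 = 0 := by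
      ext
      change (homComplex P Y).d 1 2 ((1 : R) • h) = 0
      rw [one_smul]
      exact hd
    refine ⟨(homComplex P Y).liftCycles m 2 (by simp) hm (1 : R), ?_⟩
    have h3 := (homComplex P Y).liftCycles_i m 2 (by simp) hm
    have h4 : cocycleHom P ((homComplex P Y).liftCycles m 2 (by simp) hm (1 : R)) = (1 : R) • h :=
      congrArg (fun f => f.hom (1 : R)) h3
    rw [h4, one_smul]
  refine ⟨(homComplex P Y).homologyπ 1 c, ?_⟩
  rw [homologyEval_homologyπ, cocycleEval_eq P i q hiq hE c _ (augmentation_liftOne P),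
    ← eq_cocycleExt P i hE c g fun p => by rw [hc, hh], hg', augmentation_liftOne, hψ1]

/-- Naturality of `homologyEval` in the ideal. -/
lemma homologyEval_naturality {J' : Ideal R} (P' : ProjectiveResolution (ModuleCat.of R (R ⧸ J')))
    (f : R ⧸ J' →ₗ[R] R ⧸ J) (hf : f 1 = 1) (φ : P'.complex ⟶ P.complex)
    (comm : φ.f 0 ≫ P.π.f 0 = P'.π.f 0 ≫ ModuleCat.ofHom f)
    (hE : HasRegularPair J E) (hE' : HasRegularPair J' E) :
    HomologicalComplex.homologyMap (homComplexMap P P' φ (ModuleCat.of R Y)) 1 ≫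
      homologyEval P' i q hiq hE' = homologyEval P i q hiq hE := by
  ext ξ
  obtain ⟨c, rfl⟩ := homologyπ_surjective' _ _ ξ
  have h1 : HomologicalComplex.homologyMap (homComplexMap P P' φ (ModuleCat.of R Y)) 1
      ((homComplex P Y).homologyπ 1 c) = (homComplex P' Y).homologyπ 1
        (HomologicalComplex.cyclesMap (homComplexMap P P' φ (ModuleCat.of R Y)) 1 c) :=
    congrArg (fun f => f.hom c) (HomologicalComplex.homologyπ_naturality
      (homComplexMap P P' φ (ModuleCat.of R Y)) 1)
  change homologyEval P' i q hiq hE' (HomologicalComplex.homologyMap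
    (homComplexMap P P' φ (ModuleCat.of R Y)) 1 ((homComplex P Y).homologyπ 1 c)) = _
  have h2 : cocycleHom P' (HomologicalComplex.cyclesMap
      (homComplexMap P P' φ (ModuleCat.of R Y)) 1 c) = φ.f 1 ≫ cocycleHom P c :=
    congrArg (fun f => f.hom c) (HomologicalComplex.cyclesMap_i
      (homComplexMap P P' φ (ModuleCat.of R Y)) 1)
  have h3 : augmentation P (φ.f 0 (liftOne P')) = 1 := by
    have : augmentation P (φ.f 0 (liftOne P')) = f (augmentation P' (liftOne P')) :=
      congrArg (fun f => f.hom (liftOne P')) comm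
    rw [this, augmentation_liftOne, hf]
  rw [h1, homologyEval_homologyπ, cocycleEval_eq P' i q hiq hE' _ _ (augmentation_liftOne P')]
  refine Eq.trans ?_ (homologyEval_homologyπ P i q hiq hE c).symm
  rw [cocycleEval_eq P i q hiq hE c _ h3,
    ← eq_cocycleExt P' i hE' _ (cocycleExt P i hE c ∘ₗ (φ.f 0).hom) fun p => ?_]
  · rfl
  · have : φ.f 0 (P'.complex.d 1 0 p) = P.complex.d 1 0 (φ.f 1 p) :=
      congrArg (fun f => f.hom p) (φ.comm 1 0).symm
    change cocycleExt P i hE c (φ.f 0 (P'.complex.d 1 0 p)) = _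
    rw [this, cocycleExt_d, h2]
    rfl

end ExtOneEval


section LocalCohomologyOne

open CategoryTheory Opposite Limits

variable {R : Type u} [CommRing R] (m : Ideal R)
  {Y E Z : Type u} [AddCommGroup Y] [Module R Y] [AddCommGroup E] [Module R E]
  [AddCommGroup Z] [Module R Z] (i : Y →ₗ[R] E) (q : E →ₗ[R] Z) (hiq : Function.Exact i q)
  (hE : ∀ t : ℕ, HasRegularPair (m ^ t) E)

/-- The chosen projective resolution of `R / m ^ t`. -/
noncomputable abbrev powRes (t : ℕ) : ProjectiveResolution (ModuleCat.of R (R ⧸ m ^ t)) :=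
  projectiveResolution _

/-- The map `Ext¹(R / m ^ t, Y) → Z` attached to a short exact sequence `0 → Y → E → Z → 0`. -/
noncomputable def extEval (t : ℕ) :
    ((Ext R (ModuleCat.{u} R) 1).obj (op (ModuleCat.of R (R ⧸ m ^ t)))).obj (ModuleCat.of R Y) ⟶
      ModuleCat.of R Z :=
  ((powRes m t).isoExt 1 (ModuleCat.of R Y)).hom ≫ homologyEval (powRes m t) i q hiq (hE t)

lemma extEval_naturality (s t : ℕ)
    (f : R ⧸ m ^ t →ₗ[R] R ⧸ m ^ s) (hf : f 1 = 1) :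
    ((Ext R (ModuleCat.{u} R) 1).map (ModuleCat.ofHom f).op).app (ModuleCat.of R Y) ≫
      extEval m i q hiq hE t = extEval m i q hiq hE s := by
  have comm := ProjectiveResolution.lift_commutes_zero (ModuleCat.ofHom f) (powRes m t) (powRes m s)
  have h1 := ext_map_comp_isoExt (powRes m s) (powRes m t) (ModuleCat.ofHom f) _ comm
    (ModuleCat.of R Y) 1
  rw [extEval, extEval, reassoc_of% h1,
    homologyEval_naturality (powRes m s) i q hiq (powRes m t) f hf _ comm]

/-- The maps `extEval` form a cocone over the directed system defining local cohomology. -/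
noncomputable def extEvalCocone :
    Cocone (localCohomology.diagram (localCohomology.idealPowersDiagram m) 1 ⋙
      (evaluation _ _).obj (ModuleCat.of R Y)) where
  pt := ModuleCat.of R Z
  ι :=
    { app := fun t => extEval m i q hiq hE t.unop.unop
      naturality := fun s t w => by
        refine Eq.trans ?_ (Category.comp_id _).symm
        exact extEval_naturality m i q hiq hE s.unop.unop t.unop.unop _ rfl }

/-- Let `0 → Y → E → Z → 0` be exact, where every power of `m` contains a regular sequence of length
two on `E` and some power of `m` annihilates `Z`. Then `H¹_m(Y) ≅ Z`: the maps
`Ext¹(R / m ^ t, Y) → Z` are isomorphisms for large `t`. -/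
theorem nonempty_localCohomology_one_iso (hiq : Function.Exact i q)
    (hE : ∀ t : ℕ, HasRegularPair (m ^ t) E)
    (hi : Function.Injective i) (hq : Function.Surjective q)
    (t₀ : ℕ) (hZ : ∀ a ∈ m ^ t₀, ∀ z : Z, a • z = 0) :
    Nonempty ((localCohomology m 1).obj (ModuleCat.of R Y) ≅ ModuleCat.of R Z) := by
  let F := localCohomology.diagram (localCohomology.idealPowersDiagram m) 1
  have hc : IsColimit (((evaluation _ _).obj (ModuleCat.of R Y)).mapCocone (colimit.cocone F)) :=
    isColimitOfPreserves _ (colimit.isColimit F)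
  let c := extEvalCocone m i q hiq hE
  have hbij : ∀ t : (ℕᵒᵖ)ᵒᵖ, t₀ ≤ t.unop.unop → IsIso (c.ι.app t) := by
    intro t ht
    have h1 : Function.Bijective
        ((powRes m t.unop.unop).isoExt (R := R) 1 (ModuleCat.of R Y)).hom :=
      ConcreteCategory.bijective_of_isIso _
    have h2 : Function.Bijective (homologyEval (powRes m t.unop.unop) i q hiq (hE _)) :=
      ⟨homologyEval_injective _ _ _ _ hi _, homologyEval_surjective _ _ _ _ hi hq _
        fun a ha => hZ a (Ideal.pow_le_pow_right ht ha)⟩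
    have h3 : Function.Bijective (extEval m i q hiq hE t.unop.unop) := h2.comp h1
    exact (ConcreteCategory.isIso_iff_bijective (extEval m i q hiq hE t.unop.unop)).2 h3
  -- a system which is eventually constant has its colimit at the stage `t₀`
  let T : (ℕᵒᵖ)ᵒᵖ := op (op t₀)
  have := hbij T le_rfl
  have hc' : IsColimit c :=
    { desc := fun s => inv (c.ι.app T) ≫ s.ι.app T
      fac := fun s t => by
        let t' : (ℕᵒᵖ)ᵒᵖ := op (op (max t.unop.unop t₀))
        let v : t ⟶ t' := ((homOfLE (le_max_left t.unop.unop t₀)).op).op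
        let v₀ : T ⟶ t' := ((homOfLE (le_max_right t.unop.unop t₀)).op).op
        have := hbij t' (le_max_right _ _)
        have h0 : inv (c.ι.app T) ≫ s.ι.app T = inv (c.ι.app t') ≫ s.ι.app t' := by
          rw [IsIso.inv_comp_eq, ← c.w v₀, ← s.w v₀, Category.assoc, IsIso.hom_inv_id_assoc]
        rw [h0, ← c.w v, ← s.w v, Category.assoc, IsIso.hom_inv_id_assoc]
      uniq := fun s f hf => by
        rw [← hf T, IsIso.inv_hom_id_assoc] }
  exact ⟨hc.coconePointUniqueUpToIso hc'⟩

end LocalCohomologyOne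


section LocalCohomologyOfGluing

open CategoryTheory

variable {R : Type u} [CommRing R]

lemma IsRegularPair.fst_pow {𝔟 : Ideal R} {a b : R} (h : IsRegularPair 𝔟 a b) (t : ℕ) :
    ∀ y, b ^ t * y ∈ 𝔟 → y ∈ 𝔟 := by
  induction t with
  | zero => simp
  | succ s ih => exact fun y hy => ih y (h.fst _ (by rwa [← mul_assoc, ← pow_succ']))

lemma IsRegularPair.pow {𝔟 : Ideal R} {a b : R} (h : IsRegularPair 𝔟 a b) (t : ℕ) :
    IsRegularPair 𝔟 (a ^ t) (b ^ t) := by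
  refine ⟨h.fst_pow t, ?_⟩
  suffices ∀ s : ℕ, ∀ y, a ^ t * y ∈ 𝔟 ⊔ Ideal.span {b ^ s} → y ∈ 𝔟 ⊔ Ideal.span {b ^ s} from this t
  intro s
  induction s with
  | zero => simp
  | succ s ih =>
    intro y hy
    obtain ⟨i, hi, c, hc⟩ := mem_sup_span_singleton.1 hy
    obtain ⟨i', hi', c', rfl⟩ := mem_sup_span_singleton.1 (h.snd_pow t y
      (mem_sup_span_singleton.2 ⟨i, hi, b ^ s * c, by rw [hc]; ring⟩))
    have h1 : a ^ t * c' - b ^ s * c ∈ 𝔟 := h.fst _ (by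
      have : b * (a ^ t * c' - b ^ s * c) = i - a ^ t * i' := by linear_combination hc
      rw [this]
      exact sub_mem hi (𝔟.mul_mem_left _ hi'))
    obtain ⟨j, hj, d, rfl⟩ := mem_sup_span_singleton.1 (ih c'
      (mem_sup_span_singleton.2 ⟨_, h1, c, by ring⟩))
    exact mem_sup_span_singleton.2 ⟨_, add_mem hi' (𝔟.mul_mem_left b hj), d, by ring⟩

lemma IsRegularPair.exists_smul_eq {𝔟 : Ideal R} {a b : R} (h : IsRegularPair 𝔟 a b)
    {e f : R ⧸ 𝔟} (hef : a • e = b • f) : ∃ e', e = b • e' := by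
  obtain ⟨e, rfl⟩ := Ideal.Quotient.mk_surjective e
  obtain ⟨f, rfl⟩ := Ideal.Quotient.mk_surjective f
  have h1 : a * e - b * f ∈ 𝔟 := Ideal.Quotient.eq.1 hef
  obtain ⟨i, hi, c, rfl⟩ := mem_sup_span_singleton.1 (h.snd e
    (mem_sup_span_singleton.2 ⟨_, h1, f, by ring⟩))
  exact ⟨Ideal.Quotient.mk 𝔟 c, Ideal.Quotient.eq.2 (by simpa using hi)⟩

lemma IsRegularPair.eq_zero_of_smul {𝔟 : Ideal R} {a b : R} (h : IsRegularPair 𝔟 a b)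
    {e : R ⧸ 𝔟} (he : b • e = 0) : e = 0 := by
  obtain ⟨e, rfl⟩ := Ideal.Quotient.mk_surjective e
  exact Ideal.Quotient.eq_zero_iff_mem.2 (h.fst e (Ideal.Quotient.eq_zero_iff_mem.1 he))

/-- If `𝔟 ∩ 𝔷 = 0` and `m` contains a pair which is regular modulo `𝔟` and modulo `𝔷`, the exact
sequence `0 → R → R / 𝔟 × R / 𝔷 → R / (𝔟 + 𝔷) → 0` gives `H¹_m(R) ≅ R / (𝔟 + 𝔷)`. -/
theorem nonempty_localCohomology_one_iso_quotient_sup {𝔟 𝔷 m : Ideal R} (h : 𝔟 ⊓ 𝔷 = ⊥) {a b : R}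
    (ha : a ∈ m) (hb : b ∈ m) (h1 : IsRegularPair 𝔟 a b) (h2 : IsRegularPair 𝔷 a b) (t₀ : ℕ)
    (hm : m ^ t₀ ≤ 𝔟 ⊔ 𝔷) :
    Nonempty ((localCohomology m 1).obj (ModuleCat.of R R) ≅ ModuleCat.of R (R ⧸ (𝔟 ⊔ 𝔷))) := by
  let i : R →ₗ[R] (R ⧸ 𝔟) × (R ⧸ 𝔷) := (Submodule.mkQ 𝔟).prod (Submodule.mkQ 𝔷)
  let q : (R ⧸ 𝔟) × (R ⧸ 𝔷) →ₗ[R] R ⧸ (𝔟 ⊔ 𝔷) :=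
    (Submodule.factor le_sup_left).comp (LinearMap.fst R _ _) -
      (Submodule.factor le_sup_right).comp (LinearMap.snd R _ _)
  have hq (u v : R) : q (Ideal.Quotient.mk 𝔟 u, Ideal.Quotient.mk 𝔷 v) =
      Ideal.Quotient.mk (𝔟 ⊔ 𝔷) (u - v) := rfl
  have hi (u : R) : i u = (Ideal.Quotient.mk 𝔟 u, Ideal.Quotient.mk 𝔷 u) := rfl
  refine nonempty_localCohomology_one_iso m i q ?_ ?_ ?_ ?_ t₀ ?_
  · rintro ⟨u, v⟩
    obtain ⟨u, rfl⟩ := Ideal.Quotient.mk_surjective u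
    obtain ⟨v, rfl⟩ := Ideal.Quotient.mk_surjective v
    rw [hq, Ideal.Quotient.eq_zero_iff_mem]
    constructor
    · intro huv
      obtain ⟨s, hs, r, hr, hsr⟩ := Submodule.mem_sup.1 huv
      refine ⟨u - s, ?_⟩
      rw [hi, Prod.mk.injEq]
      refine ⟨Ideal.Quotient.eq.2 ?_, Ideal.Quotient.eq.2 ?_⟩
      · simpa using hs
      · have : u - s - v = r := by linear_combination -hsr
        rwa [this]
    · rintro ⟨c, hc⟩
      rw [hi, Prod.mk.injEq] at hc
      have e1 := Ideal.Quotient.eq.1 hc.1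
      have e2 := Ideal.Quotient.eq.1 hc.2
      have : u - v = -(c - u) + (c - v) := by ring
      rw [this]
      exact add_mem (Ideal.mem_sup_left (neg_mem e1)) (Ideal.mem_sup_right e2)
  · intro t
    refine ⟨b ^ t, Ideal.pow_mem_pow hb t, a ^ t, Ideal.pow_mem_pow ha t, ?_, ?_⟩
    · rintro ⟨u, v⟩ huv
      exact Prod.ext ((h1.pow t).eq_zero_of_smul (congrArg Prod.fst huv))
        ((h2.pow t).eq_zero_of_smul (congrArg Prod.snd huv))
    · rintro ⟨u, v⟩ ⟨u', v'⟩ huv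
      obtain ⟨c, hc⟩ := (h1.pow t).exists_smul_eq (congrArg Prod.fst huv)
      obtain ⟨d, hd⟩ := (h2.pow t).exists_smul_eq (congrArg Prod.snd huv)
      exact ⟨(c, d), Prod.ext hc hd⟩
  · rw [injective_iff_map_eq_zero]
    intro u hu
    rw [hi] at hu
    have : u ∈ 𝔟 ⊓ 𝔷 := ⟨Ideal.Quotient.eq_zero_iff_mem.1 (congrArg Prod.fst hu),
      Ideal.Quotient.eq_zero_iff_mem.1 (congrArg Prod.snd hu)⟩
    rwa [h] at this
  · intro u
    obtain ⟨u, rfl⟩ := Ideal.Quotient.mk_surjective u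
    exact ⟨(Ideal.Quotient.mk 𝔟 u, 0), by
      rw [← map_zero (Ideal.Quotient.mk 𝔷), hq, sub_zero]⟩
  · intro c hc u
    obtain ⟨u, rfl⟩ := Ideal.Quotient.mk_surjective u
    exact Ideal.Quotient.eq_zero_iff_mem.2 (Ideal.mul_mem_right _ _ (hm hc))

end LocalCohomologyOfGluing

section ExRing

open CategoryTheory

variable (k : Type u) [Field k] (n : ℕ)

local notation "𝐱" => exVar k n 0
local notation "𝐲" => exVar k n 1
local notation "𝐳" => exVar k n 2
local notation "𝐰" => exVar k n 3
local notation "𝔟" => exIdeal k n n n ⊤ ⊤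
local notation "𝔷" => exIdeal k n ⊤ ⊤ 1 1
local notation "𝔪" => IsLocalRing.maximalIdeal (ExRing k n)

lemma maximalIdeal_eq_span : 𝔪 = Ideal.span {𝐱, 𝐲, 𝐳, 𝐰} := by
  have h := exIdeal_xy (k := k) (n := n) 1 1
  have h2 : exIdeal k n 1 1 ⊤ ⊤ = Ideal.span {𝐱, 𝐲} := by simpa using h
  rw [← exIdeal_one, exIdeal_one_one, h2, exIdeal_zw, ← Ideal.span_union, Set.insert_union,
    Set.singleton_union]

lemma exVar_mem_maximalIdeal (i : Fin 4) : exVar k n i ∈ 𝔪 := by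
  rw [maximalIdeal_eq_span]
  exact Ideal.subset_span (by fin_cases i <;> simp)

lemma span_c_eq : Ideal.span {𝐱 ^ n, 𝐲 ^ n, 𝐳, 𝐰} = 𝔟 ⊔ 𝔷 := by
  rw [exIdeal_xy, exIdeal_zw, ← Ideal.span_union, Set.insert_union, Set.singleton_union]

/-- An ideal containing powers of the four variables is primary to the maximal ideal. -/
lemma maximalIdeal_le_radical {J : Ideal (ExRing k n)} (h : ∀ i, ∃ t, exVar k n i ^ t ∈ J) :
    𝔪 ≤ J.radical := by
  rw [maximalIdeal_eq_span, Ideal.span_le]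
  rintro _ (rfl | rfl | rfl | rfl) <;> exact h _

lemma exists_maximalIdeal_pow_le {J : Ideal (ExRing k n)} (h : 𝔪 ≤ J.radical) :
    ∃ t, 𝔪 ^ t ≤ J := by
  have hN : IsNoetherianRing (ExRing k n) := inferInstance
  obtain ⟨t, ht⟩ := J.exists_radical_pow_le_of_fg ((isNoetherianRing_iff_ideal_fg _).1 hN _)
  exact ⟨t, (Ideal.pow_right_mono h t).trans ht⟩

lemma maximalIdeal_le_radical_c : 𝔪 ≤ (𝔟 ⊔ 𝔷).radical := by
  refine maximalIdeal_le_radical k n fun i => ?_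
  fin_cases i
  · exact ⟨n, Ideal.mem_sup_left (xn_mem k n)⟩
  · exact ⟨n, Ideal.mem_sup_left (yn_mem k n)⟩
  · exact ⟨1, by rw [pow_one]; exact Ideal.mem_sup_right (z_mem k n)⟩
  · exact ⟨1, by rw [pow_one]; exact Ideal.mem_sup_right (w_mem k n)⟩

lemma c_le_maximalIdeal (hn : n ≠ 0) : 𝔟 ⊔ 𝔷 ≤ 𝔪 := by
  rw [← span_c_eq, Ideal.span_le]
  rintro _ (rfl | rfl | rfl | rfl)
  · exact Ideal.pow_mem_of_mem _ (exVar_mem_maximalIdeal k n 0) _ (Nat.pos_of_ne_zero hn)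
  · exact Ideal.pow_mem_of_mem _ (exVar_mem_maximalIdeal k n 1) _ (Nat.pos_of_ne_zero hn)
  · exact exVar_mem_maximalIdeal k n 2
  · exact exVar_mem_maximalIdeal k n 3

lemma nonempty_localCohomology_exRing_iso (hn : n ≠ 0) :
    Nonempty ((localCohomology 𝔪 1).obj (ModuleCat.of (ExRing k n) (ExRing k n)) ≅
      ModuleCat.of (ExRing k n) (ExRing k n ⧸ 𝔟 ⊔ 𝔷)) := by
  obtain ⟨t, ht⟩ := exists_maximalIdeal_pow_le k n (maximalIdeal_le_radical_c k n)
  have h := (span_Q_le k n).trans (c_le_maximalIdeal k n hn)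
  exact nonempty_localCohomology_one_iso_quotient_sup (exIdeal_inf_eq_bot k n)
    (h (mem_span_pair_left _ _)) (h (mem_span_pair_right _ _)) (isRegularPair_Q_xy k n)
    (isRegularPair_Q_zw k n) t ht

end ExRing


/-! ### Dimension and depth -/

section DimDepth

variable {R : Type*} [CommRing R]

lemma two_le_ringKrullDim_of_lt {p q r : Ideal R} [p.IsPrime] [q.IsPrime] [r.IsPrime]
    (h1 : p < q) (h2 : q < r) : 2 ≤ ringKrullDim R := by
  have e1 := Ideal.height_add_one_le_of_lt_of_isPrime h1
  have e2 := Ideal.height_add_one_le_of_lt_of_isPrime h2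
  have e3 : (2 : ℕ∞) ≤ r.height := by
    refine le_trans ?_ e2
    have : (1 : ℕ∞) ≤ q.height := le_trans le_add_self e1
    calc (2 : ℕ∞) = 1 + 1 := by norm_num
      _ ≤ _ := by gcongr
  have e4 : (r.height : WithBot ℕ∞) ≤ ringKrullDim R := Ideal.height_le_ringKrullDim_of_ne_top
    (Ideal.IsPrime.ne_top inferInstance)
  exact le_trans (WithBot.coe_le_coe.2 e3) e4

/-- If `a` is a non-zero-divisor and the class of `f` is a non-zero socle element of `R / a`, the
depth is at most one: for a regular sequence `r, s, …`, writing `r f = a g` gives a non-zero socle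
element `g` of `R / r`, and `s` kills it. -/
lemma localDepth_le_one [IsLocalRing R] {a f : R} (ha : ∀ g, a * g = 0 → g = 0)
    (hf : ∀ g, f ≠ a * g) (h : ∀ m ∈ IsLocalRing.maximalIdeal R, ∃ g, m * f = a * g) :
    localDepth R ≤ 1 := by
  refine iSup₂_le fun rs hrs => ?_
  obtain ⟨hmem, hreg⟩ := hrs
  match rs with
  | [] => simp
  | [r] => simp
  | r :: s :: rs =>
    exfalso
    have hr := hmem r (by simp)
    have hs := hmem s (by simp)
    obtain ⟨h1, h2⟩ := (RingTheory.Sequence.isRegular_cons_iff R r (s :: rs)).1 hreg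
    obtain ⟨h3, -⟩ := (RingTheory.Sequence.isRegular_cons_iff _ s rs).1 h2
    have h1' : ∀ g, r * g = 0 → g = 0 := fun g hg => h1.right_eq_zero_of_smul hg
    obtain ⟨g, hg⟩ := h r hr
    obtain ⟨c, hc⟩ := h s hs
    have hsg : s * g = r * c := by
      refine sub_eq_zero.1 (ha _ ?_)
      linear_combination -s * hg + r * hc
    have h4 : s • (Submodule.Quotient.mk g : QuotSMulTop r R) = 0 := by
      rw [← Submodule.Quotient.mk_smul, Submodule.Quotient.mk_eq_zero, smul_eq_mul, hsg]
      exact Submodule.smul_mem_pointwise_smul c r ⊤ trivial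
    have h5 := h3.right_eq_zero_of_smul h4
    rw [Submodule.Quotient.mk_eq_zero] at h5
    obtain ⟨d, -, hd⟩ := h5
    refine hf d (sub_eq_zero.1 (h1' _ ?_))
    have hd' : r * d = g := hd
    linear_combination hg - a * hd'

lemma one_le_localDepth [IsLocalRing R] {a : R} (ha : ∀ g, a * g = 0 → g = 0)
    (hm : a ∈ IsLocalRing.maximalIdeal R) : 1 ≤ localDepth R := by
  have h1 : RingTheory.Sequence.IsWeaklyRegular R [a] :=
    (RingTheory.Sequence.isWeaklyRegular_singleton_iff R a).2
      fun x y hxy => sub_eq_zero.1 (ha _ (by rw [mul_sub]; exact sub_eq_zero.2 hxy))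
  have h2 : ∀ r ∈ [a], r ∈ IsLocalRing.maximalIdeal R := by simpa using hm
  have h3 := RingTheory.Sequence.IsRegular.of_isWeaklyRegular_of_mem_maximalIdeal R h2 h1
  exact le_iSup₂_of_le [a] ⟨h2, h3⟩ (by simp)

lemma ringKrullDim_le_two_of_maximalIdeal_le_radical [IsLocalRing R] [IsNoetherianRing R] {a b : R}
    (h : IsLocalRing.maximalIdeal R = (Ideal.span {a, b}).radical) : ringKrullDim R ≤ 2 := by
  rw [← IsLocalRing.maximalIdeal_height_eq_ringKrullDim]
  have h1 : IsLocalRing.maximalIdeal R ∈ (Ideal.span {a, b}).minimalPrimes := by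
    refine ⟨⟨inferInstance, ?_⟩, fun q hq _ => ?_⟩
    · rw [h]; exact Ideal.le_radical
    · rw [h]; exact (Ideal.IsPrime.radical_le_iff hq.1).2 hq.2
  have h2 := Ideal.height_le_card_of_mem_minimalPrimes_span (Set.toFinite _) h1
  have h3 : ({a, b} : Set R).ncard ≤ 2 := by
    have := Set.ncard_insert_le a {b}
    rwa [Set.ncard_singleton] at this
  have h4 : (IsLocalRing.maximalIdeal R).height ≤ 2 := h2.trans (by exact_mod_cast h3)
  exact WithBot.coe_le_coe.2 h4

end DimDepth

/-! ### Killing variables -/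

section Kill

open MvPowerSeries

variable (k : Type u) [Field k] (n : ℕ)

local notation "𝐱" => exVar k n 0
local notation "𝐲" => exVar k n 1
local notation "𝐳" => exVar k n 2
local notation "𝐰" => exVar k n 3
local notation "𝔟" => exIdeal k n n n ⊤ ⊤
local notation "𝔷" => exIdeal k n ⊤ ⊤ 1 1
local notation "𝔪" => IsLocalRing.maximalIdeal (ExRing k n)

variable {n} {σ : Type*} (e : σ ↪ Fin 4)

lemma relIdeal_le_ker_killCompl (hn : n ≠ 0)
    (he : (0 ∉ Set.range e ∧ 1 ∉ Set.range e) ∨ (2 ∉ Set.range e ∧ 3 ∉ Set.range e)) :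
    ∀ F ∈ relIdeal k n, (killCompl (R := k) e : MvPowerSeries (Fin 4) k →+* MvPowerSeries σ k) F = 0 := by
  intro F hF
  suffices h : relIdeal k n ≤
    RingHom.ker (killCompl (R := k) e : MvPowerSeries (Fin 4) k →+* MvPowerSeries σ k) from h hF
  rcases he with ⟨h1, h2⟩ | ⟨h1, h2⟩
  · refine inf_le_left.trans (Ideal.span_le.2 ?_)
    rintro _ (rfl | rfl) <;> simp [killCompl_X_eq_zero, h1, h2, hn]
  · refine inf_le_right.trans (Ideal.span_le.2 ?_)
    rintro _ (rfl | rfl) <;> simp [killCompl_X_eq_zero, h1, h2]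

/-- The map `k[[X, Y, Z, W]] / ((X ^ n, Y ^ n) ∩ (Z, W)) → k[[σ]]` killing the variables outside
`σ`, where `σ` consists of some of the variables `X, Y` or of some of the variables `Z, W`. -/
noncomputable def exKill (hn : n ≠ 0)
    (he : (0 ∉ Set.range e ∧ 1 ∉ Set.range e) ∨ (2 ∉ Set.range e ∧ 3 ∉ Set.range e)) :
    ExRing k n →+* MvPowerSeries σ k :=
  Ideal.Quotient.lift _ _ (relIdeal_le_ker_killCompl k e hn he)

variable {e} (hn : n ≠ 0)
  (he : (0 ∉ Set.range e ∧ 1 ∉ Set.range e) ∨ (2 ∉ Set.range e ∧ 3 ∉ Set.range e))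

lemma exKill_mk (F : MvPowerSeries (Fin 4) k) :
    exKill k e hn he (Ideal.Quotient.mk _ F) = killCompl e F := rfl

lemma exKill_exVar_apply (i : σ) : exKill k e hn he (exVar k n (e i)) = X i := by
  rw [exVar, exKill_mk, killCompl_X]

lemma exKill_exVar_of_notMem {i : Fin 4} (hi : i ∉ Set.range e) :
    exKill k e hn he (exVar k n i) = 0 := by
  rw [exVar, exKill_mk, killCompl_X_eq_zero hi]

/-- The map `A → k[[X, Y]]` killing `z` and `w`. -/
noncomputable def exToXY (hn : n ≠ 0) : ExRing k n →+* MvPowerSeries (Fin 2) k :=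
  exKill k ⟨![0, 1], by decide⟩ hn (Or.inr (by simp))

/-- The map `A → k[[Z, W]]` killing `x` and `y`. -/
noncomputable def exToZW (hn : n ≠ 0) : ExRing k n →+* MvPowerSeries (Fin 2) k :=
  exKill k ⟨![2, 3], by decide⟩ hn (Or.inl (by simp))

/-- The map `A → k[[Z]]` killing `x`, `y` and `w`. -/
noncomputable def exToZ (hn : n ≠ 0) : ExRing k n →+* MvPowerSeries (Fin 1) k :=
  exKill k ⟨![2], by decide⟩ hn (Or.inl (by simp))

lemma exToXY_x : exToXY k hn 𝐱 = X 0 := exKill_exVar_apply k (e := ⟨![0, 1], by decide⟩) hn _ 0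
lemma exToXY_y : exToXY k hn 𝐲 = X 1 := exKill_exVar_apply k (e := ⟨![0, 1], by decide⟩) hn _ 1
lemma exToXY_z : exToXY k hn 𝐳 = 0 := exKill_exVar_of_notMem k hn _ (by simp)
lemma exToXY_w : exToXY k hn 𝐰 = 0 := exKill_exVar_of_notMem k hn _ (by simp)
lemma exToZW_x : exToZW k hn 𝐱 = 0 := exKill_exVar_of_notMem k hn _ (by simp)
lemma exToZW_y : exToZW k hn 𝐲 = 0 := exKill_exVar_of_notMem k hn _ (by simp)
lemma exToZW_z : exToZW k hn 𝐳 = X 0 := exKill_exVar_apply k (e := ⟨![2, 3], by decide⟩) hn _ 0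
lemma exToZW_w : exToZW k hn 𝐰 = X 1 := exKill_exVar_apply k (e := ⟨![2, 3], by decide⟩) hn _ 1
lemma exToZ_x : exToZ k hn 𝐱 = 0 := exKill_exVar_of_notMem k hn _ (by simp)
lemma exToZ_y : exToZ k hn 𝐲 = 0 := exKill_exVar_of_notMem k hn _ (by simp)
lemma exToZ_z : exToZ k hn 𝐳 = X 0 := exKill_exVar_apply k (e := ⟨![2], by decide⟩) hn _ 0
lemma exToZ_w : exToZ k hn 𝐰 = 0 := exKill_exVar_of_notMem k hn _ (by simp)

/-- The kernels of `A → k[[Z, W]] → k[[Z]]` are nested. -/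
lemma ker_exToZW_le : RingHom.ker (exToZW k hn) ≤ RingHom.ker (exToZ k hn) := by
  intro f hf
  obtain ⟨F, rfl⟩ := Ideal.Quotient.mk_surjective f
  ext d
  have h := congrArg (MvPowerSeries.coeff (Finsupp.single (0 : Fin 2) (d 0))) (RingHom.mem_ker.1 hf)
  rw [exToZW, exKill_mk, coeff_killCompl] at h
  rw [exToZ, exKill_mk, coeff_killCompl]
  refine Eq.trans ?_ h
  congr 2
  have : d = Finsupp.single 0 (d 0) := by ext; simp
  rw [this, Finsupp.embDomain_single, Finsupp.embDomain_single]
  simp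

lemma mvPowerSeries_X_ne_zero {σ : Type*} (i : σ) : (X i : MvPowerSeries σ k) ≠ 0 := by
  classical
  intro h
  have := coeff_index_single_self_X (R := k) i
  rw [h] at this
  simp at this

lemma two_le_ringKrullDim_exRing (hn : n ≠ 0) : 2 ≤ ringKrullDim (ExRing k n) := by
  have := NoZeroDivisors.to_isDomain (MvPowerSeries (Fin 2) k)
  have := NoZeroDivisors.to_isDomain (MvPowerSeries (Fin 1) k)
  have : (RingHom.ker (exToZW k hn)).IsPrime := RingHom.ker_isPrime _
  have : (RingHom.ker (exToZ k hn)).IsPrime := RingHom.ker_isPrime _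
  refine two_le_ringKrullDim_of_lt (p := RingHom.ker (exToZW k hn))
    (q := RingHom.ker (exToZ k hn)) (r := 𝔪)
    (lt_of_le_of_ne (ker_exToZW_le k hn) fun h => ?_)
    (lt_of_le_of_ne (IsLocalRing.le_maximalIdeal (RingHom.ker_ne_top _)) fun h => ?_)
  · have h1 : 𝐰 ∈ RingHom.ker (exToZ k hn) := exToZ_w k hn
    rw [← h, RingHom.mem_ker, exToZW_w] at h1
    exact mvPowerSeries_X_ne_zero k _ h1
  · have h1 := exVar_mem_maximalIdeal k n 2
    rw [← h, RingHom.mem_ker, exToZ_z] at h1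
    exact mvPowerSeries_X_ne_zero k _ h1

variable (n) in
lemma maximalIdeal_le_radical_Q :
    𝔪 ≤ (Ideal.span {𝐱 ^ n - 𝐳, 𝐲 ^ n - 𝐰}).radical := by
  have ha := mem_span_pair_left (𝐱 ^ n - 𝐳) (𝐲 ^ n - 𝐰)
  have hb := mem_span_pair_right (𝐱 ^ n - 𝐳) (𝐲 ^ n - 𝐰)
  refine maximalIdeal_le_radical k n fun i => ?_
  fin_cases i
  · refine ⟨2 * n, ?_⟩
    have : 𝐱 ^ (2 * n) = 𝐱 ^ n * (𝐱 ^ n - 𝐳) := by linear_combination xn_mul_z k n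
    exact this ▸ Ideal.mul_mem_left _ _ ha
  · refine ⟨2 * n, ?_⟩
    have : 𝐲 ^ (2 * n) = 𝐲 ^ n * (𝐲 ^ n - 𝐰) := by linear_combination yn_mul_w k n
    exact this ▸ Ideal.mul_mem_left _ _ hb
  · refine ⟨2, ?_⟩
    have : 𝐳 ^ 2 = -𝐳 * (𝐱 ^ n - 𝐳) := by linear_combination xn_mul_z k n
    exact this ▸ Ideal.mul_mem_left _ _ ha
  · refine ⟨2, ?_⟩
    have : 𝐰 ^ 2 = -𝐰 * (𝐲 ^ n - 𝐰) := by linear_combination yn_mul_w k n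
    exact this ▸ Ideal.mul_mem_left _ _ hb

/-- The relation `(x y ^ (n - 1)) ^ 2 (z, w) = 0`. -/
lemma theta_sq_mul_eq_zero (hn : 2 ≤ n) {f : ExRing k n} (hf : f ∈ 𝔷) :
    (𝐱 * 𝐲 ^ (n - 1)) ^ 2 * f = 0 := mul_eq_zero_of_mem (theta_sq_mem k n hn) hf

lemma maximalIdeal_le_radical_Q' (hn : 2 ≤ n) :
    𝔪 ≤ (Ideal.span {𝐱 * 𝐲 ^ (n - 1) - 𝐳, 𝐱 ^ n + 𝐲 ^ n - 𝐰}).radical := by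
  set J := Ideal.span {𝐱 * 𝐲 ^ (n - 1) - 𝐳, 𝐱 ^ n + 𝐲 ^ n - 𝐰} with hJ
  have ha : 𝐱 * 𝐲 ^ (n - 1) - 𝐳 ∈ J := mem_span_pair_left _ _
  have hb : 𝐱 ^ n + 𝐲 ^ n - 𝐰 ∈ J := mem_span_pair_right _ _
  have hz : 𝐳 ∈ J.radical := by
    refine ⟨3, ?_⟩
    have : 𝐳 ^ 3 = -(𝐳 * (𝐱 * 𝐲 ^ (n - 1) + 𝐳)) * (𝐱 * 𝐲 ^ (n - 1) - 𝐳) := by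
      linear_combination theta_sq_mul_eq_zero k hn (z_mem k n)
    exact this ▸ Ideal.mul_mem_left _ _ ha
  have hw : 𝐰 ∈ J.radical := by
    refine ⟨2, ?_⟩
    have : 𝐰 ^ 2 = -𝐰 * (𝐱 ^ n + 𝐲 ^ n - 𝐰) := by
      linear_combination xn_mul_w k n + yn_mul_w k n
    exact this ▸ Ideal.mul_mem_left _ _ hb
  have hθ : 𝐱 * 𝐲 ^ (n - 1) ∈ J.radical := by
    have : 𝐱 * 𝐲 ^ (n - 1) = (𝐱 * 𝐲 ^ (n - 1) - 𝐳) + 𝐳 := by ring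
    exact this ▸ add_mem (Ideal.le_radical ha) hz
  have hξ : 𝐱 ^ n + 𝐲 ^ n ∈ J.radical := by
    have : 𝐱 ^ n + 𝐲 ^ n = (𝐱 ^ n + 𝐲 ^ n - 𝐰) + 𝐰 := by ring
    exact this ▸ add_mem (Ideal.le_radical hb) hw
  have hy1 : 𝐲 * 𝐲 ^ (n - 1) = 𝐲 ^ n := by rw [← pow_succ', Nat.sub_add_cancel (by omega)]
  have hx : 𝐱 ∈ J.radical := by
    rw [← Ideal.radical_idem J]
    refine ⟨n + 1, ?_⟩
    have : 𝐱 ^ (n + 1) = 𝐱 * (𝐱 ^ n + 𝐲 ^ n) - 𝐲 * (𝐱 * 𝐲 ^ (n - 1)) := by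
      linear_combination 𝐱 * hy1
    exact this ▸ sub_mem (Ideal.mul_mem_left _ _ hξ) (Ideal.mul_mem_left _ _ hθ)
  have hy : 𝐲 ∈ J.radical := by
    rw [← Ideal.radical_idem J]
    refine ⟨n, ?_⟩
    have : 𝐲 ^ n = (𝐱 ^ n + 𝐲 ^ n) - 𝐱 ^ n := by ring
    exact this ▸ sub_mem hξ (Ideal.pow_mem_of_mem _ hx _ (by omega))
  refine maximalIdeal_le_radical k n fun i => ?_
  fin_cases i <;> assumption

lemma theta_mem_maximalIdeal : 𝐱 * 𝐲 ^ (n - 1) ∈ 𝔪 :=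
  Ideal.mul_mem_right _ _ (exVar_mem_maximalIdeal k n 0)

lemma span_Q_le_maximalIdeal (hn : n ≠ 0) : Ideal.span {𝐱 ^ n - 𝐳, 𝐲 ^ n - 𝐰} ≤ 𝔪 :=
  (span_Q_le k n).trans (c_le_maximalIdeal k n hn)

lemma span_Q'_le_maximalIdeal (hn : 2 ≤ n) :
    Ideal.span {𝐱 * 𝐲 ^ (n - 1) - 𝐳, 𝐱 ^ n + 𝐲 ^ n - 𝐰} ≤ 𝔪 := by
  have h (i : Fin 4) := exVar_mem_maximalIdeal k n i
  rw [Ideal.span_le]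
  rintro _ (rfl | rfl)
  · exact sub_mem (theta_mem_maximalIdeal k) (h 2)
  · exact sub_mem (add_mem (Ideal.pow_mem_of_mem _ (h 0) _ (by omega))
      (Ideal.pow_mem_of_mem _ (h 1) _ (by omega))) (h 3)

lemma radical_eq_maximalIdeal {J : Ideal (ExRing k n)} (h1 : J ≤ 𝔪) (h2 : 𝔪 ≤ J.radical) :
    J.radical = 𝔪 :=
  le_antisymm ((Ideal.IsPrime.radical_le_iff inferInstance).2 h1) h2

lemma ringKrullDim_exRing (hn : n ≠ 0) : ringKrullDim (ExRing k n) = 2 :=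
  le_antisymm (ringKrullDim_le_two_of_maximalIdeal_le_radical
    (radical_eq_maximalIdeal k (span_Q_le_maximalIdeal k hn) (maximalIdeal_le_radical_Q k n)).symm)
    (two_le_ringKrullDim_exRing k hn)

lemma isParameterIdeal_span_pair (hn : n ≠ 0) {a b : ExRing k n} (h1 : Ideal.span {a, b} ≤ 𝔪)
    (h2 : 𝔪 ≤ (Ideal.span {a, b}).radical) : IsParameterIdeal (Ideal.span {a, b}) := by
  refine ⟨2, ringKrullDim_exRing k hn, ⟨![a, b], ?_⟩, radical_eq_maximalIdeal k h1 h2⟩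
  rw [Matrix.range_cons, Matrix.range_cons, Matrix.range_empty, Set.union_empty,
    Set.singleton_union]

variable (n) in
/-- `y ^ n - w` is a non-zero-divisor on `A`. -/
lemma yn_sub_w_regular (f : ExRing k n) (h : (𝐲 ^ n - 𝐰) * f = 0) : f = 0 := by
  have : f ∈ 𝔟 ⊓ 𝔷 := ⟨(isRegularPair_Q_xy k n).fst f (h ▸ zero_mem _),
    (isRegularPair_Q_zw k n).fst f (h ▸ zero_mem _)⟩
  rwa [exIdeal_inf_eq_bot] at this

/-- A monomial `x ^ i y ^ j` with `i < p` and `j < q` is not in `(x ^ p, y ^ q, z, w)`. -/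
lemma x_pow_mul_y_pow_notMem {i j p q : ℕ} (hi : i < p) (hj : j < q) :
    𝐱 ^ i * 𝐲 ^ j ∉ exIdeal k n p q 1 1 := by
  have a1 (p q : ℕ∞) : IsAdmissible n p q 1 1 := Or.inr ⟨le_rfl, le_rfl⟩
  rw [(a1 _ _).x_pow_mul_mem, ← mul_one (_ ^ j), (a1 _ _).y_pow_mul_mem,
    ← map_one (Ideal.Quotient.mk (relIdeal k n)), (a1 _ _).mk_mem, mem_monoIdeal]
  intro h
  have h1 := h 0 fun i => by
    fin_cases i
    · simpa using by exact_mod_cast hi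
    · simpa using by exact_mod_cast hj
    · simp
    · simp
  simp at h1

/-- The socle element `x ^ (n - 1) y ^ (n - 1) w` of `A / (y ^ n - w)` shows that the depth of `A`
is at most one. -/
lemma localDepth_exRing (hn : n ≠ 0) : localDepth (ExRing k n) = 1 := by
  have hb : 𝐲 ^ n - 𝐰 ∈ 𝔪 := span_Q_le_maximalIdeal k hn (mem_span_pair_right _ _)
  refine le_antisymm ?_ (one_le_localDepth (yn_sub_w_regular k n) hb)
  have hx1 : 𝐱 * 𝐱 ^ (n - 1) = 𝐱 ^ n := by
    rw [← pow_succ', Nat.sub_add_cancel (Nat.pos_of_ne_zero hn)]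
  have hy1 : 𝐲 * 𝐲 ^ (n - 1) = 𝐲 ^ n := by
    rw [← pow_succ', Nat.sub_add_cancel (Nat.pos_of_ne_zero hn)]
  refine localDepth_le_one (f := 𝐰 * (𝐱 ^ (n - 1) * 𝐲 ^ (n - 1))) (yn_sub_w_regular k n) ?_ ?_
  · intro g hg
    have hg1 : g ∈ 𝔷 := (isRegularPair_Q_zw k n).fst g
      (hg ▸ Ideal.mul_mem_right _ _ (w_mem k n))
    have h1 : 𝐰 ^ 1 * (𝐱 ^ (n - 1) * 𝐲 ^ (n - 1) + g) ∈ 𝔟 := by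
      have : 𝐰 ^ 1 * (𝐱 ^ (n - 1) * 𝐲 ^ (n - 1) + g) = g * 𝐲 ^ n := by linear_combination hg
      exact this ▸ Ideal.mul_mem_left _ _ (yn_mem k n)
    have h2 := ((adm_xy n).w_pow_mul_mem 1).1 h1
    have h3 : 𝐱 ^ (n - 1) * 𝐲 ^ (n - 1) ∈ 𝔟 ⊔ 𝔷 := by
      have : 𝐱 ^ (n - 1) * 𝐲 ^ (n - 1) = (𝐱 ^ (n - 1) * 𝐲 ^ (n - 1) + g) - g := by ring
      rw [this]
      exact sub_mem (Ideal.mem_sup_left (by simpa using h2)) (Ideal.mem_sup_right hg1)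
    rw [exIdeal_xyzw] at h3
    exact x_pow_mul_y_pow_notMem k (by omega) (by omega) h3
  · intro m hm
    rw [maximalIdeal_eq_span] at hm
    have hI : Ideal.span {𝐱, 𝐲, 𝐳, 𝐰} ≤ (Ideal.span {𝐲 ^ n - 𝐰}).colon
        {𝐰 * (𝐱 ^ (n - 1) * 𝐲 ^ (n - 1))} := by
      rw [Ideal.span_le]
      rintro _ (rfl | rfl | rfl | rfl) <;>
        rw [SetLike.mem_coe, Submodule.mem_colon_singleton, Ideal.mem_span_singleton']
      · exact ⟨0, by linear_combination -𝐰 * 𝐲 ^ (n - 1) * hx1 - 𝐲 ^ (n - 1) * xn_mul_w k n⟩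
      · exact ⟨0, by linear_combination -𝐰 * 𝐱 ^ (n - 1) * hy1 - 𝐱 ^ (n - 1) * yn_mul_w k n⟩
      · exact ⟨-𝐳 * (𝐱 ^ (n - 1) * 𝐲 ^ (n - 1)), by
          linear_combination -(𝐱 ^ (n - 1) * 𝐲 ^ (n - 1)) * yn_mul_z k n⟩
      · exact ⟨-𝐰 * (𝐱 ^ (n - 1) * 𝐲 ^ (n - 1)), by
          linear_combination -(𝐱 ^ (n - 1) * 𝐲 ^ (n - 1)) * yn_mul_w k n⟩
    obtain ⟨g, hg⟩ := Ideal.mem_span_singleton'.1 (Submodule.mem_colon_singleton.1 (hI hm))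
    exact ⟨g, by rw [← smul_eq_mul, ← hg]; ring⟩

end Kill


/-! ### Integral closures -/

section IntegralClosure

variable {R : Type*} [CommRing R]

lemma span_pair_pow_le_iff {x y : R} {m : ℕ} {K : Ideal R} :
    Ideal.span {x, y} ^ m ≤ K ↔ ∀ i j, i + j = m → x ^ i * y ^ j ∈ K := by
  constructor
  · rintro h i j rfl
    apply h
    rw [pow_add]
    exact Ideal.mul_mem_mul (Ideal.pow_mem_pow (mem_span_pair_left _ _) i)
      (Ideal.pow_mem_pow (mem_span_pair_right _ _) j)
  · induction m generalizing K with
    | zero => simp [Ideal.one_eq_top, Ideal.eq_top_iff_one]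
    | succ m ih =>
      intro h
      rw [span_pair_pow_succ, sup_le_iff, Ideal.span_singleton_le_iff_mem]
      refine ⟨by simpa using h (m + 1) 0 rfl, Ideal.mul_le.2 fun r hr s hs => ?_⟩
      obtain ⟨c, rfl⟩ := Ideal.mem_span_singleton'.1 hr
      have h1 : Ideal.span {x, y} ^ m ≤ K.colon {y} := ih fun i j hij => by
        rw [Submodule.mem_colon_singleton, smul_eq_mul]
        convert h i (j + 1) (by omega) using 1
        ring
      have h2 := Submodule.mem_colon_singleton.1 (h1 hs)
      rw [smul_eq_mul] at h2
      have : c * y * s = c * (s * y) := by ring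
      exact this ▸ Ideal.mul_mem_left _ _ h2

lemma pow_mul_pow_mem_span_pair_pow (x y : R) {i j m : ℕ} (h : i + j = m) :
    x ^ i * y ^ j ∈ Ideal.span {x, y} ^ m :=
  span_pair_pow_le_iff.1 le_rfl i j h

lemma idealIntegralClosure_mono {I J : Ideal R} (h : I ≤ J) :
    idealIntegralClosure I ⊆ idealIntegralClosure J := by
  rintro f ⟨N, hN, a, ha, hf⟩
  exact ⟨N, hN, a, fun i => Ideal.pow_right_mono h i (ha i), hf⟩

/-- An ideal `Q` is a reduction of `I` as soon as `I ^ (m + 1) ≤ Q I ^ m`: multiplication by an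
element of `I` maps `I ^ m` into `Q I ^ m`, so the Cayley-Hamilton theorem gives an integral
equation. -/
lemma subset_idealIntegralClosure [IsNoetherianRing R] {Q I : Ideal R} {m : ℕ}
    (h : I ^ (m + 1) ≤ Q * I ^ m) : (I : Set R) ⊆ idealIntegralClosure Q := by
  intro f hf
  let φ : Module.End R (I ^ m : Ideal R) := f • LinearMap.id
  have hφ : LinearMap.range φ ≤ Q • ⊤ := by
    rintro _ ⟨⟨g, hg⟩, rfl⟩
    have h1 : f * g ∈ Q * I ^ m := h (by rw [pow_succ']; exact Ideal.mul_mem_mul hf hg)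
    have h2 : Submodule.map (I ^ m : Ideal R).subtype (Q • ⊤) = Q * I ^ m := by
      rw [Submodule.map_smul'', Submodule.map_top, Submodule.range_subtype, smul_eq_mul]
    rw [← h2] at h1
    obtain ⟨u, hu, hu'⟩ := h1
    have : φ ⟨g, hg⟩ = u := Subtype.ext hu'.symm
    exact this ▸ hu
  obtain ⟨p, hp, -, hpc, hp0⟩ :=
    LinearMap.exists_monic_and_natDegree_eq_and_coeff_mem_pow_and_aeval_eq_zero R φ Q hφ
  have hφp (q : R[X]) (g : (I ^ m : Ideal R)) : aeval φ q g = q.eval f • g := by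
    have : φ = algebraMap R (Module.End R (I ^ m : Ideal R)) f := by
      ext g; rfl
    rw [this, aeval_algebraMap_apply, Polynomial.coe_aeval_eq_eval]
    rfl
  have h3 : p.eval f * f ^ m = 0 := by
    have := hφp p ⟨f ^ m, Ideal.pow_mem_pow hf m⟩
    rw [hp0] at this
    exact (congrArg Subtype.val this).symm
  -- `T ^ (m + 1) p` is the required equation, the extra `T` making its degree positive
  let D := p.natDegree
  have hq0 : p.eval f * f ^ (m + 1) = 0 := by rw [pow_succ, ← mul_assoc, h3, zero_mul]
  refine ⟨D + (m + 1), by omega, fun i => if i ≤ D then p.coeff (D - i) else 0, fun i => ?_, ?_⟩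
  · dsimp only
    split_ifs with hi
    · have := hpc (D - i)
      rwa [Nat.sub_sub_self hi] at this
    · exact zero_mem _
  · refine Eq.trans ?_ hq0
    rw [Polynomial.eval_eq_sum_range, Finset.sum_range_succ, hp.coeff_natDegree, one_mul,
      add_mul, add_comm]
    congr 1
    swap
    · rw [pow_add]
    have hsub : Finset.Icc 1 D ⊆ Finset.Icc 1 (D + (m + 1)) := Finset.Icc_subset_Icc le_rfl (by omega)
    rw [← Finset.sum_subset hsub, Finset.sum_mul]
    · refine Finset.sum_bij' (fun i _ => D - i) (fun i _ => D - i) ?_ ?_ ?_ ?_ ?_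
      · intro i hi
        rw [Finset.mem_Icc] at hi
        exact Finset.mem_range.2 (by omega)
      · intro i hi
        rw [Finset.mem_range] at hi
        exact Finset.mem_Icc.2 ⟨by omega, by omega⟩
      · intro i hi
        rw [Finset.mem_Icc] at hi
        omega
      · intro i hi
        rw [Finset.mem_range] at hi
        change i < D at hi
        omega
      · intro i hi
        rw [Finset.mem_Icc] at hi
        dsimp only
        rw [if_pos hi.2, mul_assoc, ← pow_add]
        congr 2
        omega
    · intro i hi hi'
      rw [Finset.mem_Icc] at hi hi'
      dsimp only
      rw [if_neg (by omega), zero_mul]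

end IntegralClosure

section Order

open MvPowerSeries

variable (k : Type*) [Field k] {σ : Type*}

/-- The ideal of the power series of order at least `m`. -/
def orderIdeal (m : ℕ) : Ideal (MvPowerSeries σ k) where
  carrier := {f | (m : ℕ∞) ≤ f.order}
  add_mem' hf hg := (le_min hf hg).trans min_order_le_add
  zero_mem' := by simp
  smul_mem' c f hf := by
    change (m : ℕ∞) ≤ (c * f).order
    exact (le_add_left hf).trans le_order_mul

lemma mem_orderIdeal {m : ℕ} {f : MvPowerSeries σ k} : f ∈ orderIdeal k m ↔ (m : ℕ∞) ≤ f.order :=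
  Iff.rfl

lemma orderIdeal_mul_le (i j : ℕ) :
    (orderIdeal k i * orderIdeal k j : Ideal (MvPowerSeries σ k)) ≤ orderIdeal k (i + j) := by
  refine Ideal.mul_le.2 fun f hf g hg => ?_
  rw [mem_orderIdeal] at *
  push_cast
  exact (add_le_add hf hg).trans le_order_mul

variable {R : Type*} [CommRing R] (φ : R →+* MvPowerSeries σ k)

lemma pow_le_comap_orderIdeal {J : Ideal R} {m : ℕ} (h : J ≤ (orderIdeal k m).comap φ) (i : ℕ) :
    J ^ i ≤ (orderIdeal k (i * m)).comap φ := by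
  induction i with
  | zero =>
    intro f _
    rw [Ideal.mem_comap, mem_orderIdeal]
    simp
  | succ i ih =>
    rw [pow_succ, add_mul, one_mul]
    refine Ideal.mul_le.2 fun f hf g hg => ?_
    rw [Ideal.mem_comap, map_mul]
    exact orderIdeal_mul_le k _ _ (Ideal.mul_mem_mul (ih hf) (h hg))

/-- The ideals defined by the order of power series are integrally closed, by comparing orders in an
integral equation. -/
lemma idealIntegralClosure_subset_comap_orderIdeal {J : Ideal R} {m : ℕ}
    (h : J ≤ (orderIdeal k m).comap φ) :
    idealIntegralClosure J ⊆ (orderIdeal k m).comap φ := by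
  rintro f ⟨N, hN, a, ha, hf⟩
  by_contra hcon
  rw [SetLike.mem_coe, Ideal.mem_comap, mem_orderIdeal, not_le] at hcon
  obtain ⟨v, hv⟩ := ENat.ne_top_iff_exists.1 (hcon.trans_le le_top).ne
  rw [← hv, Nat.cast_lt] at hcon
  have hpow (j : ℕ) : (φ f ^ j).order = ((j * v : ℕ) : ℕ∞) := by
    induction j with
    | zero =>
      classical
      have := weightedOrder_one (σ := σ) (R := k) (fun _ => 1)
      rw [pow_zero, zero_mul]; exact this
    | succ j ih => rw [pow_succ, order_mul, ih, ← hv]; push_cast; ring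
  have h1 : φ f ^ N ∈ orderIdeal k (N * v + 1) := by
    have h2 : φ f ^ N = -∑ i ∈ Finset.Icc 1 N, φ (a i) * φ f ^ (N - i) := by
      rw [eq_neg_iff_add_eq_zero]
      simpa using congrArg φ hf
    rw [h2]
    refine neg_mem (sum_mem fun i hi => ?_)
    rw [Finset.mem_Icc] at hi
    have h3 := pow_le_comap_orderIdeal k φ h i (ha i)
    rw [Ideal.mem_comap, mem_orderIdeal] at h3
    rw [mem_orderIdeal, order_mul, hpow]
    refine le_trans ?_ (add_le_add h3 le_rfl)
    norm_cast
    obtain ⟨l, rfl⟩ := Nat.exists_eq_add_of_le hi.2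
    obtain ⟨d, rfl⟩ := Nat.exists_eq_add_of_lt hcon
    rw [Nat.add_sub_cancel_left]
    nlinarith [hi.1]
  rw [mem_orderIdeal, hpow] at h1
  norm_cast at h1
  omega

end Order


section Reduction

variable {R : Type*} [CommRing R]

lemma sup_pow_le (I J : Ideal R) (m : ℕ) : (I ⊔ J) ^ m ≤ I ^ m ⊔ J := by
  induction m with
  | zero => simp
  | succ m ih =>
    rw [pow_succ, pow_succ]
    refine (Ideal.mul_mono_left ih).trans ?_
    rw [Ideal.sup_mul, Ideal.mul_sup]
    exact sup_le (sup_le_sup_left Ideal.mul_le_right _) (Ideal.mul_le_left.trans le_sup_right)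

/-- Let `I = 𝔫 + (z, w)` with `𝔫 ^ 2 (z, w) = 0`. If `(α, β)` is a reduction of `𝔫` and
`(z, w) ^ 2 I ≤ (α - z, β - w) I ^ 2`, then `(α - z, β - w)` is a reduction of `I`. -/
lemma pow_three_le_mul_sq {𝔫 : Ideal R} {α β z w : R} (h : 𝔫 ^ 2 ≤ Ideal.span {α, β} * 𝔫)
    (h0 : ∀ g ∈ 𝔫 ^ 2, z * g = 0 ∧ w * g = 0)
    (hz : ∀ v ∈ 𝔫 ⊔ Ideal.span {z, w}, z * z * v ∈
      Ideal.span {α - z, β - w} * (𝔫 ⊔ Ideal.span {z, w}) ^ 2 ∧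
      z * w * v ∈ Ideal.span {α - z, β - w} * (𝔫 ⊔ Ideal.span {z, w}) ^ 2 ∧
      w * w * v ∈ Ideal.span {α - z, β - w} * (𝔫 ⊔ Ideal.span {z, w}) ^ 2) :
    (𝔫 ⊔ Ideal.span {z, w}) ^ 3 ≤
      Ideal.span {α - z, β - w} * (𝔫 ⊔ Ideal.span {z, w}) ^ 2 := by
  set I := 𝔫 ⊔ Ideal.span {z, w} with hI
  set K := Ideal.span {α - z, β - w} * I ^ 2 with hK
  have hnI : 𝔫 ≤ I := le_sup_left
  have h0' : ∀ g ∈ 𝔫 ^ 2, ∀ v ∈ Ideal.span {z, w}, v * g = 0 := by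
    intro g hg v hv
    obtain ⟨c, d, rfl⟩ := Ideal.mem_span_pair.1 hv
    linear_combination c * (h0 g hg).1 + d * (h0 g hg).2
  have h1 : 𝔫 ^ 3 ≤ K := by
    have h2 : 𝔫 ^ 3 ≤ Ideal.span {α, β} * 𝔫 ^ 2 := by
      rw [pow_succ, pow_two 𝔫, ← mul_assoc, ← pow_two]
      exact Ideal.mul_mono_left h
    refine h2.trans (Ideal.mul_le.2 fun r hr g hg => ?_)
    obtain ⟨c, d, rfl⟩ := Ideal.mem_span_pair.1 hr
    have h3 : (c * α + d * β) * g = (α - z) * (c * g) + (β - w) * (d * g) := by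
      linear_combination c * (h0 g hg).1 + d * (h0 g hg).2
    have h4 : g ∈ I ^ 2 := Ideal.pow_right_mono hnI 2 hg
    rw [h3]
    exact add_mem (Ideal.mul_mem_mul (mem_span_pair_left _ _) (Ideal.mul_mem_left _ _ h4))
      (Ideal.mul_mem_mul (mem_span_pair_right _ _) (Ideal.mul_mem_left _ _ h4))
  have h2 : ∀ p ∈ Ideal.span {z, w}, ∀ q ∈ Ideal.span {z, w}, ∀ v ∈ I, p * q * v ∈ K := by
    intro p hp q hq v hv
    obtain ⟨c, d, rfl⟩ := Ideal.mem_span_pair.1 hp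
    obtain ⟨c', d', rfl⟩ := Ideal.mem_span_pair.1 hq
    obtain ⟨e1, e2, e3⟩ := hz v hv
    have : (c * z + d * w) * (c' * z + d' * w) * v =
      c * c' * (z * z * v) + (c * d' + d * c') * (z * w * v) + d * d' * (w * w * v) := by ring
    rw [this]
    exact add_mem (add_mem (K.mul_mem_left _ e1) (K.mul_mem_left _ e2)) (K.mul_mem_left _ e3)
  rw [pow_succ, pow_two]
  refine Ideal.mul_le.2 fun u hu v hv => ?_
  refine Submodule.mul_induction_on hu (fun s hs t ht => ?_) fun s t hs ht => ?_
  · obtain ⟨n1, hn1, z1, hz1, rfl⟩ := Submodule.mem_sup.1 hs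
    obtain ⟨n2, hn2, z2, hz2, rfl⟩ := Submodule.mem_sup.1 ht
    obtain ⟨n3, hn3, z3, hz3, rfl⟩ := Submodule.mem_sup.1 hv
    have m12 : n1 * n2 ∈ 𝔫 ^ 2 := by rw [pow_two]; exact Ideal.mul_mem_mul hn1 hn2
    have m13 : n1 * n3 ∈ 𝔫 ^ 2 := by rw [pow_two]; exact Ideal.mul_mem_mul hn1 hn3
    have m23 : n2 * n3 ∈ 𝔫 ^ 2 := by rw [pow_two]; exact Ideal.mul_mem_mul hn2 hn3
    have e : (n1 + z1) * (n2 + z2) * (n3 + z3) =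
        n1 * n2 * n3 + z1 * z2 * (n3 + z3) + z1 * z3 * n2 + z2 * z3 * n1 := by
      linear_combination h0' _ m12 _ hz3 + h0' _ m13 _ hz2 + h0' _ m23 _ hz1
    rw [e]
    refine add_mem (add_mem (add_mem (h1 ?_) (h2 _ hz1 _ hz2 _ hv)) (h2 _ hz1 _ hz3 _ (hnI hn2)))
      (h2 _ hz2 _ hz3 _ (hnI hn1))
    rw [pow_succ]
    exact Ideal.mul_mem_mul m12 hn3
  · rw [add_mul]; exact add_mem hs ht

end Reduction

section ExIntegral

open MvPowerSeries

variable (k : Type u) [Field k] (n : ℕ)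

local notation "𝐱" => exVar k n 0
local notation "𝐲" => exVar k n 1
local notation "𝐳" => exVar k n 2
local notation "𝐰" => exVar k n 3
local notation "𝔟" => exIdeal k n n n ⊤ ⊤
local notation "𝔷" => exIdeal k n ⊤ ⊤ 1 1
local notation "𝔪" => IsLocalRing.maximalIdeal (ExRing k n)
local notation "𝔫" => Ideal.span {exVar k n 0, exVar k n 1} ^ n

lemma span_xy_pow_two_eq : (𝔫) ^ 2 = Ideal.span {𝐱, 𝐲} ^ (n * 2) := (pow_mul (Ideal.span {𝐱, 𝐲}) n 2).symm

lemma maximalIdeal_pow_sup :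
    𝔪 ^ n ⊔ Ideal.span {𝐳, 𝐰} = 𝔫 ⊔ Ideal.span {𝐳, 𝐰} := by
  have h1 : 𝔪 = Ideal.span {𝐱, 𝐲} ⊔ Ideal.span {𝐳, 𝐰} := by
    rw [maximalIdeal_eq_span, ← Ideal.span_union, Set.insert_union, Set.singleton_union]
  apply le_antisymm
  · refine sup_le ?_ le_sup_right
    rw [h1]
    exact sup_pow_le _ _ n
  · exact sup_le_sup_right (Ideal.pow_right_mono (h1 ▸ le_sup_left) n) _

lemma span_xy_pow_two_mul_le : (𝔫) ^ 2 ≤ Ideal.span {𝐱 ^ n, 𝐲 ^ n} * 𝔫 := by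
  rw [span_xy_pow_two_eq, span_pair_pow_le_iff]
  intro i j hij
  rcases le_total n i with h | h
  · obtain ⟨l, rfl⟩ := Nat.exists_eq_add_of_le h
    rw [pow_add, mul_assoc]
    exact Ideal.mul_mem_mul (mem_span_pair_left _ _) (pow_mul_pow_mem_span_pair_pow _ _ (by omega))
  · obtain ⟨l, rfl⟩ := Nat.exists_eq_add_of_le (show n ≤ j by omega)
    rw [pow_add, mul_left_comm]
    exact Ideal.mul_mem_mul (mem_span_pair_right _ _) (pow_mul_pow_mem_span_pair_pow _ _ (by omega))

/-- The forms `x y ^ (n - 1)`, `x ^ n + y ^ n` generate a reduction of `(x, y) ^ n`. The monomials of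
degree `2 n` not divisible by the first form are rewritten by means of the second one. -/
lemma span_xy_pow_two_mul_le' (hn : 2 ≤ n) :
    (𝔫) ^ 2 ≤ Ideal.span {𝐱 * 𝐲 ^ (n - 1), 𝐱 ^ n + 𝐲 ^ n} * 𝔫 := by
  have key : ∀ i j, 1 ≤ i → n - 1 ≤ j → i + j = n * 2 →
      𝐱 ^ i * 𝐲 ^ j ∈ Ideal.span {𝐱 * 𝐲 ^ (n - 1), 𝐱 ^ n + 𝐲 ^ n} * 𝔫 := by
    intro i j hi hj hij
    obtain ⟨i, rfl⟩ := Nat.exists_eq_add_of_le hi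
    obtain ⟨j, rfl⟩ := Nat.exists_eq_add_of_le hj
    have : 𝐱 ^ (1 + i) * 𝐲 ^ (n - 1 + j) = 𝐱 * 𝐲 ^ (n - 1) * (𝐱 ^ i * 𝐲 ^ j) := by ring
    rw [this]
    exact Ideal.mul_mem_mul (mem_span_pair_left _ _) (pow_mul_pow_mem_span_pair_pow _ _ (by omega))
  rw [span_xy_pow_two_eq, span_pair_pow_le_iff]
  intro i j hij
  by_cases h1 : 1 ≤ i ∧ n - 1 ≤ j
  · exact key i j h1.1 h1.2 hij
  by_cases h2 : n ≤ i
  · obtain ⟨i, rfl⟩ := Nat.exists_eq_add_of_le h2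
    have : 𝐱 ^ (n + i) * 𝐲 ^ j = (𝐱 ^ n + 𝐲 ^ n) * (𝐱 ^ i * 𝐲 ^ j) - 𝐱 ^ i * 𝐲 ^ (n + j) := by ring
    rw [this]
    exact sub_mem (Ideal.mul_mem_mul (mem_span_pair_right _ _)
      (pow_mul_pow_mem_span_pair_pow _ _ (by omega))) (key _ _ (by omega) (by omega) (by omega))
  · have hi : i = 0 := by omega
    obtain rfl : j = n + n := by omega
    subst hi
    have : 𝐱 ^ 0 * 𝐲 ^ (n + n) = (𝐱 ^ n + 𝐲 ^ n) * (𝐱 ^ 0 * 𝐲 ^ n) - 𝐱 ^ n * 𝐲 ^ n := by ring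
    rw [this]
    exact sub_mem (Ideal.mul_mem_mul (mem_span_pair_right _ _)
      (pow_mul_pow_mem_span_pair_pow _ _ (by omega))) (key _ _ (by omega) (by omega) (by omega))

lemma span_xy_pow_two_le : (𝔫) ^ 2 ≤ 𝔟 := by
  rw [exIdeal_xy]
  exact (span_xy_pow_two_mul_le k n).trans Ideal.mul_le_left

lemma zw_mul_eq_zero {g : ExRing k n} (hg : g ∈ (𝔫) ^ 2) : 𝐳 * g = 0 ∧ 𝐰 * g = 0 := by
  rw [mul_comm, mul_comm 𝐰]
  exact ⟨mul_eq_zero_of_mem (span_xy_pow_two_le k n hg) (z_mem k n),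
    mul_eq_zero_of_mem (span_xy_pow_two_le k n hg) (w_mem k n)⟩

lemma pow_three_le_Q : (𝔫 ⊔ Ideal.span {𝐳, 𝐰}) ^ 3 ≤
    Ideal.span {𝐱 ^ n - 𝐳, 𝐲 ^ n - 𝐰} * (𝔫 ⊔ Ideal.span {𝐳, 𝐰}) ^ 2 := by
  refine pow_three_le_mul_sq (span_xy_pow_two_mul_le k n) (fun g => zw_mul_eq_zero k n)
    fun v hv => ?_
  have hz : 𝐳 * -v ∈ (𝔫 ⊔ Ideal.span {𝐳, 𝐰}) ^ 2 := by
    rw [pow_two]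
    exact Ideal.mul_mem_mul (Ideal.mem_sup_right (mem_span_pair_left _ _)) (neg_mem hv)
  have hw : 𝐰 * -v ∈ (𝔫 ⊔ Ideal.span {𝐳, 𝐰}) ^ 2 := by
    rw [pow_two]
    exact Ideal.mul_mem_mul (Ideal.mem_sup_right (mem_span_pair_right _ _)) (neg_mem hv)
  have e1 : 𝐳 * 𝐳 * v = (𝐱 ^ n - 𝐳) * (𝐳 * -v) := by linear_combination v * xn_mul_z k n
  have e2 : 𝐳 * 𝐰 * v = (𝐲 ^ n - 𝐰) * (𝐳 * -v) := by linear_combination v * yn_mul_z k n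
  have e3 : 𝐰 * 𝐰 * v = (𝐲 ^ n - 𝐰) * (𝐰 * -v) := by linear_combination v * yn_mul_w k n
  rw [e1, e2, e3]
  exact ⟨Ideal.mul_mem_mul (mem_span_pair_left _ _) hz,
    Ideal.mul_mem_mul (mem_span_pair_right _ _) hz, Ideal.mul_mem_mul (mem_span_pair_right _ _) hw⟩

lemma pow_three_le_Q' (hn : 2 ≤ n) : (𝔫 ⊔ Ideal.span {𝐳, 𝐰}) ^ 3 ≤
    Ideal.span {𝐱 * 𝐲 ^ (n - 1) - 𝐳, 𝐱 ^ n + 𝐲 ^ n - 𝐰} * (𝔫 ⊔ Ideal.span {𝐳, 𝐰}) ^ 2 := by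
  refine pow_three_le_mul_sq (span_xy_pow_two_mul_le' k n hn) (fun g => zw_mul_eq_zero k n)
    fun v hv => ?_
  set I := 𝔫 ⊔ Ideal.span {𝐳, 𝐰} with hI
  have hz' : ∀ v ∈ I, 𝐳 * -v ∈ I ^ 2 := fun v hv => by
    rw [pow_two]
    exact Ideal.mul_mem_mul (Ideal.mem_sup_right (mem_span_pair_left _ _)) (neg_mem hv)
  have hz := hz' v hv
  have hw : 𝐰 * -v ∈ I ^ 2 := by
    rw [pow_two]
    exact Ideal.mul_mem_mul (Ideal.mem_sup_right (mem_span_pair_right _ _)) (neg_mem hv)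
  have hθ : 𝐱 * 𝐲 ^ (n - 1) ∈ 𝔫 := by
    simpa using pow_mul_pow_mem_span_pair_pow 𝐱 𝐲 (show 1 + (n - 1) = n by omega)
  have e2 : 𝐳 * 𝐰 * v = (𝐱 ^ n + 𝐲 ^ n - 𝐰) * (𝐳 * -v) := by
    linear_combination v * xn_mul_z k n + v * yn_mul_z k n
  have e3 : 𝐰 * 𝐰 * v = (𝐱 ^ n + 𝐲 ^ n - 𝐰) * (𝐰 * -v) := by
    linear_combination v * xn_mul_w k n + v * yn_mul_w k n
  refine ⟨?_, ?_, ?_⟩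
  · obtain ⟨g, hg, u, hu, rfl⟩ := Submodule.mem_sup.1 hv
    obtain ⟨c, d, rfl⟩ := Ideal.mem_span_pair.1 hu
    have hθg : 𝐳 * (𝐱 * 𝐲 ^ (n - 1) * g) = 0 :=
      (zw_mul_eq_zero k n (by rw [pow_two]; exact Ideal.mul_mem_mul hθ hg)).1
    -- With `θ = x y ^ (n - 1)` and `v = g + c z + d w`, `z ^ 2 v = -a z v + θ z v`. Here `θ z g = 0`,
    -- `θ z ^ 2 = -a θ z` and `θ z w = -b θ z`.
    have e1 : 𝐳 * 𝐳 * (g + (c * 𝐳 + d * 𝐰)) =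
        (𝐱 * 𝐲 ^ (n - 1) - 𝐳) * (𝐳 * -(g + (c * 𝐳 + d * 𝐰)) + c * (𝐳 * -(𝐱 * 𝐲 ^ (n - 1)))) +
        (𝐱 ^ n + 𝐲 ^ n - 𝐰) * (d * (𝐳 * -(𝐱 * 𝐲 ^ (n - 1)))) := by
      linear_combination hθg + d * (𝐱 * 𝐲 ^ (n - 1)) * (xn_mul_z k n + yn_mul_z k n) +
        c * theta_sq_mul_eq_zero k hn (z_mem k n)
    rw [e1]
    have hθz := hz' _ (Ideal.mem_sup_left hθ : 𝐱 * 𝐲 ^ (n - 1) ∈ I)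
    exact add_mem (Ideal.mul_mem_mul (mem_span_pair_left _ _)
      (add_mem hz (Ideal.mul_mem_left _ _ hθz)))
      (Ideal.mul_mem_mul (mem_span_pair_right _ _) (Ideal.mul_mem_left _ _ hθz))
  · rw [e2]; exact Ideal.mul_mem_mul (mem_span_pair_right _ _) hz
  · rw [e3]; exact Ideal.mul_mem_mul (mem_span_pair_right _ _) hw

/-- A power series in which all monomials in `X, Y` alone have degree at least `m` lies in
`(X, Y) ^ m + (Z, W)`; the induction splits off one factor `X` or `Y`. -/
lemma mem_span_XY_pow_sup (m : ℕ) (F : MvPowerSeries (Fin 4) k)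
    (hF : ∀ d : Fin 4 →₀ ℕ, d 2 = 0 → d 3 = 0 → d 0 + d 1 < m → MvPowerSeries.coeff d F = 0) :
    F ∈ Ideal.span {MvPowerSeries.X 0, MvPowerSeries.X 1} ^ m ⊔
      Ideal.span {MvPowerSeries.X 2, MvPowerSeries.X 3} := by
  induction m generalizing F with
  | zero => simp [Ideal.one_eq_top]
  | succ m ih =>
    let G₁ : MvPowerSeries (Fin 4) k := fun d => MvPowerSeries.coeff (d + Finsupp.single 0 1) F
    let G₂ : MvPowerSeries (Fin 4) k := fun d =>
      if d 0 = 0 then MvPowerSeries.coeff (d + Finsupp.single 1 1) F else 0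
    have h₁ (d) : MvPowerSeries.coeff d G₁ = MvPowerSeries.coeff (d + Finsupp.single 0 1) F := rfl
    have h₂ (d) : MvPowerSeries.coeff d G₂ =
      if d 0 = 0 then MvPowerSeries.coeff (d + Finsupp.single 1 1) F else 0 := rfl
    have hG₁ := ih G₁ fun d h2 h3 h => by
      rw [h₁]
      exact hF _ (by simpa) (by simpa) (by simp; omega)
    have hG₂ := ih G₂ fun d h2 h3 h => by
      rw [h₂]
      split_ifs
      · exact hF _ (by simpa) (by simpa) (by simp; omega)
      · rfl
    have hrest : F - (MvPowerSeries.X 0 ^ 1 * G₁ + MvPowerSeries.X 1 ^ 1 * G₂) ∈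
        Ideal.span {(MvPowerSeries.X 2 : MvPowerSeries (Fin 4) k), MvPowerSeries.X 3} := by
      rw [span_ZW_eq, mem_monoIdeal]
      intro d hd
      have h2 : d 2 = 0 := by simpa using hd 2
      have h3 : d 3 = 0 := by simpa using hd 3
      rw [map_sub, map_add, coeff_X_pow_mul_eq, coeff_X_pow_mul_eq, h₁, h₂]
      by_cases h0 : 1 ≤ d 0
      · have : d - Finsupp.single 0 1 + Finsupp.single 0 1 = d :=
          tsub_add_cancel_of_le (Finsupp.single_le_iff.2 h0)
        have h01 : (d - Finsupp.single (1 : Fin 4) 1 : Fin 4 →₀ ℕ) 0 ≠ 0 := by simp; omega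
        rw [if_pos h0, if_neg h01, this]
        simp
      · rw [if_neg h0]
        have h01 : (d - Finsupp.single (1 : Fin 4) 1 : Fin 4 →₀ ℕ) 0 = 0 := by simp; omega
        rw [if_pos h01]
        by_cases h1 : 1 ≤ d 1
        · have : d - Finsupp.single 1 1 + Finsupp.single 1 1 = d :=
            tsub_add_cancel_of_le (Finsupp.single_le_iff.2 h1)
          rw [if_pos h1, this]
          simp
        · rw [if_neg h1, hF d h2 h3 (by omega)]
          simp
    have hmul : ∀ (G X' : MvPowerSeries (Fin 4) k),
        X' ∈ Ideal.span {(MvPowerSeries.X 0 : MvPowerSeries (Fin 4) k), MvPowerSeries.X 1} →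
        G ∈ Ideal.span {MvPowerSeries.X 0, MvPowerSeries.X 1} ^ m ⊔
          Ideal.span {MvPowerSeries.X 2, MvPowerSeries.X 3} →
        X' ^ 1 * G ∈ Ideal.span {MvPowerSeries.X 0, MvPowerSeries.X 1} ^ (m + 1) ⊔
          Ideal.span {MvPowerSeries.X 2, MvPowerSeries.X 3} := by
      intro G X' hX hG
      obtain ⟨g, hg, u, hu, rfl⟩ := Submodule.mem_sup.1 hG
      rw [mul_add, pow_one, pow_succ']
      exact add_mem (Ideal.mem_sup_left (Ideal.mul_mem_mul hX hg))
        (Ideal.mem_sup_right (Ideal.mul_mem_left _ _ hu))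
    have : F = (MvPowerSeries.X 0 ^ 1 * G₁ + MvPowerSeries.X 1 ^ 1 * G₂) +
      (F - (MvPowerSeries.X 0 ^ 1 * G₁ + MvPowerSeries.X 1 ^ 1 * G₂)) := by ring
    rw [this]
    exact add_mem (add_mem (hmul _ _ (mem_span_pair_left _ _) hG₁)
      (hmul _ _ (mem_span_pair_right _ _) hG₂)) (Ideal.mem_sup_right hrest)

/-- The ideal `(x, y) ^ n + (z, w)` consists of the elements whose image in `k[[X, Y]]` has order at
least `n`. -/
lemma comap_orderIdeal_exToXY (hn : n ≠ 0) :
    (orderIdeal k n).comap (exToXY k hn) = 𝔫 ⊔ Ideal.span {𝐳, 𝐰} := by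
  apply le_antisymm
  · intro f hf
    obtain ⟨F, rfl⟩ := Ideal.Quotient.mk_surjective f
    have h := mem_span_XY_pow_sup k n F fun d h2 h3 h => by
      rw [Ideal.mem_comap, mem_orderIdeal, exToXY, exKill_mk] at hf
      have h1 := coeff_of_lt_order (d := Finsupp.single 0 (d 0) + Finsupp.single 1 (d 1))
        (lt_of_lt_of_le (by simpa using by exact_mod_cast h) hf)
      rw [coeff_killCompl] at h1
      rw [← h1]
      congr 2
      ext i
      rw [Finsupp.embDomain_add, Finsupp.embDomain_single, Finsupp.embDomain_single]
      fin_cases i <;> simp [h2, h3]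
    have h' := Ideal.mem_map_of_mem (Ideal.Quotient.mk (relIdeal k n)) h
    rwa [Ideal.map_sup, Ideal.map_pow, Ideal.map_span, Ideal.map_span, Set.image_pair,
      Set.image_pair] at h'
  · have hX (i : Fin 2) : (X i : MvPowerSeries (Fin 2) k) ∈ orderIdeal k 1 := by
      rw [mem_orderIdeal, Nat.cast_one, one_le_order_iff_constCoeff_eq_zero]
      simp
    refine sup_le ?_ ?_
    · have h1 : Ideal.span {𝐱, 𝐲} ≤ (orderIdeal k 1).comap (exToXY k hn) := by
        rw [Ideal.span_le]
        rintro _ (rfl | rfl)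
        · rw [SetLike.mem_coe, Ideal.mem_comap, exToXY_x]; exact hX 0
        · rw [SetLike.mem_coe, Ideal.mem_comap, exToXY_y]; exact hX 1
      simpa using pow_le_comap_orderIdeal k _ h1 n
    · rw [Ideal.span_le]
      rintro _ (rfl | rfl)
      · rw [SetLike.mem_coe, Ideal.mem_comap, exToXY_z]; exact zero_mem _
      · rw [SetLike.mem_coe, Ideal.mem_comap, exToXY_w]; exact zero_mem _

/-- An ideal inside `I = (x, y) ^ n + (z, w)` containing a reduction of `I` has integral closure
`I`. -/
lemma idealIntegralClosure_eq (hn : n ≠ 0) {J K : Ideal (ExRing k n)} (hK : K ≤ J)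
    (hJ : J ≤ 𝔫 ⊔ Ideal.span {𝐳, 𝐰})
    (h : (𝔫 ⊔ Ideal.span {𝐳, 𝐰}) ^ 3 ≤ K * (𝔫 ⊔ Ideal.span {𝐳, 𝐰}) ^ 2) :
    idealIntegralClosure J = (𝔫 ⊔ Ideal.span {𝐳, 𝐰} : Ideal (ExRing k n)) := by
  apply subset_antisymm
  · have := idealIntegralClosure_subset_comap_orderIdeal k (exToXY k hn) (J := J) (m := n)
      (by rwa [comap_orderIdeal_exToXY])
    rwa [comap_orderIdeal_exToXY] at this
  · exact (subset_idealIntegralClosure h).trans (idealIntegralClosure_mono hK)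

lemma span_c_le : Ideal.span {𝐱 ^ n, 𝐲 ^ n, 𝐳, 𝐰} ≤ 𝔫 ⊔ Ideal.span {𝐳, 𝐰} := by
  rw [span_c_eq, exIdeal_xy, exIdeal_zw]
  refine sup_le_sup_right ((Ideal.span_le).2 ?_) _
  rintro _ (rfl | rfl)
  · exact Ideal.pow_mem_pow (mem_span_pair_left _ _) n
  · exact Ideal.pow_mem_pow (mem_span_pair_right _ _) n

lemma span_Q_le_c : Ideal.span {𝐱 ^ n - 𝐳, 𝐲 ^ n - 𝐰} ≤ Ideal.span {𝐱 ^ n, 𝐲 ^ n, 𝐳, 𝐰} := by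
  rw [span_c_eq]; exact span_Q_le k n

lemma span_Q'_le (hn : 2 ≤ n) : Ideal.span {𝐱 * 𝐲 ^ (n - 1) - 𝐳, 𝐱 ^ n + 𝐲 ^ n - 𝐰} ≤
    𝔫 ⊔ Ideal.span {𝐳, 𝐰} := by
  have hθ : 𝐱 * 𝐲 ^ (n - 1) ∈ 𝔫 := by
    simpa using pow_mul_pow_mem_span_pair_pow 𝐱 𝐲 (show 1 + (n - 1) = n by omega)
  rw [Ideal.span_le]
  rintro _ (rfl | rfl)
  · exact sub_mem (Ideal.mem_sup_left hθ) (Ideal.mem_sup_right (mem_span_pair_left _ _))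
  · exact sub_mem (Ideal.mem_sup_left (add_mem (Ideal.pow_mem_pow (mem_span_pair_left _ _) n)
      (Ideal.pow_mem_pow (mem_span_pair_right _ _) n)))
      (Ideal.mem_sup_right (mem_span_pair_right _ _))

end ExIntegral


/-! ### Prime ideals of Rees algebras defined by leading forms -/

section LeadingForm

variable {k : Type*} [Field k] {σ : Type*} {A : Type*} [CommRing A] {Q : Ideal A}
  (ψ : A →+* MvPowerSeries σ k) (hψ : Q ≤ (orderIdeal k 1).comap ψ)

lemma le_order_coeff_reesAlgebra (hψ : Q ≤ (orderIdeal k 1).comap ψ) (f : reesAlgebra Q) (i : ℕ) :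
    (i : ℕ∞) ≤ (ψ ((f : A[X]).coeff i)).order := by
  have h := pow_le_comap_orderIdeal k ψ hψ i ((mem_reesAlgebra_iff Q _).1 f.2 i)
  rwa [mul_one] at h

/-- The polynomial `∑ᵢ in_i(ψ(fᵢ)) T ^ i`, where `in_i` is the form of degree `i`. -/
noncomputable def leadingFormFun (f : A[X]) : (MvPowerSeries σ k)[X] :=
  ∑ i ∈ f.support, monomial i ((ψ (f.coeff i)).homogeneousComponent i)

lemma coeff_leadingFormFun (f : A[X]) (i : ℕ) :
    (leadingFormFun ψ f).coeff i = (ψ (f.coeff i)).homogeneousComponent i := by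
  rw [leadingFormFun, finsetSum_coeff]
  simp only [coeff_monomial]
  rw [Finset.sum_ite_eq' f.support i]
  split_ifs with h
  · rfl
  · rw [notMem_support_iff.1 h, map_zero, map_zero]

/-- If `ψ` maps `Q` into the power series without constant term, the leading forms define a ring map
`A[Qt] → k[[σ]][T]`. -/
noncomputable def leadingForm : reesAlgebra Q →+* (MvPowerSeries σ k)[X] where
  toFun f := leadingFormFun ψ f
  map_one' := by
    ext1 i
    rw [coeff_leadingFormFun, OneMemClass.coe_one, coeff_one, coeff_one]
    split_ifs with h
    · subst h
      rw [map_one]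
      ext d
      rw [MvPowerSeries.coeff_homogeneousComponent]
      classical
      rw [MvPowerSeries.coeff_one]
      split_ifs <;> simp_all
    · rw [map_zero, map_zero]
  map_zero' := by
    ext1 i
    rw [coeff_leadingFormFun]
    simp
  map_add' f g := by
    ext1 i
    simp [coeff_leadingFormFun]
  map_mul' f g := by
    ext1 i
    rw [coeff_leadingFormFun, coeff_mul, MulMemClass.coe_mul, coeff_mul, map_sum, map_sum]
    refine Finset.sum_congr rfl fun p hp => ?_
    rw [coeff_leadingFormFun, coeff_leadingFormFun, map_mul,
      ← MvPowerSeries.homogeneousComponent_mul_of_le_order (le_order_coeff_reesAlgebra ψ hψ f p.1)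
        (le_order_coeff_reesAlgebra ψ hψ g p.2), Finset.HasAntidiagonal.mem_antidiagonal.1 hp]

/-- The ideal of the `f ∈ A[Qt]` such that all `ψ(fᵢ)` have order larger than `i`. -/
noncomputable def leadingFormIdeal : Ideal (reesAlgebra Q) := RingHom.ker (leadingForm ψ hψ)

instance : (leadingFormIdeal ψ hψ).IsPrime := by
  have := NoZeroDivisors.to_isDomain (MvPowerSeries σ k)
  exact RingHom.ker_isPrime _

lemma mem_leadingFormIdeal {f : reesAlgebra Q} :
    f ∈ leadingFormIdeal ψ hψ ↔
      ∀ i, (ψ ((f : A[X]).coeff i)).homogeneousComponent i = 0 := by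
  change leadingFormFun ψ f = 0 ↔ _
  rw [Polynomial.ext_iff]
  simp [coeff_leadingFormFun]

lemma coeff_decompose_reesGrading (f : reesAlgebra Q) (i j : ℕ) :
    ((DirectSum.decompose (reesGrading Q) f i : reesAlgebra Q) : A[X]).coeff j =
      if j = i then (f : A[X]).coeff i else 0 := by
  split_ifs with h
  · subst h
    have h1 := reesGrading_coeff_coe Q (DirectSum.decompose (reesGrading Q) f) j
    have h2 : DirectSum.coeAddMonoidHom (reesGrading Q) (DirectSum.decompose (reesGrading Q) f) = f :=
      DirectSum.Decomposition.left_inv f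
    rw [h2] at h1
    exact h1.symm
  · exact (DirectSum.decompose (reesGrading Q) f i).2 j h

lemma isHomogeneous_leadingFormIdeal :
    (leadingFormIdeal ψ hψ).IsHomogeneous (reesGrading Q) := by
  intro i f hf
  rw [mem_leadingFormIdeal] at hf ⊢
  intro j
  rw [coeff_decompose_reesGrading]
  split_ifs with h
  · rw [h]; exact hf i
  · rw [map_zero, map_zero]

/-- The element `g t ^ i` of the Rees algebra, for `g ∈ Q ^ i`. -/
noncomputable def reesMonomial (i : ℕ) {g : A} (hg : g ∈ Q ^ i) : reesAlgebra Q :=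
  ⟨monomial i g, reesAlgebra.monomial_mem.2 hg⟩

lemma reesMonomial_mem_leadingFormIdeal {i : ℕ} {g : A} (hg : g ∈ Q ^ i) :
    reesMonomial i hg ∈ leadingFormIdeal ψ hψ ↔ (ψ g).homogeneousComponent i = 0 := by
  rw [mem_leadingFormIdeal]
  constructor
  · intro h
    simpa [reesMonomial] using h i
  · intro h j
    change (ψ ((monomial i g).coeff j)).homogeneousComponent j = 0
    rw [coeff_monomial]
    split_ifs with hij
    · rw [← hij]; exact h
    · rw [map_zero, map_zero]

lemma reesMonomial_mem_reesGrading {i : ℕ} {g : A} (hg : g ∈ Q ^ i) :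
    reesMonomial i hg ∈ reesGrading Q i := fun j hj => by
  change (monomial i g).coeff j = 0
  rw [coeff_monomial, if_neg hj.symm]

lemma exists_eq_reesMonomial {i : ℕ} {f : reesAlgebra Q} (hf : f ∈ reesGrading Q i) :
    ∃ (g : A) (hg : g ∈ Q ^ i), f = reesMonomial i hg := by
  refine ⟨_, (mem_reesAlgebra_iff Q _).1 f.2 i, Subtype.ext ?_⟩
  ext j
  change _ = (monomial i _).coeff j
  rw [coeff_monomial]
  split_ifs with h
  · rw [h]
  · exact hf j (Ne.symm h)

end LeadingForm


section LeadingCoefficient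

variable {k : Type*} [Field k] {σ : Type*} {A : Type*} [CommRing A] {a b : A}
  (ψ : A →+* MvPowerSeries σ k) (s : σ)

/-- Elements of `(a, b) ^ i` are written as `aⁱ c + b d` with `b d` again of degree `i`; the bound on
`d` is stated as `a d ∈ (a, b) ^ i` so as to include `i = 0`, where `d = 0`. -/
lemma exists_eq_pow_mul_add {i : ℕ} {g : A} (hg : g ∈ Ideal.span {a, b} ^ i) :
    ∃ c d, g = a ^ i * c + b * d ∧ a * d ∈ Ideal.span {a, b} ^ i := by
  cases i with
  | zero => exact ⟨g, 0, by simp, by simp⟩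
  | succ i =>
    rw [span_pair_pow_succ] at hg
    obtain ⟨u, hu, v, hv, rfl⟩ := Submodule.mem_sup.1 hg
    obtain ⟨c, rfl⟩ := Ideal.mem_span_singleton'.1 hu
    obtain ⟨d, hd, rfl⟩ := Ideal.mem_span_singleton_mul.1 hv
    refine ⟨c, d, by ring, ?_⟩
    rw [pow_succ']
    exact Ideal.mul_mem_mul (mem_span_pair_left _ _) hd

lemma coeff_single_of_eq (ha : ψ a = -MvPowerSeries.X s)
    (hb : ∀ h j, MvPowerSeries.coeff (Finsupp.single s j) (ψ b * h) = 0) (i : ℕ) (c d : A) :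
    MvPowerSeries.coeff (Finsupp.single s i) (ψ (a ^ i * c + b * d)) =
      (-1) ^ i * MvPowerSeries.constantCoeff (ψ c) := by
  classical
  rw [map_add, map_mul, map_mul, map_add, hb, add_zero, map_pow, ha, neg_pow, mul_assoc]
  have h1 : ((-1) ^ i : MvPowerSeries σ k) = MvPowerSeries.C ((-1) ^ i) := by simp
  rw [h1, MvPowerSeries.coeff_C_mul, MvPowerSeries.coeff_X_pow_mul_eq]
  simp

/-- The leading coefficient of `aⁱ c + b d` is a unit multiple of the constant term of `c`. -/
lemma constantCoeff_eq_zero_of_homogeneousComponent (ha : ψ a = -MvPowerSeries.X s)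
    (hb : ∀ h j, MvPowerSeries.coeff (Finsupp.single s j) (ψ b * h) = 0) {i : ℕ} {c d : A}
    (h : (ψ (a ^ i * c + b * d)).homogeneousComponent i = 0) :
    MvPowerSeries.constantCoeff (ψ c) = 0 := by
  have h1 := congrArg (MvPowerSeries.coeff (Finsupp.single s i)) h
  rw [MvPowerSeries.coeff_homogeneousComponent, Finsupp.degree_single, if_pos rfl,
    coeff_single_of_eq ψ s ha hb, map_zero] at h1
  simpa using h1

end LeadingCoefficient

section Socle

variable (k : Type u) [Field k] {n : ℕ}

local notation "𝐱" => exVar k n 0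
local notation "𝐲" => exVar k n 1
local notation "𝐳" => exVar k n 2
local notation "𝐰" => exVar k n 3
local notation "𝔟" => exIdeal k n n n ⊤ ⊤
local notation "𝔷" => exIdeal k n ⊤ ⊤ 1 1
local notation "𝔪" => IsLocalRing.maximalIdeal (ExRing k n)
local notation "𝐚" => (exVar k n 0 * exVar k n 1 ^ (n - 1) - exVar k n 2)
local notation "𝐛" => (exVar k n 0 ^ n + exVar k n 1 ^ n - exVar k n 3)
local notation "𝔮" => Ideal.span {exVar k n 0 * exVar k n 1 ^ (n - 1) - exVar k n 2,
  exVar k n 0 ^ n + exVar k n 1 ^ n - exVar k n 3}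

variable (n) in
/-- The element `x ^ (n - 2) z (z - 2 x y ^ (n - 1))`. For a suitable point of `Proj A[Q't]` it
represents a socle element of the local ring modulo `x y ^ (n - 1) - z`. -/
noncomputable def socleElement : ExRing k n :=
  𝐱 ^ (n - 2) * (𝐳 * (𝐳 - 2 * (𝐱 * 𝐲 ^ (n - 1))))

/-- `x y ^ (n - 1) - z` is a non-zero-divisor on `A`. -/
lemma theta_sub_z_regular (hn : 2 ≤ n) (g : ExRing k n) (h : 𝐚 * g = 0) : g = 0 := by
  have h1 : 𝐳 ^ 2 * g ∈ 𝔟 := by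
    have : 𝐳 ^ 2 * g = g * (𝐱 * 𝐲 ^ (n - 1)) ^ 2 := by
      linear_combination -(𝐱 * 𝐲 ^ (n - 1) + 𝐳) * h
    exact this ▸ Ideal.mul_mem_left _ _ (theta_sq_mem k n hn)
  have : g ∈ 𝔟 ⊓ 𝔷 := ⟨by simpa using ((adm_xy n).z_pow_mul_mem 2).1 h1,
    (isRegularPair_Q'_zw k n hn).fst g (h ▸ zero_mem _)⟩
  rwa [exIdeal_inf_eq_bot] at this

lemma socleElement_mem : socleElement k n ∈ 𝔷 :=
  Ideal.mul_mem_left _ _ (Ideal.mul_mem_right _ _ (z_mem k n))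

/-- With `θ = x y ^ (n - 1)`, `a = θ - z` and `b = x ^ n + y ^ n - w`: the forms `x ^ n` and `y ^ n` are
killed by `z`, and `w θ ^ 2 = 0`, so that `b z (z - 2 θ) = -w (z - θ) ^ 2`. -/
lemma b_mul_socleElement (hn : 2 ≤ n) :
    𝐛 * socleElement k n = -(𝐚 * (𝐚 * (𝐱 ^ (n - 2) * 𝐰))) := by
  rw [socleElement]
  linear_combination (𝐱 ^ (n - 2) * (𝐳 - 2 * (𝐱 * 𝐲 ^ (n - 1)))) * (xn_mul_z k n + yn_mul_z k n) +
    𝐱 ^ (n - 2) * theta_sq_mul_eq_zero k hn (w_mem k n)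

/-- The element `socleElement` is annihilated by the maximal ideal modulo `x y ^ (n - 1) - z`. -/
lemma exists_mul_socleElement_eq (hn : 2 ≤ n) {m : ExRing k n} (hm : m ∈ 𝔪) :
    ∃ g, m * socleElement k n = 𝐚 * g := by
  obtain ⟨l, rfl⟩ := Nat.exists_eq_add_of_le hn
  rw [maximalIdeal_eq_span] at hm
  have hl : 2 + l - 1 = l + 1 := by omega
  have hl' : 2 + l - 2 = l := by omega
  have e1 := xn_mul_z k (2 + l)
  have e2 := yn_mul_z k (2 + l)
  have t1 := theta_sq_mul_eq_zero k hn (z_mem k _)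
  have t2 := theta_sq_mul_eq_zero k hn (w_mem k _)
  suffices hI : Ideal.span {exVar k (2 + l) 0, exVar k (2 + l) 1, exVar k (2 + l) 2,
      exVar k (2 + l) 3} ≤ (Ideal.span {exVar k (2 + l) 0 * exVar k (2 + l) 1 ^ (2 + l - 1) -
        exVar k (2 + l) 2}).colon {socleElement k (2 + l)} by
    obtain ⟨g, hg⟩ := Ideal.mem_span_singleton'.1 (Submodule.mem_colon_singleton.1 (hI hm))
    exact ⟨g, by rw [← smul_eq_mul, ← hg]; ring⟩
  rw [Ideal.span_le]
  rintro _ (rfl | rfl | rfl | rfl) <;>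
    rw [SetLike.mem_coe, Submodule.mem_colon_singleton, Ideal.mem_span_singleton', smul_eq_mul,
      socleElement]
  · refine ⟨-(exVar k (2 + l) 0 ^ (l + 1) * exVar k (2 + l) 2), ?_⟩
    rw [hl, hl']
    linear_combination exVar k (2 + l) 1 ^ (l + 1) * e1
  · refine ⟨-(exVar k (2 + l) 0 ^ l * exVar k (2 + l) 1 * exVar k (2 + l) 2), ?_⟩
    rw [hl, hl']
    linear_combination exVar k (2 + l) 0 ^ (l + 1) * e2
  · refine ⟨exVar k (2 + l) 0 ^ l * exVar k (2 + l) 2 *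
      (exVar k (2 + l) 0 * exVar k (2 + l) 1 ^ (l + 1) - exVar k (2 + l) 2), ?_⟩
    rw [hl] at t1 ⊢
    rw [hl']
    linear_combination exVar k (2 + l) 0 ^ l * t1
  · refine ⟨exVar k (2 + l) 0 ^ l * exVar k (2 + l) 3 *
      (exVar k (2 + l) 0 * exVar k (2 + l) 1 ^ (l + 1) - exVar k (2 + l) 2), ?_⟩
    rw [hl] at t2 ⊢
    rw [hl']
    linear_combination exVar k (2 + l) 0 ^ l * t2

/-- As `Q' ^ (l + 1) ∩ (z, w) = (z, w) Q' ^ (l + 1)`, the claim can be tested modulo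
`(x ^ n, y ^ n, w)`, where `Q'` is generated by `a = x y ^ (n - 1) - z`. -/
lemma pow_mul_socleElement_notMem (hn : 2 ≤ n) (l : ℕ) :
    𝐚 ^ l * socleElement k n ∉ 𝔮 ^ (l + 1) := by
  intro h
  set θ := 𝐱 * 𝐲 ^ (n - 1) with hθ
  set J := exIdeal k n n n ⊤ 1 with hJ
  have hbJ : 𝐛 ∈ J := by
    rw [hJ, ← exIdeal_xyw]
    exact sub_mem (Ideal.mem_sup_left (add_mem (xn_mem k n) (yn_mem k n)))
      (Ideal.mem_sup_right (Ideal.mem_span_singleton_self _))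
  have hJb : 𝔟 ⊔ Ideal.span {𝐛} = J := by
    rw [hJ, ← exIdeal_xyw, ← Ideal.span_singleton_neg 𝐰]
    exact sup_span_singleton_congr (by simpa using add_mem (xn_mem k n) (yn_mem k n))
  have hwJ : 𝐰 ∈ J := by
    rw [hJ, ← exIdeal_xyw]; exact Ideal.mem_sup_right (Ideal.mem_span_singleton_self _)
  have hbJ' : 𝔟 ≤ J := hJb ▸ le_sup_left
  have h1 : 𝐚 ^ l * socleElement k n ∈ 𝔷 * 𝔮 ^ (l + 1) := by
    have := (isRegularPair_Q'_zw k n hn).pow_inf_eq (l + 1)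
    rw [Set.pair_comm] at this
    exact this.le ⟨h, Ideal.mul_mem_left _ _ (socleElement_mem k)⟩
  have h2 : 𝔷 * 𝔮 ^ (l + 1) ≤ J ⊔ Ideal.span {𝐳 * 𝐚 ^ (l + 1)} := by
    rw [exIdeal_zw, span_pair_pow_succ]
    refine Ideal.mul_le.2 fun r hr s hs => ?_
    obtain ⟨r1, r2, rfl⟩ := Ideal.mem_span_pair.1 hr
    obtain ⟨u, hu, v, hv, rfl⟩ := Submodule.mem_sup.1 hs
    obtain ⟨c, rfl⟩ := Ideal.mem_span_singleton'.1 hu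
    obtain ⟨d, hd, rfl⟩ := Ideal.mem_span_singleton_mul.1 hv
    refine mem_sup_span_singleton.2 ⟨r2 * (c * 𝐚 ^ (l + 1) + 𝐛 * d) * 𝐰 + r1 * 𝐳 * d * 𝐛,
      add_mem (J.mul_mem_left _ hwJ) (J.mul_mem_left _ hbJ), r1 * c, by ring⟩
  -- work modulo `J = 𝔟 + (b)`, where `a` and `z` are regular: cancel `a ^ l z`, multiply by `θ`, whose
  -- square vanishes, and cancel `z` to get `(c + x ^ (n - 2)) θ = 0`; then `x ^ (n - 2) θ ∈ 𝔟 + 𝔷`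
  obtain ⟨j, hj, c, hc⟩ := mem_sup_span_singleton.1 (h2 h1)
  have h3 : 𝐚 ^ l * (𝐳 ^ 1 * ((c + 𝐱 ^ (n - 2)) * 𝐚 + 𝐱 ^ (n - 2) * θ)) ∈ 𝔟 ⊔ Ideal.span {𝐛} := by
    rw [hJb]
    have : 𝐚 ^ l * (𝐳 ^ 1 * ((c + 𝐱 ^ (n - 2)) * 𝐚 + 𝐱 ^ (n - 2) * θ)) = -j := by
      rw [socleElement, ← hθ] at hc
      linear_combination -hc
    exact this ▸ neg_mem hj
  have h4 := (isRegularPair_Q'_xy k n hn).snd_pow l _ h3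
  rw [hJb] at h4
  have h5 : (c + 𝐱 ^ (n - 2)) * 𝐚 + 𝐱 ^ (n - 2) * θ ∈ J := by
    simpa using ((adm_xy n).z_pow_mul_mem 1).1 h4
  have h6 : 𝐳 ^ 1 * ((c + 𝐱 ^ (n - 2)) * θ) ∈ J := by
    have : 𝐳 ^ 1 * ((c + 𝐱 ^ (n - 2)) * θ) = (c + 2 * 𝐱 ^ (n - 2)) * θ ^ 2 -
      θ * ((c + 𝐱 ^ (n - 2)) * 𝐚 + 𝐱 ^ (n - 2) * θ) := by ring
    rw [this]
    exact sub_mem (J.mul_mem_left _ (hbJ' (theta_sq_mem k n hn))) (J.mul_mem_left _ h5)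
  have h7 : (c + 𝐱 ^ (n - 2)) * θ ∈ J := by
    simpa using ((adm_xy n).z_pow_mul_mem 1).1 h6
  have h8 : 𝐱 ^ (n - 1) * 𝐲 ^ (n - 1) ∈ 𝔟 ⊔ 𝔷 := by
    have e : 𝐱 ^ (n - 1) = 𝐱 ^ (n - 2) * 𝐱 := by
      rw [← pow_succ, show n - 2 + 1 = n - 1 by omega]
    have : 𝐱 ^ (n - 1) * 𝐲 ^ (n - 1) = ((c + 𝐱 ^ (n - 2)) * 𝐚 + 𝐱 ^ (n - 2) * θ) -
        (c + 𝐱 ^ (n - 2)) * θ + (c + 𝐱 ^ (n - 2)) * 𝐳 := by rw [e, hθ]; ring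
    have hJc : J ≤ 𝔟 ⊔ 𝔷 := by
      rw [hJ, ← exIdeal_xyw]
      exact sup_le_sup_left ((Ideal.span_singleton_le_iff_mem _).2 (w_mem k n)) _
    rw [this]
    exact add_mem (hJc (sub_mem h5 h7)) (Ideal.mul_mem_left _ _ (Ideal.mem_sup_right (z_mem k n)))
  rw [exIdeal_xyzw] at h8
  exact x_pow_mul_y_pow_notMem k (by omega) (by omega) h8

/-- With `a = x y ^ (n - 1) - z` and the socle element `f`, the product `a ^ (m - 1) f` is not in
`Q' ^ m`, but is multiplied into `Q' ^ (m + 1)`. -/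
lemma not_isSuperficial (hn : 2 ≤ n) : ¬ IsSuperficial 𝔮 𝐛 := by
  rintro ⟨-, c, hc⟩
  have ha : 𝐚 ∈ 𝔮 := mem_span_pair_left _ _
  refine pow_mul_socleElement_notMem k hn c ((hc (c + 1) (by omega) _).1 ⟨?_, ?_⟩)
  · have : 𝐛 * (𝐚 ^ c * socleElement k n) = 𝐚 ^ (c + 1 + 1) * -(𝐱 ^ (n - 2) * 𝐰) := by
      linear_combination 𝐚 ^ c * b_mul_socleElement k hn
    rw [this]
    exact Ideal.mul_mem_right _ _ (Ideal.pow_mem_pow ha _)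
  · exact Ideal.mul_mem_right _ _ (Ideal.pow_mem_pow ha _)

lemma constantCoeff_exToZ_eq_zero_iff (hn : n ≠ 0) (c : ExRing k n) :
    MvPowerSeries.constantCoeff (exToZ k hn c) = 0 ↔ c ∈ 𝔪 := by
  constructor
  · intro h
    by_contra hc
    have h1 : IsUnit c := by simpa using hc
    have h2 := (h1.map (exToZ k hn)).map (MvPowerSeries.constantCoeff (σ := Fin 1) (R := k))
    exact h2.ne_zero h
  · intro hc
    have : 𝔪 ≤ RingHom.ker ((MvPowerSeries.constantCoeff (σ := Fin 1) (R := k)).comp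
        (exToZ k hn)) := by
      rw [maximalIdeal_eq_span, Ideal.span_le]
      rintro _ (rfl | rfl | rfl | rfl) <;>
        simp [RingHom.mem_ker, exToZ_x, exToZ_y, exToZ_z, exToZ_w]
    exact this hc

lemma exToZ_a (hn : 2 ≤ n) : exToZ k (by omega : n ≠ 0) 𝐚 = -MvPowerSeries.X 0 := by
  rw [map_sub, map_mul, exToZ_x, exToZ_z]; simp

lemma exToZ_b (hn : 2 ≤ n) : exToZ k (by omega : n ≠ 0) 𝐛 = 0 := by
  have : n ≠ 0 := by omega
  rw [map_sub, map_add, map_pow, map_pow, exToZ_x, exToZ_y, exToZ_w]; simp [this]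

lemma span_le_comap_exToZ (hn : 2 ≤ n) : 𝔮 ≤ (orderIdeal k 1).comap (exToZ k (by omega)) := by
  rw [Ideal.span_le]
  rintro _ (rfl | rfl)
  · rw [SetLike.mem_coe, Ideal.mem_comap, exToZ_a k hn, mem_orderIdeal, Nat.cast_one,
      MvPowerSeries.one_le_order_iff_constCoeff_eq_zero]
    simp
  · rw [SetLike.mem_coe, Ideal.mem_comap, exToZ_b k hn]
    exact zero_mem _

/-- The leading coefficient of `aⁱ c + b d` vanishes along `x = y = w = 0` precisely if `c` is not a
unit. -/
lemma homogeneousComponent_exToZ_eq_zero_iff (hn : 2 ≤ n) (i : ℕ) (c d : ExRing k n) :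
    (exToZ k (by omega : n ≠ 0) (𝐚 ^ i * c + 𝐛 * d)).homogeneousComponent i = 0 ↔ c ∈ 𝔪 := by
  have hn0 : n ≠ 0 := by omega
  constructor
  · intro h
    rw [← constantCoeff_exToZ_eq_zero_iff k hn0]
    refine constantCoeff_eq_zero_of_homogeneousComponent (exToZ k hn0) 0 (exToZ_a k hn) ?_ h
    intro h j
    rw [exToZ_b k hn, zero_mul, map_zero]
  · intro hc
    rw [← constantCoeff_exToZ_eq_zero_iff k hn0] at hc
    apply MvPowerSeries.homogeneousComponent_of_lt_order_eq_zero
    have h1 : exToZ k hn0 (𝐚 ^ i * c + 𝐛 * d) ∈ orderIdeal k (i + 1) := by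
      rw [map_add, map_mul, map_mul, exToZ_b k hn, zero_mul, add_zero, map_pow]
      refine orderIdeal_mul_le k i 1 (Ideal.mul_mem_mul ?_ ?_)
      · have := pow_le_comap_orderIdeal k _ (span_le_comap_exToZ k hn) i
          (Ideal.pow_mem_pow (mem_span_pair_left _ _) i)
        rwa [mul_one, Ideal.mem_comap, map_pow] at this
      · rw [mem_orderIdeal, Nat.cast_one, MvPowerSeries.one_le_order_iff_constCoeff_eq_zero]
        exact hc
    rw [mem_orderIdeal] at h1
    exact lt_of_lt_of_le (by exact_mod_cast Nat.lt_succ_self i) h1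

/-- In the local ring of `Proj` the maximal ideal consists of the fractions whose numerator has
vanishing leading form; they multiply the socle element into the ideal generated by
`x y ^ (n - 1) - z`. -/
lemma exists_mul_socleElement_eq_of_leading (hn : 2 ≤ n) {i : ℕ} {g : ExRing k n} (hg : g ∈ 𝔮 ^ i)
    (h : (exToZ k (by omega : n ≠ 0) g).homogeneousComponent i = 0) :
    ∃ g' ∈ 𝔮 ^ i, g * socleElement k n = 𝐚 * g' := by
  obtain ⟨c, d, rfl, hd⟩ := exists_eq_pow_mul_add hg
  rw [homogeneousComponent_exToZ_eq_zero_iff k hn] at h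
  obtain ⟨c', hc'⟩ := exists_mul_socleElement_eq k hn h
  refine ⟨𝐚 ^ i * c' - (𝐱 ^ (n - 2) * 𝐰) * (𝐚 * d), sub_mem (Ideal.mul_mem_right _ _
    (Ideal.pow_mem_pow (mem_span_pair_left _ _) i)) (Ideal.mul_mem_left _ _ hd), ?_⟩
  linear_combination 𝐚 ^ i * hc' + d * b_mul_socleElement k hn

/-- The socle element is non-zero modulo `x y ^ (n - 1) - z` in the local ring of `Proj`. -/
lemma socleElement_mul_ne (hn : 2 ≤ n) {i : ℕ} {e g : ExRing k n} (he : e ∈ 𝔮 ^ i) (hg : g ∈ 𝔮 ^ i)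
    (h : (exToZ k (by omega : n ≠ 0) e).homogeneousComponent i ≠ 0) :
    socleElement k n * e ≠ 𝐚 * g := by
  intro heq
  have ha : 𝐚 ∈ 𝔮 := mem_span_pair_left _ _
  obtain ⟨c, d, rfl, hd⟩ := exists_eq_pow_mul_add he
  rw [Ne, homogeneousComponent_exToZ_eq_zero_iff k hn] at h
  have hc : IsUnit c := by simpa using h
  refine pow_mul_socleElement_notMem k hn i ((Ideal.unit_mul_mem_iff_mem _ hc).1 ?_)
  have : c * (𝐚 ^ i * socleElement k n) = 𝐚 * g + 𝐚 * ((𝐱 ^ (n - 2) * 𝐰) * (𝐚 * d)) := by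
    linear_combination heq - d * b_mul_socleElement k hn
  have hp : 𝔮 ^ (i + 1) = 𝔮 * 𝔮 ^ i := pow_succ' 𝔮 i
  rw [this, hp]
  exact add_mem (Ideal.mul_mem_mul ha hg) (Ideal.mul_mem_mul ha (Ideal.mul_mem_left _ _ hd))

end Socle


/-! ### A point of `Proj` whose local ring is not Cohen-Macaulay -/

section LocalRingOfProj

variable {k : Type*} [Field k] {σ : Type*} {A : Type u} [CommRing A] {Q : Ideal A}
  (ψ : A →+* MvPowerSeries σ k) (hψ : Q ≤ (orderIdeal k 1).comap ψ)

/-- The local ring of `Proj A[Qt]` at the homogeneous prime ideal defined by leading forms. -/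
abbrev LeadingFormLocalization : Type u :=
  HomogeneousLocalization.AtPrime (reesGrading Q) (leadingFormIdeal ψ hψ)

variable {ψ hψ}

/-- The fraction `(g t ^ i) / (e t ^ i)`. -/
noncomputable def reesFrac {i : ℕ} {g e : A} (hg : g ∈ Q ^ i) (he : e ∈ Q ^ i)
    (h : (ψ e).homogeneousComponent i ≠ 0) : LeadingFormLocalization ψ hψ :=
  HomogeneousLocalization.mk
    { deg := i
      num := ⟨reesMonomial i hg, reesMonomial_mem_reesGrading hg⟩
      den := ⟨reesMonomial i he, reesMonomial_mem_reesGrading he⟩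
      den_mem := fun h' => h ((reesMonomial_mem_leadingFormIdeal ψ hψ he).1 h') }

lemma exists_eq_reesFrac (h : LeadingFormLocalization ψ hψ) :
    ∃ (i : ℕ) (g e : A) (hg : g ∈ Q ^ i) (he : e ∈ Q ^ i)
      (h' : (ψ e).homogeneousComponent i ≠ 0), h = reesFrac hg he h' := by
  obtain ⟨⟨i, ⟨num, hnum⟩, ⟨den, hden⟩, hmem⟩, rfl⟩ := HomogeneousLocalization.mk_surjective h
  obtain ⟨g, hg, rfl⟩ := exists_eq_reesMonomial hnum
  obtain ⟨e, he, rfl⟩ := exists_eq_reesMonomial hden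
  exact ⟨i, g, e, hg, he, fun h0 => hmem ((reesMonomial_mem_leadingFormIdeal ψ hψ he).2 h0), rfl⟩

lemma val_reesFrac {i : ℕ} {g e : A} (hg : g ∈ Q ^ i) (he : e ∈ Q ^ i)
    (h : (ψ e).homogeneousComponent i ≠ 0) :
    (reesFrac hg he h : LeadingFormLocalization ψ hψ).val =
      Localization.mk (reesMonomial i hg)
        (⟨reesMonomial i he, fun h' => h ((reesMonomial_mem_leadingFormIdeal ψ hψ he).1 h')⟩ :
          (leadingFormIdeal ψ hψ).primeCompl) := rfl

variable (ψ hψ) in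
/-- The structure map from `A` to the local ring. -/
noncomputable def reesConst : A →+* LeadingFormLocalization ψ hψ where
  toFun c := HomogeneousLocalization.mk
    { deg := 0
      num := ⟨algebraMap A (reesAlgebra Q) c, fun j hj => by
        change (C c : A[X]).coeff j = 0
        rw [coeff_C, if_neg hj]⟩
      den := 1
      den_mem := one_mem _ }
  map_one' := HomogeneousLocalization.val_injective _ (by
    rw [HomogeneousLocalization.val_mk, HomogeneousLocalization.val_one]
    simp only [map_one]
    exact Localization.mk_one)
  map_zero' := HomogeneousLocalization.val_injective _ (by
    rw [HomogeneousLocalization.val_mk, HomogeneousLocalization.val_zero]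
    simp only [map_zero]
    exact Localization.mk_zero _)
  map_add' c d := HomogeneousLocalization.val_injective _ (by
    rw [HomogeneousLocalization.val_add]
    simp only [HomogeneousLocalization.val_mk, map_add]
    exact Localization.add_mk_self _ _ _ |>.symm)
  map_mul' c d := HomogeneousLocalization.val_injective _ (by
    rw [HomogeneousLocalization.val_mul]
    simp only [HomogeneousLocalization.val_mk, map_mul, Localization.mk_mul]
    congr 1
    exact (mul_one _).symm)

lemma val_reesConst (c : A) : (reesConst ψ hψ c).val =
    algebraMap (reesAlgebra Q) _ (algebraMap A (reesAlgebra Q) c) :=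
  Localization.mk_one_eq_algebraMap _

lemma reesConst_mul_reesFrac (c : A) {i : ℕ} {g e : A} (hg : g ∈ Q ^ i) (he : e ∈ Q ^ i)
    (h : (ψ e).homogeneousComponent i ≠ 0) :
    reesConst ψ hψ c * reesFrac hg he h =
      reesFrac (Ideal.mul_mem_left _ c hg : c * g ∈ Q ^ i) he h := by
  apply HomogeneousLocalization.val_injective
  rw [HomogeneousLocalization.val_mul, val_reesConst, val_reesFrac, val_reesFrac,
    ← Localization.mk_one_eq_algebraMap, Localization.mk_mul, one_mul]
  congr 1
  apply Subtype.ext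
  exact C_mul_monomial

lemma reesFrac_congr {i : ℕ} {g g' e : A} (hg : g ∈ Q ^ i) (hg' : g' ∈ Q ^ i) (he : e ∈ Q ^ i)
    (h : (ψ e).homogeneousComponent i ≠ 0) (hgg : g = g') :
    (reesFrac hg he h : LeadingFormLocalization ψ hψ) = reesFrac hg' he h := by
  subst hgg; rfl

variable {a f : A}

/-- A non-zero-divisor of `A` is a non-zero-divisor on the local ring. -/
lemma reesConst_regular (ha : ∀ g, a * g = 0 → g = 0) (h : LeadingFormLocalization ψ hψ)
    (h0 : reesConst ψ hψ a * h = 0) : h = 0 := by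
  obtain ⟨i, g, e, hg, he, hne, rfl⟩ := exists_eq_reesFrac h
  rw [reesConst_mul_reesFrac] at h0
  apply HomogeneousLocalization.val_injective
  have h1 := congrArg HomogeneousLocalization.val h0
  rw [val_reesFrac, HomogeneousLocalization.val_zero, Localization.mk_eq_mk',
    IsLocalization.mk'_eq_zero_iff] at h1
  rw [val_reesFrac, HomogeneousLocalization.val_zero, Localization.mk_eq_mk',
    IsLocalization.mk'_eq_zero_iff]
  obtain ⟨u, hu⟩ := h1
  refine ⟨u, Subtype.ext ?_⟩
  ext j
  refine ha _ ?_
  have h2 := congrArg (fun v : reesAlgebra Q => (v : A[X]).coeff j) hu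
  change ((u : A[X]) * monomial i (a * g)).coeff j = 0 at h2
  change a * ((u : A[X]) * monomial i g).coeff j = 0
  rw [← C_mul_monomial, mul_left_comm, coeff_C_mul] at h2
  exact h2

/-- If `f` were divisible by `a` in the local ring, clearing denominators and comparing coefficients in
a degree in which the leading form of the denominator does not vanish would give a relation
`f e = a g` in `A`. -/
lemma reesConst_ne (hf : ∀ i, ∀ e ∈ Q ^ i, ∀ g ∈ Q ^ i, (ψ e).homogeneousComponent i ≠ 0 →
      f * e ≠ a * g) (h : LeadingFormLocalization ψ hψ) :
    reesConst ψ hψ f ≠ reesConst ψ hψ a * h := by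
  obtain ⟨i, g, e, hg, he, hne, rfl⟩ := exists_eq_reesFrac h
  intro h0
  rw [reesConst_mul_reesFrac] at h0
  have h1 := congrArg HomogeneousLocalization.val h0
  rw [val_reesFrac, val_reesConst, ← Localization.mk_one_eq_algebraMap,
    Localization.mk_eq_mk_iff, Localization.r_iff_exists] at h1
  obtain ⟨⟨u, hu⟩, hu'⟩ := h1
  have hex : ∃ l, (ψ ((u : A[X]).coeff l)).homogeneousComponent l ≠ 0 := by
    by_contra hcon
    push Not at hcon
    exact hu ((mem_leadingFormIdeal ψ hψ).2 hcon)
  obtain ⟨l, hl⟩ := hex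
  have h2 := congrArg (fun v : reesAlgebra Q => (v : A[X]).coeff (l + i)) hu'
  change ((u : A[X]) * (monomial i e * C f)).coeff (l + i) =
    ((u : A[X]) * (1 * monomial i (a * g))).coeff (l + i) at h2
  rw [one_mul, mul_comm (monomial i e), C_mul_monomial, coeff_mul_monomial, coeff_mul_monomial] at h2
  have hul : (u : A[X]).coeff l ∈ Q ^ l := (mem_reesAlgebra_iff Q _).1 u.2 l
  refine hf (l + i) ((u : A[X]).coeff l * e) ?_ ((u : A[X]).coeff l * g) ?_ ?_ ?_
  · rw [pow_add]; exact Ideal.mul_mem_mul hul he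
  · rw [pow_add]; exact Ideal.mul_mem_mul hul hg
  · have he' : (i : ℕ∞) ≤ (ψ e).order := by
      have := pow_le_comap_orderIdeal k ψ hψ i he
      rwa [mul_one] at this
    rw [map_mul, MvPowerSeries.homogeneousComponent_mul_of_le_order
      (le_order_coeff_reesAlgebra ψ hψ u l) he']
    exact mul_ne_zero hl hne
  · linear_combination h2

lemma reesFrac_mul_reesFrac {i : ℕ} {g e : A} (hg : g ∈ Q ^ i) (he : e ∈ Q ^ i)
    (h : (ψ e).homogeneousComponent i ≠ 0) (h' : (ψ g).homogeneousComponent i ≠ 0) :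
    (reesFrac hg he h * reesFrac he hg h' : LeadingFormLocalization ψ hψ) = 1 := by
  apply HomogeneousLocalization.val_injective
  rw [HomogeneousLocalization.val_mul, val_reesFrac, val_reesFrac, HomogeneousLocalization.val_one,
    Localization.mk_mul]
  rw [mul_comm (reesMonomial i hg)]
  exact Localization.mk_self
    ((⟨reesMonomial i he, fun h0 => h ((reesMonomial_mem_leadingFormIdeal ψ hψ he).1 h0)⟩ :
      (leadingFormIdeal ψ hψ).primeCompl) *
        ⟨reesMonomial i hg, fun h0 => h' ((reesMonomial_mem_leadingFormIdeal ψ hψ hg).1 h0)⟩)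

lemma homogeneousComponent_eq_zero_of_mem_maximalIdeal {i : ℕ} {g e : A} (hg : g ∈ Q ^ i)
    (he : e ∈ Q ^ i) (h : (ψ e).homogeneousComponent i ≠ 0)
    (hm : (reesFrac hg he h : LeadingFormLocalization ψ hψ) ∈ IsLocalRing.maximalIdeal _) :
    (ψ g).homogeneousComponent i = 0 := by
  by_contra hcon
  exact (IsLocalRing.mem_maximalIdeal _).1 hm
    ⟨⟨_, _, reesFrac_mul_reesFrac hg he h hcon, reesFrac_mul_reesFrac he hg hcon h⟩, rfl⟩

/-- The depth of the local ring is at most one if `f` is a non-zero socle element modulo the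
non-zero-divisor `a`, both taken from `A`; the hypotheses say so in terms of fractions. -/
lemma localDepth_leadingFormLocalization_le_one (ha : ∀ g, a * g = 0 → g = 0)
    (hf : ∀ i, ∀ e ∈ Q ^ i, ∀ g ∈ Q ^ i, (ψ e).homogeneousComponent i ≠ 0 → f * e ≠ a * g)
    (h : ∀ i, ∀ g ∈ Q ^ i, (ψ g).homogeneousComponent i = 0 → ∃ g' ∈ Q ^ i, g * f = a * g')
    {R : Type*} [CommRing R] [IsLocalRing R] (φ : R ≃+* LeadingFormLocalization ψ hψ) :
    localDepth R ≤ 1 := by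
  refine localDepth_le_one (a := φ.symm (reesConst ψ hψ a)) (f := φ.symm (reesConst ψ hψ f))
    (fun g hg => ?_) (fun g hg => ?_) (fun m hm => ?_)
  · have := congrArg φ hg
    rw [map_mul, RingEquiv.apply_symm_apply, map_zero] at this
    exact (map_eq_zero_iff φ φ.injective).1 (reesConst_regular ha _ this)
  · have := congrArg φ hg
    rw [map_mul, RingEquiv.apply_symm_apply, RingEquiv.apply_symm_apply] at this
    exact reesConst_ne hf _ this
  · have hm' : φ m ∈ IsLocalRing.maximalIdeal _ := by
      rw [IsLocalRing.mem_maximalIdeal, mem_nonunits_iff] at hm ⊢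
      rwa [MulEquiv.isUnit_map]
    obtain ⟨i, g, e, hg, he, hne, hfr⟩ := exists_eq_reesFrac (φ m)
    rw [hfr] at hm'
    obtain ⟨g', hg', hgg⟩ := h i g hg (homogeneousComponent_eq_zero_of_mem_maximalIdeal hg he hne hm')
    refine ⟨φ.symm (reesFrac hg' he hne), φ.injective ?_⟩
    rw [map_mul, map_mul, hfr, RingEquiv.apply_symm_apply, RingEquiv.apply_symm_apply,
      RingEquiv.apply_symm_apply, reesConst_mul_reesFrac,
      mul_comm (reesFrac hg he hne), reesConst_mul_reesFrac]
    exact reesFrac_congr _ _ _ _ (by rw [← hgg, mul_comm])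

/-- A chain `p₀ ⊂ p₁ ⊂ p₂` of primes of the Rees algebra contained in the prime `P`, whose steps
are witnessed by elements of degree zero, gives a chain of primes in the local ring at `P`. -/
lemma two_le_ringKrullDim_leadingFormLocalization {p₀ p₁ : Ideal (reesAlgebra Q)} [p₀.IsPrime]
    [p₁.IsPrime] (h01 : p₀ ≤ p₁) (h1 : p₁ ≤ leadingFormIdeal ψ hψ) {c₁ c₂ : A}
    (hc₁ : algebraMap A _ c₁ ∈ p₁) (hc₁' : algebraMap A _ c₁ ∉ p₀)
    (hc₂ : algebraMap A _ c₂ ∈ leadingFormIdeal ψ hψ) (hc₂' : algebraMap A _ c₂ ∉ p₁) :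
    2 ≤ ringKrullDim (LeadingFormLocalization ψ hψ) := by
  set P := leadingFormIdeal ψ hψ with hP
  let L := Localization P.primeCompl
  let S := LeadingFormLocalization ψ hψ
  have hdisj : ∀ p : Ideal (reesAlgebra Q), p ≤ P →
      Disjoint (P.primeCompl : Set (reesAlgebra Q)) (p : Set (reesAlgebra Q)) :=
    fun p hp => Set.disjoint_left.2 fun x hx hx' => hx (hp hx')
  let q (p : Ideal (reesAlgebra Q)) : Ideal S :=
    (p.map (algebraMap (reesAlgebra Q) L)).comap (algebraMap S L)
  have hq : ∀ p : Ideal (reesAlgebra Q), p.IsPrime → p ≤ P → (q p).IsPrime := fun p hp hpP => by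
    have := IsLocalization.isPrime_of_isPrime_disjoint P.primeCompl L p hp (hdisj p hpP)
    exact Ideal.comap_isPrime _ _
  have hmem : ∀ p : Ideal (reesAlgebra Q), p.IsPrime → p ≤ P → ∀ c : A,
      reesConst ψ hψ c ∈ q p ↔ algebraMap A _ c ∈ p := fun p hp hpP c => by
    have h2 := IsLocalization.under_map_of_isPrime_disjoint P.primeCompl L hp (hdisj p hpP)
    nth_rw 2 [← h2]
    change (reesConst ψ hψ c).val ∈ p.map (algebraMap (reesAlgebra Q) L) ↔ _
    rw [val_reesConst]
    rfl
  have hmono : ∀ p p' : Ideal (reesAlgebra Q), p ≤ p' → q p ≤ q p' := fun p p' h =>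
    Ideal.comap_mono (Ideal.map_mono h)
  have i0 := hq p₀ inferInstance (h01.trans h1)
  have i1 := hq p₁ inferInstance h1
  have i2 := hq P inferInstance le_rfl
  refine two_le_ringKrullDim_of_lt (p := q p₀) (q := q p₁) (r := q P)
    (lt_of_le_of_ne (hmono _ _ h01) fun h => ?_) (lt_of_le_of_ne (hmono _ _ h1) fun h => ?_)
  · exact hc₁' ((hmem p₀ inferInstance (h01.trans h1) c₁).1
      (h ▸ (hmem p₁ inferInstance h1 c₁).2 hc₁))
  · exact hc₂' ((hmem p₁ inferInstance h1 c₂).1 (h ▸ (hmem P inferInstance le_rfl c₂).2 hc₂))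

end LocalRingOfProj

section ExProj

variable (k : Type u) [Field k] {n : ℕ}

local notation "𝐱" => exVar k n 0
local notation "𝐲" => exVar k n 1
local notation "𝐳" => exVar k n 2
local notation "𝐰" => exVar k n 3
local notation "𝔮" => Ideal.span {exVar k n 0 * exVar k n 1 ^ (n - 1) - exVar k n 2,
  exVar k n 0 ^ n + exVar k n 1 ^ n - exVar k n 3}

/-- The kernel of the map `A[Qt] → D[T]` induced by `φ : A → D`. -/
noncomputable def reesKer {A : Type*} [CommRing A] (Q : Ideal A) {D : Type*} [CommRing D]
    (φ : A →+* D) : Ideal (reesAlgebra Q) :=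
  RingHom.ker ((mapRingHom φ).comp (reesAlgebra Q).val.toRingHom)

lemma mem_reesKer {A : Type*} [CommRing A] {Q : Ideal A} {D : Type*} [CommRing D] {φ : A →+* D}
    {f : reesAlgebra Q} : f ∈ reesKer Q φ ↔ ∀ i, φ ((f : A[X]).coeff i) = 0 := by
  change (f : A[X]).map φ = 0 ↔ _
  rw [Polynomial.ext_iff]
  simp

lemma algebraMap_mem_reesKer {A : Type*} [CommRing A] {Q : Ideal A} {D : Type*} [CommRing D]
    {φ : A →+* D} {c : A} : algebraMap A _ c ∈ reesKer Q φ ↔ φ c = 0 := by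
  change (C c : A[X]).map φ = 0 ↔ _
  rw [map_C, C_eq_zero]

/-- The homogeneous prime ideal of `A[Q't]` of the elements whose leading forms vanish along
`x = y = w = 0`. -/
noncomputable def exPoint (hn : 2 ≤ n) : ProjectiveSpectrum (reesGrading 𝔮) where
  asHomogeneousIdeal := ⟨leadingFormIdeal (exToZ k (by omega)) (span_le_comap_exToZ k hn),
    isHomogeneous_leadingFormIdeal _ _⟩
  isPrime := by
    change (leadingFormIdeal _ _).IsPrime
    infer_instance
  not_irrelevant_le h := by
    have ha : 𝐱 * 𝐲 ^ (n - 1) - 𝐳 ∈ 𝔮 ^ 1 := by rw [pow_one]; exact mem_span_pair_left _ _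
    have h1 := h (HomogeneousIdeal.mem_irrelevant_of_mem _ one_pos (reesMonomial_mem_reesGrading ha))
    have h2 := (reesMonomial_mem_leadingFormIdeal _ _ ha).1 h1
    have h3 := (homogeneousComponent_exToZ_eq_zero_iff k hn 1 1 0).1 (by simpa using h2)
    exact (Ideal.ne_top_iff_one _).1 (Ideal.IsPrime.ne_top inferInstance) h3

/-- The local ring at `exPoint` has depth at most one, but dimension at least two: below the point lie
the kernels of `A[Q't] → k[[Z]][T]` and `A[Q't] → k[[Z, W]][T]`. -/
lemma not_isLocallyCohenMacaulay (hn : 2 ≤ n) : ¬ IsLocallyCohenMacaulay (projRees 𝔮) := by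
  intro h
  have hn0 : n ≠ 0 := by omega
  let x : AlgebraicGeometry.Proj (reesGrading 𝔮) := exPoint k hn
  have hx : IsCohenMacaulayLocal ((AlgebraicGeometry.Proj (reesGrading 𝔮)).presheaf.stalk x) := h x
  let φ : ((AlgebraicGeometry.Proj (reesGrading 𝔮)).presheaf.stalk x) ≃+*
      LeadingFormLocalization (exToZ k hn0) (span_le_comap_exToZ k hn) :=
    (AlgebraicGeometry.Proj.stalkIso (reesGrading 𝔮) x).commRingCatIsoToRingEquiv
  have hdepth := localDepth_leadingFormLocalization_le_one (theta_sub_z_regular k hn)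
    (fun i e he g hg => socleElement_mul_ne k hn he hg)
    (fun i g hg => exists_mul_socleElement_eq_of_leading k hn hg) φ
  have := NoZeroDivisors.to_isDomain (MvPowerSeries (Fin 2) k)
  have := NoZeroDivisors.to_isDomain (MvPowerSeries (Fin 1) k)
  have i0 : (reesKer 𝔮 (exToZW k hn0)).IsPrime := RingHom.ker_isPrime _
  have i1 : (reesKer 𝔮 (exToZ k hn0)).IsPrime := RingHom.ker_isPrime _
  have hdim : 2 ≤ ringKrullDim (LeadingFormLocalization (exToZ k hn0) (span_le_comap_exToZ k hn)) := by
    refine two_le_ringKrullDim_leadingFormLocalization (p₀ := reesKer 𝔮 (exToZW k hn0))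
      (p₁ := reesKer 𝔮 (exToZ k hn0)) (c₁ := 𝐰) (c₂ := 𝐳) ?_ ?_ ?_ ?_ ?_ ?_
    · intro f hf
      rw [mem_reesKer] at hf ⊢
      exact fun i => ker_exToZW_le k hn0 (hf i)
    · intro f hf
      rw [mem_reesKer] at hf
      rw [mem_leadingFormIdeal]
      intro i
      rw [hf i, map_zero]
    · rw [algebraMap_mem_reesKer, exToZ_w]
    · rw [algebraMap_mem_reesKer, exToZW_w]
      exact mvPowerSeries_X_ne_zero k _
    · rw [mem_leadingFormIdeal]
      intro i
      change (exToZ k hn0 ((C 𝐳 : (ExRing k n)[X]).coeff i)).homogeneousComponent i = 0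
      rw [coeff_C]
      split_ifs with hi
      · subst hi
        have := (homogeneousComponent_exToZ_eq_zero_iff k hn 0 𝐳 0).2 (exVar_mem_maximalIdeal k n 2)
        simpa using this
      · rw [map_zero, map_zero]
    · rw [algebraMap_mem_reesKer, exToZ_z]
      exact mvPowerSeries_X_ne_zero k _
  rw [← ringKrullDim_eq_of_ringEquiv φ, ← hx.depth_eq] at hdim
  have h1 : (2 : WithBot ℕ∞) ≤ 1 := hdim.trans (by exact_mod_cast hdepth)
  exact absurd h1 (by decide)

end ExProj


/-! ### Lengths of localized modules -/

section LocalLength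

variable {R W : Type*} [CommRing R] [IsLocalRing R] [AddCommGroup W] [Module R W]

lemma length_sup_span_singleton {N : Submodule R W} {s : W} (hs : s ∉ N)
    (hkill : ∀ c ∈ IsLocalRing.maximalIdeal R, c • s ∈ N) :
    Module.length R ↥(N ⊔ Submodule.span R {s}) = Module.length R N + 1 := by
  have hcov : N ⋖ N ⊔ Submodule.span R {s} := by
    refine ⟨?_, fun P hNP hPs => ?_⟩
    · refine lt_of_le_of_ne le_sup_left fun h => hs ?_
      rw [h]
      exact (le_sup_right : _ ≤ N ⊔ _) (Submodule.mem_span_singleton_self s)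
    · obtain ⟨v, hv, hvN⟩ := SetLike.exists_of_lt hNP
      obtain ⟨m, hm, t, ht, rfl⟩ := Submodule.mem_sup.1 (hPs.le hv)
      obtain ⟨c, rfl⟩ := Submodule.mem_span_singleton.1 ht
      have hc : IsUnit c := by
        by_contra h
        exact hvN (N.add_mem hm (hkill c h))
      have hsP : s ∈ P := by
        have : c • s ∈ P := by simpa using P.sub_mem hv (hNP.le hm)
        exact (Submodule.smul_mem_iff_of_isUnit P hc).1 this
      exact not_le_of_gt hPs (sup_le hNP.le ((Submodule.span_singleton_le_iff_mem _ _).2 hsP))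
  have hsimple := (covBy_iff_quot_is_simple hcov.le).1 hcov
  have h1 := Module.length_eq_one_iff.2 hsimple
  have h2 := Module.length_eq_add_of_exact
    ((N.comap (N ⊔ Submodule.span R {s}).subtype).subtype)
    ((N.comap (N ⊔ Submodule.span R {s}).subtype).mkQ)
    (Submodule.injective_subtype _) (Submodule.mkQ_surjective _)
    (LinearMap.exact_subtype_mkQ _)
  rw [h2, h1, (Submodule.comapSubtypeEquivOfLe hcov.le).length_eq]

/-- A module over a local ring has length `#F` if it is spanned by a finite family with weights `d`
such that the maximal ideal sends each member into the span of those with larger weight, and no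
member lies in the span of the other members of at least its weight: adding the members in order of
decreasing weight gives a composition series. -/
theorem length_eq_card_of_weights {ι : Type*} [DecidableEq ι] (F : Finset ι) (e : ι → W) (d : ι → ℕ)
    (kill : ∀ i ∈ F, ∀ c ∈ IsLocalRing.maximalIdeal R,
      c • e i ∈ Submodule.span R (e '' {j | j ∈ F ∧ d i < d j}))
    (ind : ∀ i ∈ F, e i ∉ Submodule.span R (e '' {j | j ∈ F ∧ d i ≤ d j ∧ j ≠ i}))
    (gen : ⊤ ≤ Submodule.span R (e '' (F : Set ι))) :
    Module.length R W = F.card := by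
  have key : ∀ G : Finset ι, G ⊆ F → (∀ i ∈ G, ∀ j ∈ F, d i < d j → j ∈ G) →
      Module.length R ↥(Submodule.span R (e '' (G : Set ι))) = G.card := by
    intro G
    refine Finset.induction_on_min_value d G
      (by rw [Finset.coe_empty, Set.image_empty, Submodule.span_empty]; simp) ?_
    · intro a s has hmin ih hsub hup
      have haF : a ∈ F := hsub (Finset.mem_insert_self a s)
      have h1 : e '' ((insert a s : Finset ι) : Set ι) = e '' (s : Set ι) ∪ {e a} := by
        rw [Finset.coe_insert, Set.image_insert_eq, Set.insert_eq, Set.union_comm]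
      rw [h1, Submodule.span_union, length_sup_span_singleton, ih, Finset.card_insert_of_notMem has]
      · push_cast; rfl
      · exact (Finset.subset_insert a s).trans hsub
      · intro i hi j hj hij
        have := hup i (Finset.mem_insert_of_mem hi) j hj hij
        rcases Finset.mem_insert.1 this with rfl | h
        · exact absurd (hmin i hi) (not_le_of_gt hij)
        · exact h
      · intro h
        refine ind a haF (Submodule.span_mono (Set.image_mono ?_) h)
        intro j hj
        exact ⟨hsub (Finset.mem_insert_of_mem hj), hmin j hj, fun h => has (h ▸ hj)⟩
      · intro c hc
        refine Submodule.span_mono (Set.image_mono ?_) (kill a haF c hc)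
        rintro j ⟨hj, hlt⟩
        rcases Finset.mem_insert.1 (hup a (Finset.mem_insert_self a s) j hj hlt) with rfl | h
        · exact absurd hlt (lt_irrefl _)
        · exact h
  rw [← key F subset_rfl fun _ _ j hj _ => hj, top_le_iff.1 gen, Module.length_top]

end LocalLength

section Localized

variable {T : Type*} [CommRing T] (p : Ideal T) [p.IsPrime]

lemma mk_one_mem_span_iff {M : Type*} [AddCommGroup M] [Module T M] (G : Set M) (v : M) :
    LocalizedModule.mkLinearMap p.primeCompl M v ∈ Submodule.span (Localization.AtPrime p)
        (LocalizedModule.mkLinearMap p.primeCompl M '' G) ↔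
      ∃ u ∉ p, u • v ∈ Submodule.span T G := by
  rw [← Submodule.localized'_span (Localization.AtPrime p) p.primeCompl, Submodule.mem_localized']
  constructor
  · rintro ⟨m, hm, s, h⟩
    rw [IsLocalizedModule.mk'_eq_iff, ← LinearMap.map_smul_of_tower] at h
    obtain ⟨c, hc⟩ := IsLocalizedModule.exists_of_eq (S := p.primeCompl) h
    refine ⟨(c * s : p.primeCompl), (c * s).2, ?_⟩
    have : ((c * s : p.primeCompl) : T) • v = c • m := by
      rw [hc, Submonoid.coe_mul, mul_smul]; rfl
    rw [this]
    exact Submodule.smul_mem _ _ hm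
  · rintro ⟨u, hu, h⟩
    refine ⟨_, h, ⟨u, hu⟩, ?_⟩
    rw [IsLocalizedModule.mk'_eq_iff, map_smul]
    rfl

/-- The length at the prime `p` of the image of `K` in `V / N₀`, when `K` is generated modulo `N₀`,
locally at `p`, by a finite family as in `length_eq_card_of_weights`. -/
theorem length_localizedModule_map_mkQ {V ι : Type*} [AddCommGroup V] [Module T V] [DecidableEq ι]
    (N₀ K : Submodule T V) (F : Finset ι) (g : ι → V) (d : ι → ℕ) (hg : ∀ i ∈ F, g i ∈ K)
    (kill : ∀ i ∈ F, ∀ c ∈ p,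
      ∃ u ∉ p, (u * c) • g i ∈ N₀ ⊔ Submodule.span T (g '' {j | j ∈ F ∧ d i < d j}))
    (ind : ∀ i ∈ F, ∀ u ∉ p,
      u • g i ∉ N₀ ⊔ Submodule.span T (g '' {j | j ∈ F ∧ d i ≤ d j ∧ j ≠ i}))
    (gen : ∀ v ∈ K, ∃ u ∉ p, u • v ∈ N₀ ⊔ Submodule.span T (g '' (F : Set ι))) :
    Module.length (Localization.AtPrime p)
      (LocalizedModule p.primeCompl ↥(K.map N₀.mkQ)) = F.card := by
  classical
  let M := ↥(K.map N₀.mkQ)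
  let s : ι → M := fun i => if h : i ∈ F then ⟨N₀.mkQ (g i), Submodule.mem_map_of_mem (hg i h)⟩ else 0
  let L := LocalizedModule.mkLinearMap p.primeCompl M
  have hs : ∀ i ∈ F, (s i : V ⧸ N₀) = N₀.mkQ (g i) := fun i hi => by simp only [s, dif_pos hi]
  have htr : ∀ (G : Set ι), G ⊆ F → ∀ (v : V) (m : M), (m : V ⧸ N₀) = N₀.mkQ v →
      (L m ∈ Submodule.span (Localization.AtPrime p) ((fun i => L (s i)) '' G) ↔
        ∃ u ∉ p, u • v ∈ N₀ ⊔ Submodule.span T (g '' G)) := by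
    intro G hG v m hm
    have h1 : (fun i => L (s i)) '' G = L '' (s '' G) := by rw [Set.image_image]
    rw [h1, mk_one_mem_span_iff]
    refine exists_congr fun u => and_congr_right fun _ => ?_
    have h2 : (Submodule.span T (s '' G)).map (K.map N₀.mkQ).subtype =
        (Submodule.span T (g '' G)).map N₀.mkQ := by
      rw [Submodule.map_span, Submodule.map_span, Set.image_image, Set.image_image]
      congr 1
      exact Set.image_congr fun i hi => hs i (hG hi)
    have h3 : u • m ∈ Submodule.span T (s '' G) ↔ (K.map N₀.mkQ).subtype (u • m) ∈
        (Submodule.span T (s '' G)).map (K.map N₀.mkQ).subtype :=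
      ((K.map N₀.mkQ).injective_subtype.mem_set_image).symm
    rw [h3, h2, ← Submodule.comap_map_mkQ, Submodule.mem_comap, map_smul, map_smul,
      Submodule.subtype_apply, hm]
  refine length_eq_card_of_weights F (fun i => L (s i)) d ?_ ?_ ?_
  · intro i hi c hc
    have h1 : IsLocalRing.maximalIdeal (Localization.AtPrime p) ≤
        (Submodule.span (Localization.AtPrime p)
          ((fun i => L (s i)) '' {j | j ∈ F ∧ d i < d j})).comap
          (LinearMap.toSpanSingleton (Localization.AtPrime p) _ (L (s i))) := by
      rw [← IsLocalization.AtPrime.map_eq_maximalIdeal p, Ideal.map, Ideal.span_le]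
      rintro _ ⟨a, ha, rfl⟩
      rw [SetLike.mem_coe, Submodule.mem_comap, LinearMap.toSpanSingleton_apply, algebraMap_smul,
        ← map_smul]
      refine (htr _ (fun j hj => hj.1) (a • g i) _ ?_).2 ?_
      · rw [Submodule.coe_smul, hs i hi, map_smul]
      · obtain ⟨u, hu, h⟩ := kill i hi a ha
        exact ⟨u, hu, by rwa [smul_smul]⟩
    exact h1 hc
  · intro i hi h
    obtain ⟨u, hu, h⟩ := (htr _ (fun j hj => hj.1) (g i) _ (hs i hi)).1 h
    exact ind i hi u hu h
  · have h1 : (⊤ : Submodule T M) ≤ ((Submodule.span (Localization.AtPrime p)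
        ((fun i => L (s i)) '' (F : Set ι))).restrictScalars T).comap L := by
      rintro ⟨_, v, hv, rfl⟩ -
      exact (htr _ subset_rfl v _ rfl).2 (gen v hv)
    rintro v -
    obtain ⟨⟨m, u⟩, rfl⟩ := IsLocalizedModule.mk'_surjective p.primeCompl L v
    simp only [Function.uncurry]
    have h2 : IsLocalizedModule.mk' L m u =
        IsLocalization.mk' (Localization.AtPrime p) 1 u • L m := by
      rw [← IsLocalizedModule.mk'_one p.primeCompl L m, IsLocalizedModule.mk'_smul_mk', one_smul,
        mul_one]
    change IsLocalizedModule.mk' L m u ∈ _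
    rw [h2]
    exact Submodule.smul_mem _ _ (h1 Submodule.mem_top)

end Localized


/-! ### The fibre ideal of the Rees algebra is prime -/

section FiberIdeal

variable {k : Type*} [Field k] {σ : Type*} {A : Type u} [CommRing A] [IsLocalRing A] {a b : A}
  (ψ : A →+* MvPowerSeries σ k)

lemma mem_maximalIdeal_of_constantCoeff_eq_zero {c : A}
    (h : MvPowerSeries.constantCoeff (ψ c) = 0) : c ∈ IsLocalRing.maximalIdeal A := by
  rw [IsLocalRing.mem_maximalIdeal, mem_nonunits_iff]
  intro hc
  exact ((hc.map ψ).map (MvPowerSeries.constantCoeff (σ := σ) (R := k))).ne_zero h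

/-- An element of `(a, b) ^ i` whose image has order larger than `i` lies in `𝔪 (a, b) ^ i`: the
leading form determines the coefficients of an expression in `a` and `b` modulo `𝔪`. -/
lemma mem_maximalIdeal_mul_pow_of_homogeneousComponent {s t : σ} (hst : s ≠ t)
    (ha : ψ a = -MvPowerSeries.X s) (hb : ψ b = -MvPowerSeries.X t) (i : ℕ) :
    ∀ {g : A}, g ∈ Ideal.span {a, b} ^ i → (ψ g).homogeneousComponent i = 0 →
      g ∈ IsLocalRing.maximalIdeal A * Ideal.span {a, b} ^ i := by
  classical
  have hb' : ∀ h j, MvPowerSeries.coeff (Finsupp.single s j) (ψ b * h) = 0 := by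
    intro h j
    rw [hb, neg_mul, map_neg, ← pow_one (MvPowerSeries.X t), MvPowerSeries.coeff_X_pow_mul_eq,
      if_neg, neg_zero]
    intro hle
    simp [hst] at hle
  induction i with
  | zero =>
    intro g _ hg
    have h0 : (ψ (a ^ 0 * g + b * 0)).homogeneousComponent 0 = 0 := by simpa using hg
    have := constantCoeff_eq_zero_of_homogeneousComponent ψ s ha hb' h0
    simpa using mem_maximalIdeal_of_constantCoeff_eq_zero ψ this
  | succ i ih =>
    intro g hg hg0
    rw [span_pair_pow_succ] at hg
    obtain ⟨u, hu, v, hv, rfl⟩ := Submodule.mem_sup.1 hg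
    obtain ⟨c, rfl⟩ := Ideal.mem_span_singleton'.1 hu
    obtain ⟨d, hd, rfl⟩ := Ideal.mem_span_singleton_mul.1 hv
    rw [mul_comm c] at hg0 ⊢
    have hc := mem_maximalIdeal_of_constantCoeff_eq_zero ψ
      (constantCoeff_eq_zero_of_homogeneousComponent ψ s ha hb' hg0)
    have h1 : a ^ (i + 1) * c ∈ IsLocalRing.maximalIdeal A * Ideal.span {a, b} ^ (i + 1) := by
      rw [mul_comm (a ^ _)]
      exact Ideal.mul_mem_mul hc (Ideal.pow_mem_pow (mem_span_pair_left _ _) _)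
    refine add_mem h1 ?_
    have h2 : (ψ d).homogeneousComponent i = 0 := by
      ext e
      rw [MvPowerSeries.coeff_homogeneousComponent, map_zero]
      split_ifs with he
      · have h3 := congrArg (MvPowerSeries.coeff (Finsupp.single t 1 + e)) hg0
        rw [MvPowerSeries.coeff_homogeneousComponent, if_pos, map_add, map_add, map_mul ψ b, hb,
          neg_mul, map_neg, ← pow_one (MvPowerSeries.X t), MvPowerSeries.coeff_X_pow_mul_eq,
          if_pos, add_tsub_cancel_left, map_zero] at h3
        · have h4 : MvPowerSeries.coeff (Finsupp.single t 1 + e) (ψ (a ^ (i + 1) * c)) = 0 := by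
            rw [map_mul, map_pow, ha, neg_pow, mul_assoc]
            have h5 : ((-1) ^ (i + 1) : MvPowerSeries σ k) = MvPowerSeries.C ((-1) ^ (i + 1)) := by
              simp
            rw [h5, MvPowerSeries.coeff_C_mul, MvPowerSeries.coeff_X_pow_mul_eq, if_neg, mul_zero]
            intro hle
            have h6 : e s ≤ e.degree := Finsupp.le_degree s e
            simp [hst.symm] at hle
            omega
          rw [h4, zero_add] at h3
          exact neg_eq_zero.1 h3
        · simp
        · rw [map_add, Finsupp.degree_single, he, add_comm]
      · rfl
    have hp : Ideal.span {a, b} ^ (i + 1) = Ideal.span {a, b} * Ideal.span {a, b} ^ i :=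
      pow_succ' _ i
    rw [hp, mul_left_comm]
    exact Ideal.mul_mem_mul (mem_span_pair_right _ _) (ih hd h2)

lemma reesMonomial_mem_reesFiberIdeal {Q : Ideal A} {i : ℕ} {g : A} (hg : g ∈ Q ^ i)
    (h : g ∈ IsLocalRing.maximalIdeal A * Q ^ i) : reesMonomial i hg ∈ reesFiberIdeal Q := by
  refine Submodule.mul_induction_on' (C := fun g _ => ∀ hg : g ∈ Q ^ i,
    reesMonomial i hg ∈ reesFiberIdeal Q) (fun c hc d hd hg => ?_) (fun c hc d hd h1 h2 hcd => ?_) h hg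
  · have : reesMonomial i hg = algebraMap A (reesAlgebra Q) c * reesMonomial i hd :=
      Subtype.ext C_mul_monomial.symm
    rw [this]
    exact Ideal.mul_mem_right _ _ (Ideal.mem_map_of_mem _ hc)
  · have hc' : c ∈ Q ^ i := Ideal.mul_le_right hc
    have hd' : d ∈ Q ^ i := Ideal.mul_le_right hd
    have : reesMonomial i hcd = reesMonomial i hc' + reesMonomial i hd' :=
      Subtype.ext (map_add (monomial i) c d)
    rw [this]
    exact add_mem (h1 _) (h2 _)

/-- If the images of `a` and `b` are, up to sign, two variables, then `𝔪 A[Qt]` is the kernel of the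
leading form map, and in particular prime. -/
theorem reesFiberIdeal_eq_leadingFormIdeal {s t : σ} (hst : s ≠ t)
    (ha : ψ a = -MvPowerSeries.X s) (hb : ψ b = -MvPowerSeries.X t)
    (hψ : Ideal.span {a, b} ≤ (orderIdeal k 1).comap ψ)
    (h𝔪 : IsLocalRing.maximalIdeal A ≤ (orderIdeal k 1).comap ψ) :
    reesFiberIdeal (Ideal.span {a, b}) = leadingFormIdeal ψ hψ := by
  apply le_antisymm
  · rw [reesFiberIdeal, Ideal.map_le_iff_le_comap]
    intro c hc
    have h1 : algebraMap A (reesAlgebra (Ideal.span {a, b})) c =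
        reesMonomial 0 (show c ∈ Ideal.span {a, b} ^ 0 by simp) :=
      Subtype.ext (monomial_zero_left (a := c)).symm
    rw [Ideal.mem_comap, h1, reesMonomial_mem_leadingFormIdeal]
    refine MvPowerSeries.homogeneousComponent_of_lt_order_eq_zero ?_
    exact lt_of_lt_of_le (by norm_num) (mem_orderIdeal k |>.1 (h𝔪 hc))
  · intro f hf
    rw [mem_leadingFormIdeal] at hf
    have h1 : f = ∑ i ∈ (f : A[X]).support, reesMonomial i ((mem_reesAlgebra_iff _ _).1 f.2 i) := by
      apply Subtype.ext
      rw [AddSubmonoidClass.coe_finsetSum]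
      exact (f : A[X]).as_sum_support
    rw [h1]
    refine Ideal.sum_mem _ fun i _ => reesMonomial_mem_reesFiberIdeal _ ?_
    exact mem_maximalIdeal_mul_pow_of_homogeneousComponent ψ hst ha hb i
      ((mem_reesAlgebra_iff _ _).1 f.2 i) (hf i)

end FiberIdeal


/-! ### Sally modules locally at the fibre ideal -/

section Saturation

variable {T V : Type*} [CommRing T] (p : Ideal T) [hp : p.IsPrime] [AddCommGroup V] [Module T V]

/-- The submodule of the elements that lie in `N` after localization at `p`. -/
def localSaturation (N : Submodule T V) : Submodule T V where
  carrier := {v | ∃ u ∉ p, u • v ∈ N}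
  add_mem' := by
    rintro v w ⟨u, hu, h⟩ ⟨u', hu', h'⟩
    refine ⟨u * u', fun h => (hp.mem_or_mem h).elim hu hu', ?_⟩
    rw [smul_add]
    exact N.add_mem (by rw [mul_comm, mul_smul]; exact N.smul_mem _ h)
      (by rw [mul_smul]; exact N.smul_mem _ h')
  zero_mem' := ⟨1, p.one_notMem, by simp⟩
  smul_mem' := by
    rintro c v ⟨u, hu, h⟩
    exact ⟨u, hu, by rw [smul_comm]; exact N.smul_mem c h⟩

variable {p}

lemma le_localSaturation (N : Submodule T V) : N ≤ localSaturation p N :=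
  fun v hv => ⟨1, p.one_notMem, by rwa [one_smul]⟩

lemma mem_localSaturation_of_smul_mem {N : Submodule T V} {u : T} (hu : u ∉ p) {v : V}
    (h : u • v ∈ localSaturation p N) : v ∈ localSaturation p N := by
  obtain ⟨u', hu', h⟩ := h
  exact ⟨u' * u, fun h => (hp.mem_or_mem h).elim hu' hu, by rwa [mul_smul]⟩

end Saturation

section SallyModule

variable {A : Type u} [CommRing A] {Q I : Ideal A}

lemma monomial_mem_idealTimesRees {J : Ideal A} {m : ℕ} {h : A}
    (hh : h ∈ I * J ^ m) : monomial m h ∈ idealTimesRees Q I J := by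
  refine Submodule.mul_induction_on hh (fun c hc d hd => ?_) fun c d hc hd => ?_
  · exact Submodule.subset_span ⟨c, hc, monomial m d, reesAlgebra.monomial_mem.2 hd,
      C_mul_monomial.symm⟩
  · rw [map_add]
    exact add_mem hc hd

lemma coeff_mem_of_mem_idealTimesRees {v : A[X]} (hv : v ∈ idealTimesRees Q I Q) (m : ℕ) :
    v.coeff m ∈ Q ^ m * I := by
  induction hv using Submodule.span_induction generalizing m with
  | mem v h =>
    obtain ⟨a, ha, f, hf, rfl⟩ := h
    rw [coeff_C_mul, mul_comm a]
    exact Ideal.mul_mem_mul ((mem_reesAlgebra_iff Q _).1 hf m) ha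
  | zero => simp
  | add v w _ _ h1 h2 => rw [coeff_add]; exact add_mem (h1 m) (h2 m)
  | smul u v _ h =>
    change ((u : A[X]) * v).coeff m ∈ _
    rw [coeff_mul]
    refine Ideal.sum_mem _ fun q hq => ?_
    rw [← Finset.HasAntidiagonal.mem_antidiagonal.1 hq, pow_add, mul_assoc]
    exact Ideal.mul_mem_mul ((mem_reesAlgebra_iff Q _).1 u.2 q.1) (h q.2)

lemma coeff_mem_of_mem_span {G : Set A[X]} {L : Ideal A} (hG : ∀ v ∈ G, ∀ m, v.coeff m ∈ L)
    {v : A[X]} (hv : v ∈ Submodule.span (reesAlgebra Q) G) (m : ℕ) : v.coeff m ∈ L := by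
  induction hv using Submodule.span_induction generalizing m with
  | mem v h => exact hG v h m
  | zero => simp
  | add v w _ _ h1 h2 => rw [coeff_add]; exact add_mem (h1 m) (h2 m)
  | smul u v _ h =>
    change ((u : A[X]) * v).coeff m ∈ _
    rw [coeff_mul]
    exact Ideal.sum_mem _ fun q _ => L.mul_mem_left _ (h q.2)

/-- The elements `h` of `A` with `h t ^ m ∈ N`. -/
noncomputable def monomialIdeal (N : Submodule (reesAlgebra Q) A[X]) (m : ℕ) : Ideal A :=
  (N.restrictScalars A).comap (monomial m)

lemma reesMonomial_smul_monomial {i m : ℕ} {g : A} (hg : g ∈ Q ^ i) (h : A) :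
    reesMonomial i hg • monomial m h = monomial (i + m) (g * h) :=
  monomial_mul_monomial i m g h

lemma mul_mem_monomialIdeal_succ {N : Submodule (reesAlgebra Q) A[X]} {m : ℕ} {q h : A}
    (hq : q ∈ Q) (hh : h ∈ monomialIdeal N m) : q * h ∈ monomialIdeal N (m + 1) := by
  have h1 := N.smul_mem (reesMonomial 1 (by rwa [pow_one] : q ∈ Q ^ 1)) hh
  rwa [reesMonomial_smul_monomial, add_comm] at h1

lemma pow_succ_le_mul_pow {J : Ideal A} (h3 : J ^ 3 ≤ Q * J ^ 2) (m : ℕ) :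
    J ^ (m + 3) ≤ Q * J ^ (m + 2) := by
  have e1 : J ^ (m + 3) = J ^ 3 * J ^ m := by rw [← pow_add, add_comm]
  have e2 : Q * J ^ (m + 2) = Q * J ^ 2 * J ^ m := by rw [mul_assoc, ← pow_add, add_comm m]
  rw [e1, e2]
  exact Ideal.mul_mono_left h3

/-- If `I ^ 3 = Q I ^ 2`, the module `I A[It]` is generated in degrees `0` and `1`. -/
lemma idealTimesRees_le (h3 : I ^ 3 ≤ Q * I ^ 2) {N : Submodule (reesAlgebra Q) A[X]}
    (h0 : I ≤ monomialIdeal N 0) (h1 : I ^ 2 ≤ monomialIdeal N 1) :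
    idealTimesRees Q I I ≤ N := by
  have key : ∀ m, I ^ (m + 1) ≤ monomialIdeal N m := by
    intro m
    induction m with
    | zero => simpa using h0
    | succ m ih =>
      cases m with
      | zero => exact h1
      | succ m =>
        exact (pow_succ_le_mul_pow h3 m).trans
          (Ideal.mul_le.2 fun q hq h hh => mul_mem_monomialIdeal_succ hq (ih hh))
  refine Submodule.span_le.2 ?_
  rintro _ ⟨c, hc, f, hf, rfl⟩
  rw [SetLike.mem_coe, (C c * f).as_sum_support]
  refine Submodule.sum_mem _ fun m _ => key m ?_
  have hp : I ^ (m + 1) = I * I ^ m := pow_succ' I m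
  rw [coeff_C_mul, hp]
  exact Ideal.mul_mem_mul hc ((mem_reesAlgebra_iff I _).1 hf m)

end SallyModule

section SallyRank

variable (k : Type u) [Field k] {n : ℕ}

local notation "𝐱" => exVar k n 0
local notation "𝐲" => exVar k n 1
local notation "𝐳" => exVar k n 2
local notation "𝐰" => exVar k n 3
local notation "𝔟" => exIdeal k n n n ⊤ ⊤
local notation "𝔷" => exIdeal k n ⊤ ⊤ 1 1
local notation "𝔪" => IsLocalRing.maximalIdeal (ExRing k n)
local notation "𝔫" => (Ideal.span {exVar k n 0, exVar k n 1} ^ n : Ideal (ExRing k n))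
local notation "𝐈" => ((Ideal.span {exVar k n 0, exVar k n 1} ^ n : Ideal (ExRing k n)) ⊔
  Ideal.span {exVar k n 2, exVar k n 3})

lemma coeff_exToZW_eq_zero (hn : n ≠ 0) {γ β : ℕ} {f : ExRing k n}
    (hf : f ∈ exIdeal k n 1 1 (γ + 1 : ℕ) (β + 1 : ℕ)) {δ : Fin 2 →₀ ℕ} (h0 : δ 0 = γ) (h1 : δ 1 = β) :
    MvPowerSeries.coeff δ (exToZW k hn f) = 0 := by
  obtain ⟨F, rfl⟩ := Ideal.Quotient.mk_surjective f
  have hadm : IsAdmissible n 1 1 (γ + 1 : ℕ) (β + 1 : ℕ) :=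
    Or.inl (by constructor <;> exact_mod_cast Nat.one_le_iff_ne_zero.2 hn)
  rw [exToZW, exKill_mk, MvPowerSeries.coeff_killCompl]
  refine hadm.mk_mem.1 hf _ fun i => ?_
  have e0 : (Finsupp.embDomain ⟨![2, 3], by decide⟩ δ : Fin 4 →₀ ℕ) 0 = 0 :=
    Finsupp.embDomain_of_notMem_range _ _ _ (by simp)
  have e1 : (Finsupp.embDomain ⟨![2, 3], by decide⟩ δ : Fin 4 →₀ ℕ) 1 = 0 :=
    Finsupp.embDomain_of_notMem_range _ _ _ (by simp)
  have e2 : (Finsupp.embDomain ⟨![2, 3], by decide⟩ δ : Fin 4 →₀ ℕ) 2 = δ 0 :=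
    Finsupp.embDomain_apply_self (f := ⟨![(2 : Fin 4), 3], by decide⟩) δ 0
  have e3 : (Finsupp.embDomain ⟨![2, 3], by decide⟩ δ : Fin 4 →₀ ℕ) 3 = δ 1 :=
    Finsupp.embDomain_apply_self (f := ⟨![(2 : Fin 4), 3], by decide⟩) δ 1
  fin_cases i
  · change (((_ : Fin 4 →₀ ℕ) 0 : ℕ) : ℕ∞) < 1
    rw [e0]; simp
  · change (((_ : Fin 4 →₀ ℕ) 1 : ℕ) : ℕ∞) < 1
    rw [e1]; simp
  · change (((_ : Fin 4 →₀ ℕ) 2 : ℕ) : ℕ∞) < (γ + 1 : ℕ)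
    rw [e2, h0]; exact_mod_cast Nat.lt_succ_self γ
  · change (((_ : Fin 4 →₀ ℕ) 3 : ℕ) : ℕ∞) < (β + 1 : ℕ)
    rw [e3, h1]; exact_mod_cast Nat.lt_succ_self β

/-- What the computation of the Sally module of `I = (x, y) ^ n + (z, w)` with respect to
`Q = (a, b)` uses about `Q`: modulo `(x, y)` its generators are `-z` and `-w`, `I ^ 3 ≤ Q I ^ 2`, and
the elements `x ^ i y ^ j z t` with `i + j ≥ n` and `i ≥ n` or `j ≥ J` become zero in the Sally module
after multiplication by `b t`. -/
structure IsSallyPair (hn : n ≠ 0) (a b : ExRing k n) (J : ℕ) : Prop where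
  J_le : J ≤ n
  map_a : exToZW k hn a = -MvPowerSeries.X 0
  map_b : exToZW k hn b = -MvPowerSeries.X 1
  pow_three_le : 𝐈 ^ 3 ≤ Ideal.span {a, b} * 𝐈 ^ 2
  pow_inf_le : ∀ s, Ideal.span {a, b} ^ s ⊓ 𝔷 ≤ 𝔷 * Ideal.span {a, b} ^ s
  le_sup : Ideal.span {a, b} ≤ 𝔷 ⊔ exIdeal k n n J ⊤ ⊤
  pow_two_le : 𝐈 ^ 2 ≤ 𝐈 * Ideal.span {a, b} ⊔ 𝔫 * Ideal.span {𝐳, 𝐰}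
  a_mul_w : ∀ i j, n ≤ i + j → a * (𝐱 ^ i * 𝐲 ^ j * 𝐰) = b * (𝐱 ^ i * 𝐲 ^ j * 𝐳)
  z_mul_z : ∀ i j, n ≤ i + j → 𝐳 * (𝐱 ^ i * 𝐲 ^ j * 𝐳) = -(𝐱 ^ i * 𝐲 ^ j * 𝐳) * a
  w_mul_z : ∀ i j, n ≤ i + j → 𝐰 * (𝐱 ^ i * 𝐲 ^ j * 𝐳) = -(𝐱 ^ i * 𝐲 ^ j * 𝐳) * b
  b_mul_mem : ∀ i j, n ≤ i + j → n ≤ i ∨ J ≤ j →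
    b * (𝐱 ^ i * 𝐲 ^ j * 𝐳) ∈ 𝐈 * Ideal.span {a, b} ^ 2

/-- The exponents of the monomials `x ^ i y ^ j z t` that form a composition series of the localized
Sally module. -/
def sallyCells (n J : ℕ) : Finset (ℕ × ℕ) :=
  ((Finset.range n) ×ˢ (Finset.range J)).filter fun q => n ≤ q.1 + q.2

lemma mem_sallyCells {n J i j : ℕ} : (i, j) ∈ sallyCells n J ↔ (i < n ∧ j < J) ∧ n ≤ i + j := by
  simp [sallyCells]

variable (n) in
/-- The element `x ^ i y ^ j z t` of `A[t]`. -/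
noncomputable def sallyMonomial (q : ℕ × ℕ) : (ExRing k n)[X] := monomial 1 (𝐱 ^ q.1 * 𝐲 ^ q.2 * 𝐳)

namespace IsSallyPair

variable {k} {hn : n ≠ 0} {a b : ExRing k n} {J : ℕ}

lemma le_comap (h : IsSallyPair k hn a b J) :
    Ideal.span {a, b} ≤ (orderIdeal k 1).comap (exToZW k hn) := by
  rw [Ideal.span_le]
  rintro _ (rfl | rfl) <;> rw [SetLike.mem_coe, Ideal.mem_comap, mem_orderIdeal,
    Nat.cast_one, MvPowerSeries.one_le_order_iff_constCoeff_eq_zero]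
  · rw [h.map_a, map_neg, MvPowerSeries.constantCoeff_X, neg_zero]
  · rw [h.map_b, map_neg, MvPowerSeries.constantCoeff_X, neg_zero]

lemma reesFiberIdeal_eq (h : IsSallyPair k hn a b J) :
    reesFiberIdeal (Ideal.span {a, b}) = leadingFormIdeal (exToZW k hn) h.le_comap := by
  refine reesFiberIdeal_eq_leadingFormIdeal (exToZW k hn) (s := 0) (t := 1) (by decide) h.map_a
    h.map_b h.le_comap ?_
  rw [maximalIdeal_eq_span, Ideal.span_le]
  rintro _ (rfl | rfl | rfl | rfl) <;> rw [SetLike.mem_coe, Ideal.mem_comap, mem_orderIdeal,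
    Nat.cast_one, MvPowerSeries.one_le_order_iff_constCoeff_eq_zero]
  · rw [exToZW_x, map_zero]
  · rw [exToZW_y, map_zero]
  · rw [exToZW_z, MvPowerSeries.constantCoeff_X]
  · rw [exToZW_w, MvPowerSeries.constantCoeff_X]

lemma isPrime (h : IsSallyPair k hn a b J) : (reesFiberIdeal (Ideal.span {a, b})).IsPrime := by
  rw [h.reesFiberIdeal_eq]; infer_instance

/-- Locally at `𝔪 A[Qt]`, the elements `a t` and `b t` are units. -/
lemma reesMonomial_notMem (h : IsSallyPair k hn a b J) {c : ExRing k n} {s : Fin 2}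
    (hc : c ∈ Ideal.span {a, b} ^ 1) (hs : exToZW k hn c = -MvPowerSeries.X s) :
    reesMonomial 1 hc ∉ reesFiberIdeal (Ideal.span {a, b}) := by
  rw [h.reesFiberIdeal_eq, reesMonomial_mem_leadingFormIdeal, hs, map_neg, neg_eq_zero]
  intro h0
  have h1 := congrArg (MvPowerSeries.coeff (Finsupp.single s 1)) h0
  rw [MvPowerSeries.coeff_homogeneousComponent, Finsupp.degree_single, if_pos rfl,
    MvPowerSeries.coeff_index_single_self_X, map_zero] at h1
  exact one_ne_zero h1

lemma mem_pow_one {c : ExRing k n} (hc : c ∈ Ideal.span {a, b}) : c ∈ Ideal.span {a, b} ^ 1 := by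
  rwa [pow_one]

/-- Locally, the monomials with exponents outside `sallyCells` vanish in the Sally module, as `b t`
kills them. -/
lemma sallyMonomial_mem (h : IsSallyPair k hn a b J) [(reesFiberIdeal (Ideal.span {a, b})).IsPrime]
    {G : Set (ℕ × ℕ)} {i j : ℕ} (hij : n ≤ i + j) (hG : (i, j) ∈ sallyCells n J → (i, j) ∈ G) :
    sallyMonomial k n (i, j) ∈ localSaturation (reesFiberIdeal (Ideal.span {a, b}))
      (idealTimesRees (Ideal.span {a, b}) 𝐈 (Ideal.span {a, b}) ⊔
        Submodule.span _ (sallyMonomial k n '' G)) := by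
  by_cases hF : (i, j) ∈ sallyCells n J
  · exact le_localSaturation _ (Submodule.mem_sup_right
      (Submodule.subset_span (Set.mem_image_of_mem _ (hG hF))))
  · have hb : b ∈ Ideal.span {a, b} := mem_span_pair_right a b
    refine mem_localSaturation_of_smul_mem (h.reesMonomial_notMem (mem_pow_one hb) h.map_b)
      (le_localSaturation _ (Submodule.mem_sup_left ?_))
    rw [sallyMonomial, reesMonomial_smul_monomial]
    refine monomial_mem_idealTimesRees (h.b_mul_mem i j hij ?_)
    rw [mem_sallyCells] at hF
    by_contra hcon
    push Not at hcon
    exact hF ⟨hcon, hij⟩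

/-- Locally, `𝔪 A[Qt]` sends a monomial into the span of the monomials of larger degree in `x`, `y`:
multiplication by `x` or `y` raises an exponent, and multiplication by `z` or `w` leads into
`I A[Qt]`. -/
lemma kill (h : IsSallyPair k hn a b J) [(reesFiberIdeal (Ideal.span {a, b})).IsPrime]
    {i j : ℕ} (hij : n ≤ i + j) {G : Set (ℕ × ℕ)}
    (hG : ∀ i' j', i + j < i' + j' → (i', j') ∈ sallyCells n J → (i', j') ∈ G) :
    reesFiberIdeal (Ideal.span {a, b}) ≤
      (localSaturation (reesFiberIdeal (Ideal.span {a, b}))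
        (idealTimesRees (Ideal.span {a, b}) 𝐈 (Ideal.span {a, b}) ⊔
        Submodule.span _ (sallyMonomial k n '' G))).comap
      (LinearMap.toSpanSingleton _ _ (sallyMonomial k n (i, j))) := by
  have hz : 𝐳 ∈ 𝐈 := Ideal.mem_sup_right (mem_span_pair_left _ _)
  have hQ : ∀ q ∈ Ideal.span {a, b}, monomial 1 (-(𝐱 ^ i * 𝐲 ^ j * 𝐳) * q) ∈
      localSaturation (reesFiberIdeal (Ideal.span {a, b}))
        (idealTimesRees (Ideal.span {a, b}) 𝐈 (Ideal.span {a, b}) ⊔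
        Submodule.span _ (sallyMonomial k n '' G)) := fun q hq =>
    le_localSaturation _ (Submodule.mem_sup_left (monomial_mem_idealTimesRees
      (Ideal.mul_mem_mul (neg_mem (Ideal.mul_mem_left _ _ hz)) (mem_pow_one hq))))
  refine Ideal.map_le_iff_le_comap.2 ?_
  rw [maximalIdeal_eq_span, Ideal.span_le]
  have hC : ∀ c : ExRing k n, algebraMap (ExRing k n) (reesAlgebra (Ideal.span {a, b})) c •
      sallyMonomial k n (i, j) = monomial 1 (c * (𝐱 ^ i * 𝐲 ^ j * 𝐳)) := fun c => C_mul_monomial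
  rintro _ (rfl | rfl | rfl | rfl) <;> rw [SetLike.mem_coe, Ideal.mem_comap, Submodule.mem_comap,
    LinearMap.toSpanSingleton_apply, hC]
  · rw [← mul_assoc, ← mul_assoc, ← pow_succ']
    exact h.sallyMonomial_mem (i := i + 1) (j := j) (by omega) (hG _ _ (by omega))
  · rw [mul_assoc, mul_left_comm, ← mul_assoc 𝐲, ← pow_succ', ← mul_assoc]
    exact h.sallyMonomial_mem (i := i) (j := j + 1) (by omega) (hG _ _ (by omega))
  · rw [h.z_mul_z i j hij]
    exact hQ _ (mem_span_pair_left _ _)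
  · rw [h.w_mul_z i j hij]
    exact hQ _ (mem_span_pair_right _ _)

/-- Locally, the monomials `x ^ i y ^ j z t` with `(i, j)` in `sallyCells` generate the Sally module. The
monomials with `w` in place of `z` are not needed, since `a w = b z` on `(x, y) ^ n` and `a t` is a
unit. -/
lemma generate (h : IsSallyPair k hn a b J) [(reesFiberIdeal (Ideal.span {a, b})).IsPrime] :
    idealTimesRees (Ideal.span {a, b}) 𝐈 𝐈 ≤
      localSaturation (reesFiberIdeal (Ideal.span {a, b}))
        (idealTimesRees (Ideal.span {a, b}) 𝐈 (Ideal.span {a, b}) ⊔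
        Submodule.span _ (sallyMonomial k n '' (sallyCells n J))) := by
  set N := localSaturation (reesFiberIdeal (Ideal.span {a, b}))
        (idealTimesRees (Ideal.span {a, b}) 𝐈 (Ideal.span {a, b}) ⊔
        Submodule.span _ (sallyMonomial k n '' (sallyCells n J))) with hN
  have hN0 : ∀ m, 𝐈 * Ideal.span {a, b} ^ m ≤ monomialIdeal N m := fun m f hf =>
    le_localSaturation _ (Submodule.mem_sup_left (monomial_mem_idealTimesRees hf))
  refine idealTimesRees_le h.pow_three_le (by simpa using hN0 0) (h.pow_two_le.trans ?_)
  refine sup_le (by simpa using hN0 1) ?_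
  have hz : ∀ i j, i + j = n → 𝐱 ^ i * 𝐲 ^ j * 𝐳 ∈ monomialIdeal N 1 := fun i j hij =>
    h.sallyMonomial_mem hij.ge id
  have hw : ∀ i j, i + j = n → 𝐱 ^ i * 𝐲 ^ j * 𝐰 ∈ monomialIdeal N 1 := fun i j hij => by
    have ha : a ∈ Ideal.span {a, b} := mem_span_pair_left a b
    have hb : b ∈ Ideal.span {a, b} := mem_span_pair_right a b
    refine mem_localSaturation_of_smul_mem (h.reesMonomial_notMem (mem_pow_one ha) h.map_a) ?_
    rw [reesMonomial_smul_monomial, h.a_mul_w i j hij.ge]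
    exact mul_mem_monomialIdeal_succ hb (hz i j hij)
  refine Ideal.mul_le.2 fun e he ζ hζ => ?_
  have hz' : 𝔫 ≤ (monomialIdeal N 1).colon {𝐳} :=
    span_pair_pow_le_iff.2 fun i j hij => Submodule.mem_colon_singleton.2 (hz i j hij)
  have hw' : 𝔫 ≤ (monomialIdeal N 1).colon {𝐰} :=
    span_pair_pow_le_iff.2 fun i j hij => Submodule.mem_colon_singleton.2 (hw i j hij)
  obtain ⟨c, d, rfl⟩ := Ideal.mem_span_pair.1 hζ
  have : e * (c * 𝐳 + d * 𝐰) = c * (e * 𝐳) + d * (e * 𝐰) := by ring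
  rw [this]
  exact add_mem (Ideal.mul_mem_left _ _ (Submodule.mem_colon_singleton.1 (hz' he)))
    (Ideal.mul_mem_left _ _ (Submodule.mem_colon_singleton.1 (hw' he)))

/-- Modulo `(x ^ (i + 1), y ^ (j + 1))` the ideal `Q` lies in `(z, w)`, so `𝔷 Q ^ (γ + β + 1)` has order at
least `γ + β + 2` in `z`, `w`. -/
lemma mul_pow_le (h : IsSallyPair k hn a b J) {i j γ β : ℕ} (hi : i < n) (hj : j < J) :
    𝔷 * Ideal.span {a, b} ^ (γ + β + 1) ≤
      exIdeal k n (i + 1 : ℕ) (j + 1 : ℕ) (γ + 1 + 1 : ℕ) (β + 1 : ℕ) := by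
  have h1 : exIdeal k n n J ⊤ ⊤ ≤ exIdeal k n (i + 1 : ℕ) (j + 1 : ℕ) (γ + 1 + 1 : ℕ) (β + 1 : ℕ) :=
    exIdeal_anti (by exact_mod_cast hi) (by exact_mod_cast hj) le_top le_top
  have h2 : 𝔷 ^ (γ + β + 1 + 1) ≤ exIdeal k n (i + 1 : ℕ) (j + 1 : ℕ) (γ + 1 + 1 : ℕ) (β + 1 : ℕ) := by
    rw [exIdeal_zw, span_pair_pow_le_iff]
    intro p q hpq
    by_cases hp : γ + 1 + 1 ≤ p
    · obtain ⟨p, rfl⟩ := Nat.exists_eq_add_of_le hp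
      rw [pow_add, mul_assoc, exIdeal_sup2]
      exact Ideal.mem_sup_right (Ideal.mul_mem_right _ _ (Ideal.mem_span_singleton_self _))
    · obtain ⟨q, rfl⟩ := Nat.exists_eq_add_of_le (show β + 1 ≤ q by omega)
      rw [pow_add, mul_left_comm, exIdeal_sup3]
      exact Ideal.mem_sup_right (Ideal.mul_mem_right _ _ (Ideal.mem_span_singleton_self _))
  refine (Ideal.mul_mono_right ((Ideal.pow_right_mono h.le_sup _).trans (sup_pow_le _ _ _))).trans ?_
  rw [Ideal.mul_sup]
  refine sup_le ?_ (Ideal.mul_le_right.trans h1)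
  have hp : 𝔷 ^ (γ + β + 1 + 1) = 𝔷 * 𝔷 ^ (γ + β + 1) := pow_succ' 𝔷 _
  exact hp ▸ h2

/-- Locally, a monomial is not in the span of the other monomials of at least its degree in `x`, `y`. -/
lemma independent (h : IsSallyPair k hn a b J) {i j : ℕ} (hF : (i, j) ∈ sallyCells n J)
    {u : reesAlgebra (Ideal.span {a, b})} (hu : u ∉ reesFiberIdeal (Ideal.span {a, b}))
    {G : Set (ℕ × ℕ)} (hG : ∀ i' j', (i', j') ∈ G → i + j ≤ i' + j' ∧ (i', j') ≠ (i, j)) :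
    u • sallyMonomial k n (i, j) ∉
      idealTimesRees (Ideal.span {a, b}) 𝐈 (Ideal.span {a, b}) ⊔
        Submodule.span _ (sallyMonomial k n '' G) := by
  -- Compare coefficients of `t ^ (m + 1)`, where `m` is a degree in which the leading form of `u`
  -- has a monomial `z ^ γ w ^ β`: `x ^ i y ^ j z uₘ` would lie in
  -- `(x ^ (i + 1), y ^ (j + 1), z ^ (γ + 2), w ^ (β + 1))`.
  intro hmem
  obtain ⟨⟨hi, hj⟩, hij⟩ := mem_sallyCells.1 hF
  rw [h.reesFiberIdeal_eq, mem_leadingFormIdeal] at hu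
  push Not at hu
  obtain ⟨m, hm⟩ := hu
  obtain ⟨δ, hδ⟩ : ∃ δ, MvPowerSeries.coeff δ
      ((exToZW k hn ((u : (ExRing k n)[X]).coeff m)).homogeneousComponent m) ≠ 0 := by
    by_contra hcon
    push Not at hcon
    exact hm (MvPowerSeries.ext fun δ => by rw [hcon, map_zero])
  rw [MvPowerSeries.coeff_homogeneousComponent, ite_ne_right_iff] at hδ
  obtain ⟨hdeg, hδ⟩ := hδ
  have hm' : m = δ 0 + δ 1 := by
    rw [← hdeg, Finsupp.degree_eq_sum, Fin.sum_univ_two]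
  obtain ⟨v, hv, e, he, hve⟩ := Submodule.mem_sup.1 hmem
  have hJn := h.J_le
  set L := exIdeal k n (i + 1 : ℕ) (j + 1 : ℕ) (δ 0 + 1 + 1 : ℕ) (δ 1 + 1 : ℕ) with hL
  have he1 : e.coeff (m + 1) ∈ L := by
    refine coeff_mem_of_mem_span ?_ he _
    rintro _ ⟨⟨i', j'⟩, hG', rfl⟩ l
    obtain ⟨h1, h2⟩ := hG i' j' hG'
    rw [sallyMonomial, coeff_monomial]
    split_ifs with hl
    · refine Ideal.mul_mem_right _ _ ?_
      by_cases h3 : i + 1 ≤ i'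
      · obtain ⟨i', rfl⟩ := Nat.exists_eq_add_of_le h3
        rw [pow_add, mul_assoc, hL, exIdeal_sup0]
        exact Ideal.mem_sup_right (Ideal.mul_mem_right _ _ (Ideal.mem_span_singleton_self _))
      · have h4 : j + 1 ≤ j' := by
          by_contra h5
          have h6 : i' = i := by omega
          have h7 : j' = j := by omega
          exact h2 (by rw [h6, h7])
        obtain ⟨j', rfl⟩ := Nat.exists_eq_add_of_le h4
        rw [pow_add, mul_left_comm, hL, exIdeal_sup1]
        exact Ideal.mem_sup_right (Ideal.mul_mem_right _ _ (Ideal.mem_span_singleton_self _))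
    · exact zero_mem _
  have he2 : e.coeff (m + 1) ∈ 𝔷 := by
    refine coeff_mem_of_mem_span ?_ he _
    rintro _ ⟨⟨i', j'⟩, hG', rfl⟩ l
    rw [sallyMonomial, coeff_monomial]
    split_ifs with hl
    · exact Ideal.mul_mem_left _ _ (z_mem k n)
    · exact zero_mem _
  have hcoeff : v.coeff (m + 1) + e.coeff (m + 1) =
      (u : (ExRing k n)[X]).coeff m * (𝐱 ^ i * 𝐲 ^ j * 𝐳) := by
    rw [← coeff_add, hve]
    exact coeff_mul_monomial _ _ _ _
  have hv1 : v.coeff (m + 1) ∈ L := by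
    have h1 : v.coeff (m + 1) ∈ 𝔷 := by
      rw [eq_sub_of_add_eq hcoeff]
      exact sub_mem (Ideal.mul_mem_left _ _ (Ideal.mul_mem_left _ _ (z_mem k n))) he2
    have h2 := h.pow_inf_le (m + 1) ⟨Ideal.mul_le_left (coeff_mem_of_mem_idealTimesRees hv (m + 1)), h1⟩
    have h3 := h.mul_pow_le (γ := δ 0) (β := δ 1) hi hj
    rw [← hm'] at h3
    exact h3 h2
  have hmemL : 𝐱 ^ i * (𝐲 ^ j * (𝐳 ^ 1 * (u : (ExRing k n)[X]).coeff m)) ∈ L := by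
    have : 𝐱 ^ i * (𝐲 ^ j * (𝐳 ^ 1 * (u : (ExRing k n)[X]).coeff m)) =
      v.coeff (m + 1) + e.coeff (m + 1) := by rw [hcoeff]; ring
    rw [this]
    exact add_mem hv1 he1
  have a1 : IsAdmissible n (i + 1 : ℕ) (j + 1 : ℕ) (δ 0 + 1 + 1 : ℕ) (δ 1 + 1 : ℕ) :=
    Or.inl ⟨by exact_mod_cast hi, by exact_mod_cast hj.trans_le hJn⟩
  have a2 : IsAdmissible n 1 (j + 1 : ℕ) (δ 0 + 1 + 1 : ℕ) (δ 1 + 1 : ℕ) :=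
    Or.inl ⟨by exact_mod_cast Nat.one_le_iff_ne_zero.2 hn, by exact_mod_cast hj.trans_le hJn⟩
  have a3 : IsAdmissible n 1 1 (δ 0 + 1 + 1 : ℕ) (δ 1 + 1 : ℕ) :=
    Or.inl ⟨by exact_mod_cast Nat.one_le_iff_ne_zero.2 hn,
      by exact_mod_cast Nat.one_le_iff_ne_zero.2 hn⟩
  have hcast : ∀ r s : ℕ, (((r + s : ℕ) : ℕ∞) - r) = s := fun r s => by
    rw [← ENat.natCast_sub, Nat.add_sub_cancel_left]
  rw [a1.x_pow_mul_mem, hcast, Nat.cast_one, a2.y_pow_mul_mem, hcast, Nat.cast_one,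
    a3.z_pow_mul_mem, add_comm (δ 0 + 1) 1, hcast] at hmemL
  exact hδ (coeff_exToZW_eq_zero k hn hmemL rfl rfl)

/-- The localized Sally module has length `#sallyCells`, the degree in `x`, `y` serving as weight. -/
theorem hasSallyRank (h : IsSallyPair k hn a b J) :
    HasSallyRank (Ideal.span {a, b}) 𝐈 (sallyCells n J).card := by
  have hp := h.isPrime
  refine ⟨hp, _, length_localizedModule_map_mkQ _ _ _ (sallyCells n J) (sallyMonomial k n)
    (fun q => q.1 + q.2) ?_ ?_ ?_ ?_, rfl⟩
  · rintro ⟨i, j⟩ hF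
    obtain ⟨-, hij⟩ := mem_sallyCells.1 hF
    have h1 : 𝐱 ^ i * 𝐲 ^ j ∈ 𝐈 := Ideal.mem_sup_left
      (Ideal.pow_le_pow_right hij (pow_mul_pow_mem_span_pair_pow 𝐱 𝐲 rfl))
    refine monomial_mem_idealTimesRees (Ideal.mul_mem_mul h1 ?_)
    rw [pow_one]
    exact Ideal.mem_sup_right (mem_span_pair_left _ _)
  · rintro ⟨i, j⟩ hF c hc
    obtain ⟨u, hu, h1⟩ := h.kill (mem_sallyCells.1 hF).2 (G := {q | q ∈ sallyCells n J ∧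
      i + j < q.1 + q.2}) (fun i' j' hlt hF' => ⟨hF', hlt⟩) hc
    exact ⟨u, hu, by rwa [mul_smul]⟩
  · rintro ⟨i, j⟩ hF u hu
    exact h.independent hF hu fun i' j' hG => hG.2
  · intro v hv
    exact h.generate hv

end IsSallyPair

end SallyRank


section Reduction

variable {R : Type*} [CommRing R]

/-- If `(α, β)` is a reduction of `𝔫` with `𝔫 ^ 2 ≤ (α, β) 𝔫`, the square of `𝔫 + (z, w)` is `𝔫 (z, w)`
up to multiples of `α - z` and `β - w`, since `α ≡ z` and `β ≡ w`. -/
lemma pow_two_le_mul_sup {𝔫 : Ideal R} {α β z w : R} (hα : α ∈ 𝔫) (hβ : β ∈ 𝔫)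
    (h : 𝔫 ^ 2 ≤ Ideal.span {α, β} * 𝔫) :
    (𝔫 ⊔ Ideal.span {z, w}) ^ 2 ≤
      (𝔫 ⊔ Ideal.span {z, w}) * Ideal.span {α - z, β - w} ⊔ 𝔫 * Ideal.span {z, w} := by
  have hq : ∀ c d, c * (α - z) + d * (β - w) ∈ Ideal.span {α - z, β - w} := fun c d =>
    Ideal.mem_span_pair.2 ⟨c, d, rfl⟩
  have hζ : ∀ c d, c * z + d * w ∈ Ideal.span {z, w} := fun c d => Ideal.mem_span_pair.2 ⟨c, d, rfl⟩
  rw [pow_two, Ideal.sup_mul, Ideal.mul_sup, Ideal.mul_sup]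
  refine sup_le (sup_le ?_ le_sup_right) (sup_le ?_ ?_)
  · rw [← pow_two]
    refine h.trans (Ideal.mul_le.2 fun r hr g hg => ?_)
    obtain ⟨c, d, rfl⟩ := Ideal.mem_span_pair.1 hr
    have : (c * α + d * β) * g = g * (c * (α - z) + d * (β - w)) + g * (c * z + d * w) := by ring
    rw [this]
    exact add_mem (Ideal.mem_sup_left (Ideal.mul_mem_mul (Ideal.mem_sup_left hg) (hq c d)))
      (Ideal.mem_sup_right (Ideal.mul_mem_mul hg (hζ c d)))
  · rw [mul_comm]
    exact le_sup_right
  · refine Ideal.mul_le.2 fun r hr g hg => ?_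
    obtain ⟨c, d, rfl⟩ := Ideal.mem_span_pair.1 hr
    have : (c * z + d * w) * g = (c * α + d * β) * g - g * (c * (α - z) + d * (β - w)) := by ring
    rw [this]
    exact sub_mem (Ideal.mem_sup_right (Ideal.mul_mem_mul
        (add_mem (𝔫.mul_mem_left _ hα) (𝔫.mul_mem_left _ hβ)) hg))
      (Ideal.mem_sup_left (Ideal.mul_mem_mul (Ideal.mem_sup_right hg) (hq c d)))

end Reduction

section SallyPairs

variable (k : Type u) [Field k] {n : ℕ}

local notation "𝐱" => exVar k n 0
local notation "𝐲" => exVar k n 1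
local notation "𝐳" => exVar k n 2
local notation "𝐰" => exVar k n 3
local notation "𝔟" => exIdeal k n n n ⊤ ⊤
local notation "𝔷" => exIdeal k n ⊤ ⊤ 1 1
local notation "𝔫" => (Ideal.span {exVar k n 0, exVar k n 1} ^ n : Ideal (ExRing k n))

lemma pow_mul_pow_mul_z_eq_zero {i j : ℕ} (h : n ≤ i ∨ n ≤ j) : 𝐱 ^ i * 𝐲 ^ j * 𝐳 = 0 := by
  rcases h with h | h
  · obtain ⟨i, rfl⟩ := Nat.exists_eq_add_of_le h
    linear_combination 𝐱 ^ i * 𝐲 ^ j * xn_mul_z k n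
  · obtain ⟨j, rfl⟩ := Nat.exists_eq_add_of_le h
    linear_combination 𝐱 ^ i * 𝐲 ^ j * yn_mul_z k n

lemma isSallyPair_Q (hn : n ≠ 0) : IsSallyPair k hn (𝐱 ^ n - 𝐳) (𝐲 ^ n - 𝐰) n where
  J_le := le_rfl
  map_a := by rw [map_sub, map_pow, exToZW_x, exToZW_z, zero_pow hn, zero_sub]
  map_b := by rw [map_sub, map_pow, exToZW_y, exToZW_w, zero_pow hn, zero_sub]
  pow_three_le := pow_three_le_Q k n
  pow_inf_le s := ((isRegularPair_Q_zw k n).pow_inf_eq s).le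
  le_sup := by
    rw [sup_comm]
    exact span_Q_le k n
  pow_two_le := pow_two_le_mul_sup (Ideal.pow_mem_pow (mem_span_pair_left _ _) n)
    (Ideal.pow_mem_pow (mem_span_pair_right _ _) n) (span_xy_pow_two_mul_le k n)
  a_mul_w i j _ := by
    linear_combination 𝐱 ^ i * 𝐲 ^ j * (xn_mul_w k n - yn_mul_z k n)
  z_mul_z i j _ := by linear_combination 𝐱 ^ i * 𝐲 ^ j * xn_mul_z k n
  w_mul_z i j _ := by linear_combination 𝐱 ^ i * 𝐲 ^ j * yn_mul_z k n
  b_mul_mem i j _ h := by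
    rw [pow_mul_pow_mul_z_eq_zero k h, mul_zero]
    exact zero_mem _

lemma theta_mem (hn : n ≠ 0) : 𝐱 * 𝐲 ^ (n - 1) ∈ 𝔫 := by
  simpa using pow_mul_pow_mem_span_pair_pow 𝐱 𝐲 (show 1 + (n - 1) = n by omega)

lemma theta_mul_pow_mul_eq_zero (hn : n ≠ 0) {i j : ℕ} (hij : n ≤ i + j) {f : ExRing k n}
    (hf : f ∈ 𝔷) : 𝐱 * 𝐲 ^ (n - 1) * (𝐱 ^ i * 𝐲 ^ j) * f = 0 := by
  refine mul_eq_zero_of_mem (span_xy_pow_two_le k n ?_) hf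
  have hp : 𝔫 ^ 2 = 𝔫 * 𝔫 := pow_two 𝔫
  rw [hp]
  exact Ideal.mul_mem_mul (theta_mem k hn)
    (Ideal.pow_le_pow_right hij (pow_mul_pow_mem_span_pair_pow 𝐱 𝐲 rfl))

lemma isSallyPair_Q' (hn : 2 ≤ n) :
    IsSallyPair k (Nat.ne_of_gt (by omega : 0 < n)) (𝐱 * 𝐲 ^ (n - 1) - 𝐳) (𝐱 ^ n + 𝐲 ^ n - 𝐰) (n - 1) := by
  have hn0 : n ≠ 0 := by omega
  have hξ : 𝐱 ^ n + 𝐲 ^ n ∈ 𝔫 := add_mem (Ideal.pow_mem_pow (mem_span_pair_left _ _) n)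
    (Ideal.pow_mem_pow (mem_span_pair_right _ _) n)
  exact {
    J_le := Nat.sub_le n 1
    map_a := by rw [map_sub, map_mul, exToZW_x, exToZW_z, zero_mul, zero_sub]
    map_b := by
      rw [map_sub, map_add, map_pow, map_pow, exToZW_x, exToZW_y, exToZW_w, zero_pow hn0, add_zero,
        zero_sub]
    pow_three_le := pow_three_le_Q' k n hn
    pow_inf_le := fun s => by
      have := (isRegularPair_Q'_zw k n hn).pow_inf_eq s
      rw [Set.pair_comm] at this
      exact this.le
    le_sup := by
      rw [exIdeal_xy, Ideal.span_le]
      have hy : 𝐲 ^ n = 𝐲 * 𝐲 ^ (n - 1) := by rw [← pow_succ']; congr 1; omega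
      rintro _ (rfl | rfl)
      · exact sub_mem (Ideal.mem_sup_right (Ideal.mul_mem_left _ _ (mem_span_pair_right _ _)))
          (Ideal.mem_sup_left (z_mem k n))
      · refine sub_mem (Ideal.mem_sup_right (add_mem (mem_span_pair_left _ _) ?_))
          (Ideal.mem_sup_left (w_mem k n))
        rw [hy]
        exact Ideal.mul_mem_left _ _ (mem_span_pair_right _ _)
    pow_two_le := pow_two_le_mul_sup (theta_mem k hn0) hξ (span_xy_pow_two_mul_le' k n hn)
    a_mul_w := fun i j hij => by
      linear_combination theta_mul_pow_mul_eq_zero k hn0 hij (w_mem k n) -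
        𝐱 ^ i * 𝐲 ^ j * (xn_mul_z k n + yn_mul_z k n)
    z_mul_z := fun i j hij => by
      linear_combination theta_mul_pow_mul_eq_zero k hn0 hij (z_mem k n)
    w_mul_z := fun i j hij => by
      linear_combination 𝐱 ^ i * 𝐲 ^ j * (xn_mul_z k n + yn_mul_z k n)
    b_mul_mem := fun i j hij h => by
      by_cases h0 : n ≤ i ∨ n ≤ j
      · rw [pow_mul_pow_mul_z_eq_zero k h0, mul_zero]
        exact zero_mem _
      · obtain ⟨i, rfl⟩ := Nat.exists_eq_add_of_le (show 1 ≤ i by omega)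
        obtain ⟨j, rfl⟩ := Nat.exists_eq_add_of_le (show n - 1 ≤ j by omega)
        -- With `θ = x y ^ (n - 1)` and `ξ = x ^ n + y ^ n`, one has `b θ z = ξ a ^ 2 - θ a b`.
        have e : (𝐱 ^ n + 𝐲 ^ n - 𝐰) * (𝐱 ^ (1 + i) * 𝐲 ^ (n - 1 + j) * 𝐳) =
            (𝐱 ^ i * 𝐲 ^ j * (𝐱 ^ n + 𝐲 ^ n)) *
              ((𝐱 * 𝐲 ^ (n - 1) - 𝐳) * (𝐱 * 𝐲 ^ (n - 1) - 𝐳)) -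
            (𝐱 ^ i * 𝐲 ^ j * (𝐱 * 𝐲 ^ (n - 1))) *
              ((𝐱 * 𝐲 ^ (n - 1) - 𝐳) * (𝐱 ^ n + 𝐲 ^ n - 𝐰)) := by
          rw [pow_add, pow_add]
          linear_combination 𝐱 ^ i * 𝐲 ^ j * ((2 * (𝐱 * 𝐲 ^ (n - 1)) - 𝐳) *
            (xn_mul_z k n + yn_mul_z k n) - theta_sq_mul_eq_zero k hn (w_mem k n))
        rw [e, pow_two]
        exact sub_mem
          (Ideal.mul_mem_mul (Ideal.mul_mem_left _ _ (Ideal.mem_sup_left hξ))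
            (Ideal.mul_mem_mul (mem_span_pair_left _ _) (mem_span_pair_left _ _)))
          (Ideal.mul_mem_mul (Ideal.mul_mem_left _ _ (Ideal.mem_sup_left (theta_mem k hn0)))
            (Ideal.mul_mem_mul (mem_span_pair_left _ _) (mem_span_pair_right _ _))) }

/-- The additional exponents are the `(i, n - 1)` with `1 ≤ i < n`. -/
lemma card_sallyCells_self (n : ℕ) :
    (sallyCells n n).card = (sallyCells n (n - 1)).card + (n - 1) := by
  have h1 : sallyCells n n = sallyCells n (n - 1) ∪ Finset.Ico 1 n ×ˢ {n - 1} := by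
    ext ⟨i, j⟩
    simp only [mem_sallyCells, Finset.mem_union, Finset.mem_product, Finset.mem_Ico,
      Finset.mem_singleton]
    omega
  rw [h1, Finset.card_union_of_disjoint]
  · simp
  · rw [Finset.disjoint_left]
    rintro ⟨i, j⟩ h2 h3
    simp only [mem_sallyCells, Finset.mem_product, Finset.mem_Ico, Finset.mem_singleton] at h2 h3
    omega

end SallyPairs


/-! ### Hilbert coefficients and the conclusion -/

section HilbertCoeff

variable {R : Type*} [CommRing R]

lemma HasLength.of_colength {J : Ideal R} {L : ℕ} {c : ℤ} (h : J.colength = L) (hc : (L : ℤ) = c) :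
    HasLength R (R ⧸ J) c := ⟨L, h, hc⟩

/-- In a ring of dimension two, a Hilbert function `e₀ binom(s + 2, 2) + e (s + 1)` has the Hilbert
coefficients `e₀`, `-e` and `0`. -/
lemma isHilbertCoeff_of_hasLength {J : Ideal R} (hdim : ringKrullDim R = 2) {e₀ e : ℤ}
    (h : ∀ s : ℕ, HasLength R (R ⧸ J ^ (s + 1))
      (e₀ * ((s + 2).choose 2 : ℤ) + e * ((s + 1).choose 1 : ℤ))) :
    IsHilbertCoeff J 0 e₀ ∧ IsHilbertCoeff J 1 (-e) := by
  have key : ∀ i : ℕ, i ≤ 2 → IsHilbertCoeff J i (if i = 0 then e₀ else if i = 1 then -e else 0) := by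
    intro i hi
    refine ⟨2, by exact_mod_cast hdim, hi, fun i => if i = 0 then e₀ else if i = 1 then -e else 0, rfl,
      Filter.Eventually.of_forall fun s => ?_⟩
    convert h s using 1
    simp [Finset.sum_range_succ]
  exact ⟨key 0 (by omega), key 1 (by omega)⟩

end HilbertCoeff


theorem mainTheorem4 {k : Type u} [Field k] (n : ℕ) (hn : 2 ≤ n)
    (x y z w : ExRing k n)
    (hx : x = exVar k n 0) (hy : y = exVar k n 1) (hz : z = exVar k n 2) (hw : w = exVar k n 3)
    (𝔪 Q Q' 𝔠 I : Ideal (ExRing k n))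
    (h𝔪 : 𝔪 = IsLocalRing.maximalIdeal (ExRing k n))
    (hQ : Q = Ideal.span {x ^ n - z, y ^ n - w})
    (hQ' : Q' = Ideal.span {x * y ^ (n - 1) - z, x ^ n + y ^ n - w})
    (h𝔠 : 𝔠 = Ideal.span {x ^ n, y ^ n, z, w})
    (hI : I = 𝔪 ^ n + Ideal.span {z, w}) :
    -- dimension, depth and first local cohomology
    (ringKrullDim (ExRing k n) = 2 ∧ localDepth (ExRing k n) = 1 ∧
      Nonempty ((localCohomology 𝔪 1).obj (ModuleCat.of (ExRing k n) (ExRing k n)) ≅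
        ModuleCat.of (ExRing k n) (ExRing k n ⧸ 𝔠))) ∧
    (IsParameterIdeal Q ∧ IsParameterIdeal Q') ∧
    -- (1) integral closures
    (idealIntegralClosure Q = I ∧ idealIntegralClosure Q' = I ∧ idealIntegralClosure 𝔠 = I) ∧
    -- (2) multiplicities
    (IsHilbertCoeff Q 0 (2 * (n : ℤ) ^ 2) ∧ IsHilbertCoeff Q' 0 (2 * (n : ℤ) ^ 2)) ∧
    -- (3) first Hilbert coefficients
    (IsHilbertCoeff Q' 1 (-(n : ℤ) ^ 2 + n - 1) ∧ IsHilbertCoeff Q 1 (-(n : ℤ) ^ 2) ∧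
      0 > -(n : ℤ) ^ 2 + n - 1 ∧ -(n : ℤ) ^ 2 + n - 1 > -(n : ℤ) ^ 2 ∧
      1 < (firstCoeffSet 𝔠).encard) ∧
    -- (4) Hilbert functions
    (∀ l : ℕ,
      HasLength (ExRing k n) (ExRing k n ⧸ Q ^ (l + 1))
        (2 * (n : ℤ) ^ 2 * ((l + 2).choose 2 : ℤ) + (n : ℤ) ^ 2 * ((l + 1).choose 1 : ℤ)) ∧
      HasLength (ExRing k n) (ExRing k n ⧸ Q' ^ (l + 1))
        (2 * (n : ℤ) ^ 2 * ((l + 2).choose 2 : ℤ) +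
          ((n : ℤ) ^ 2 - n + 1) * ((l + 1).choose 1 : ℤ))) ∧
    -- (5) a non-superficial generator, and failure of the Cohen-Macaulay property
    (¬ IsSuperficial Q' (x ^ n + y ^ n - w) ∧ ¬ IsLocallyCohenMacaulay (projRees Q')) ∧
    -- (6) ranks of the Sally modules
    (∃ r r' : ℤ, HasSallyRank Q I r ∧ HasSallyRank Q' I r' ∧ r = r' + ((n : ℤ) - 1)) := by
  have hn0 : n ≠ 0 := by omega
  subst hx hy hz hw h𝔪 hQ hQ' h𝔠 hI
  have hdim := ringKrullDim_exRing k hn0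
  have hQp := isParameterIdeal_span_pair k hn0 (span_Q_le_maximalIdeal k hn0)
    (maximalIdeal_le_radical_Q k n)
  have hQp' := isParameterIdeal_span_pair k hn0 (span_Q'_le_maximalIdeal k hn)
    (maximalIdeal_le_radical_Q' k hn)
  rw [Submodule.add_eq_sup, maximalIdeal_pow_sup]
  have hI := idealIntegralClosure_eq k n hn0 le_rfl ((span_Q_le_c k n).trans (span_c_le k n))
    (pow_three_le_Q k n)
  have hI' := idealIntegralClosure_eq k n hn0 le_rfl (span_Q'_le k n hn) (pow_three_le_Q' k n hn)
  have hIc := idealIntegralClosure_eq k n hn0 (span_Q_le_c k n) (span_c_le k n) (pow_three_le_Q k n)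
  have hle : n ≤ n ^ 2 := Nat.le_self_pow two_ne_zero n
  have hl : ∀ l : ℕ, _ := fun l => HasLength.of_colength (colength_Q_pow k n l)
    (c := 2 * (n : ℤ) ^ 2 * ((l + 2).choose 2 : ℤ) + (n : ℤ) ^ 2 * ((l + 1).choose 1 : ℤ))
    (by rw [Nat.choose_one_right]; push_cast; ring)
  have hl' : ∀ l : ℕ, _ := fun l => HasLength.of_colength (colength_Q'_pow k n hn l)
    (c := 2 * (n : ℤ) ^ 2 * ((l + 2).choose 2 : ℤ) +
      ((n : ℤ) ^ 2 - n + 1) * ((l + 1).choose 1 : ℤ))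
    (by rw [Nat.choose_one_right]; push_cast [Nat.cast_sub hle]; ring)
  obtain ⟨h0, h1⟩ := isHilbertCoeff_of_hasLength hdim hl
  obtain ⟨h0', h1'⟩ := isHilbertCoeff_of_hasLength hdim hl'
  have hneg : -((n : ℤ) ^ 2 - n + 1) = -(n : ℤ) ^ 2 + n - 1 := by ring
  rw [hneg] at h1'
  have hn' : (2 : ℤ) ≤ n := by exact_mod_cast hn
  have hlt : -(n : ℤ) ^ 2 + n - 1 > -(n : ℤ) ^ 2 := by linarith
  refine ⟨⟨hdim, localDepth_exRing k hn0, ?_⟩, ⟨hQp, hQp'⟩, ⟨hI, hI', hIc⟩, ⟨h0, h0'⟩,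
    ⟨h1', h1, by nlinarith, hlt, ?_⟩, fun l => ⟨hl l, hl' l⟩,
    ⟨not_isSuperficial k hn, not_isLocallyCohenMacaulay k hn⟩, ?_⟩
  · rw [span_c_eq]
    exact nonempty_localCohomology_exRing_iso k n hn0
  · exact Set.one_lt_encard_iff.2 ⟨_, _, ⟨_, hQp', hI'.trans hIc.symm, h1'⟩,
      ⟨_, hQp, hI.trans hIc.symm, h1⟩, hlt.ne'⟩
  · refine ⟨_, _, (isSallyPair_Q k hn0).hasSallyRank, (isSallyPair_Q' k hn).hasSallyRank, ?_⟩
    rw [card_sallyCells_self n]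
    push_cast [Nat.cast_sub (by omega : 1 ≤ n)]
    ring
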